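/- **Setting.** Fix $g\ge 2$, $d=2g$, and a permutation $\sigma$ of $\{1,\dots,d\}$ whose suspension surface has exactly one marked point (hence genus $g$). A $\mathcal C^3$-generalised interval exchange transformation (GIET) with permutation $\sigma$ is a bijection $T$ of $[0,1)$ for which there are partitions of $[0,1)$ into consecutive intervals $I^t_1,\dots,I^t_d$ and $I^b_1,\dots,I^b_d$ such that $T$ restricted to $I_i^t$ extends to an orientation preserving $\mathcal C^3$-diffeomorphism of the closure of $I^t_i$ onto the closure of $I^b_{\sigma(i)}$. Rescaling affinely the branches of $T$, one obtains diffeomorphisms $\varphi_T^1,\dots,\varphi_T^d\in \mathrm{Diff}^3_+([0,1])$, and $T$ is determined by the lengths $|I^t_i|$, $|I^b_j|$ and the $\varphi^i_T$. For $k\le 3$ put $$d_{\mathcal C^k}(S,T)=\sum_i \big||I_i^t(S)|-|I_i^t(T)|\big|+\sum_j \big||I_j^b(S)|-|I_j^b(T)|\big|+\sum_i\|\varphi_S^i-\varphi_T^i\|_{\mathcal C^k},\qquad \|f\|_{\mathcal C^k}=\max_{0\le l\le k}\sup_{[0,1]}|f^{(l)}|.$$ Let $\mathcal M$ be the set of Möbius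 (projective) GIETs with permutation $\sigma$, i.e. those all of whose $\varphi^i_T$ are restrictions to $[0,1]$ of projective transformations $x\mapsto\frac{ax+b}{cx+e}$. Let $\eta_T=D\log DT$ be the non-linearity of $T$. Let $T_0$ be a standard interval exchange transformation (a translation on each $I^t_i$) with permutation $\sigma$, without connections (no forward iterate $T_0^m(u)$, $m\geq 1$, of a discontinuity $u$ is a discontinuity), and self-similar: for some $x_0\in(0,1)$ the first return map of $T_0$ to $[0,x_0)$, rescaled affinely to $[0,1)$, equals $T_0$. Its intersection matrix $A$ has as entry $a_{ij}$ the number of floors of the tower over the $i$-th exchanged interval of this first return map (the iterates of that interval under $T_0$ before it returns to $[0,x_0)$) that meet the $j$-th exchanged interval of $T_0$. Assume that $A$ is hyperbolic, i.e. has no complex eigenvalue of modulus $1$. **Theorem.** There are a neighbourhood $\mathcal W$ of $T_0$, for $d_{\mathcal C^3}$, in the space of $\mathcal C^3$-GIETs with permutation $\sigma$, a function $X$ continuous on $\mathcal W$ for $d_{\mathcal C^3}$ with $X(T_0)=x_0$, and a renormalisation operator $\mathcal R$ on $\mathcal W$ with $\mathcal R T_0=T_0$ (for every $T\in\mathcal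 W$, $0<X(T)<1$ and $\mathcal RT$ is the first return map of $T$ to $[0,X(T))$, rescaled affinely to $[0,1)$, which is again a $\mathcal C^3$-GIET with permutation $\sigma$), such that the following holds. Let $$\mathcal K=\{T:\ \mathcal R^n T\in\mathcal W \text{ for all } n\ge 0\}$$ be the pre-stable set, and $\mathcal K_0=\{T\in\mathcal K:\ \int_0^1\eta_T=0\}$. 1. There is a constant $\rho_1\in(0,1)$ such that for all $T\in\mathcal K$ there exists $C_T$ with $$d_{\mathcal C^1}(\mathcal R^nT,\mathcal M)=\inf_{P\in\mathcal M}d_{\mathcal C^1}(\mathcal R^nT,P)\le C_T\,\rho_1^n\qquad\text{for all } n\ge 0.$$ 2. There is a constant $\rho_2\in(0,1)$ such that for all $T\in\mathcal K_0$ there exists $D_T$ with $$d_{\mathcal C^1}(\mathcal R^nT,T_0)\le D_T\,\rho_2^n\qquad\text{for all } n\ge 0.$$ -/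

import Mathlib

open Set

noncomputable section

/-- An orientation preserving `C³` diffeomorphism of `[0,1]`. It is stored as a function on `ℝ`
whose values outside `[0,1]` are normalised to the identity, so that two such
diffeomorphisms are equal as soon as they agree on `[0,1]`. -/
@[ext]
structure IntervalDiffeo where
  toFun : ℝ → ℝ
  contDiffOn : ContDiffOn ℝ 3 toFun (Icc 0 1)
  map_zero : toFun 0 = 0
  map_one : toFun 1 = 1
  deriv_pos : ∀ x ∈ Icc (0 : ℝ) 1, 0 < derivWithin toFun (Icc 0 1) x
  eq_self : ∀ x, x ∉ Icc (0 : ℝ) 1 → toFun x = x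

namespace IntervalDiffeo

/-- The `C^k` distance `max_{i ≤ k} sup_{[0,1]} |f^{(i)} - g^{(i)}|` (for `k ≤ 3`). -/
def cDist (k : ℕ) (f g : IntervalDiffeo) : ℝ :=
  ⨆ i : Fin (k + 1), ⨆ x : Icc (0 : ℝ) 1,
    |iteratedDerivWithin i f.toFun (Icc 0 1) x - iteratedDerivWithin i g.toFun (Icc 0 1) x|

/-- `f` is the restriction to `[0,1]` of a projective (Möbius) transformation. -/
def IsMoebius (f : IntervalDiffeo) : Prop :=
  ∃ a b c e : ℝ, a * e - b * c = 1 ∧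
    ∀ x ∈ Icc (0 : ℝ) 1, c * x + e ≠ 0 ∧ f.toFun x = (a * x + b) / (c * x + e)

end IntervalDiffeo

/-- A `C³` generalised interval exchange transformation on `d` intervals with permutation `σ`, in
the coordinates `(A_T, φ_1, …, φ_d)`. The `i`-th top interval (from the left) has length `top i`,
the `j`-th bottom interval (from the left) has length `bot j`, and `T` maps the `i`-th top interval
onto the `σ i`-th bottom interval; up to affine rescaling at source and target, this branch
is `φ i`. The two families of lengths are the datum of the affine interval exchange `A_T`. -/
@[ext]
structure GIET {d : ℕ} (σ : Equiv.Perm (Fin d)) where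
  top : Fin d → ℝ
  bot : Fin d → ℝ
  φ : Fin d → IntervalDiffeo
  top_pos : ∀ i, 0 < top i
  bot_pos : ∀ j, 0 < bot j
  sum_top : ∑ i, top i = 1
  sum_bot : ∑ j, bot j = 1

namespace GIET

variable {d : ℕ} {σ : Equiv.Perm (Fin d)}

/-- Left endpoint of the `i`-th top interval. -/
def topLeft (T : GIET σ) (i : Fin d) : ℝ := ∑ j ∈ Finset.Iio i, T.top j

/-- Left endpoint of the `j`-th bottom interval. -/
def botLeft (T : GIET σ) (j : Fin d) : ℝ := ∑ i ∈ Finset.Iio j, T.bot i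

/-- The `i`-th top interval, closed on the left and open on the right. -/
def topInterval (T : GIET σ) (i : Fin d) : Set ℝ := Ico (T.topLeft i) (T.topLeft i + T.top i)

/-- The map `T : [0,1) → [0,1)` (right-continuous at the discontinuities). Exactly one summand is
non-trivial for `x ∈ [0,1)`; the value is `0` for `x ∉ [0,1)`. -/
def map (T : GIET σ) (x : ℝ) : ℝ :=
  ∑ i, (T.topInterval i).indicator
    (fun y => T.botLeft (σ i) + T.bot (σ i) * (T.φ i).toFun ((y - T.topLeft i) / T.top i)) x

/-- `T` is a standard interval exchange transformation: a translation on each top interval. -/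
def IsStandard (T : GIET σ) : Prop :=
  (∀ i, T.bot (σ i) = T.top i) ∧ ∀ i, ∀ x ∈ Icc (0 : ℝ) 1, (T.φ i).toFun x = x

/-- `T` is a Möbius (projective) interval exchange transformation. -/
def IsMoebius (T : GIET σ) : Prop := ∀ i, (T.φ i).IsMoebius

/-- No forward orbit of a discontinuity meets a discontinuity (Keane's condition). -/
def NoConnection (T : GIET σ) : Prop :=
  ∀ i j : Fin d, 0 < (i : ℕ) → 0 < (j : ℕ) → ∀ m : ℕ, 0 < m →
    T.map^[m] (T.topLeft i) ≠ T.topLeft j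

/-- The `C^k` distance on generalised interval exchange transformations (for `k ≤ 3`). -/
def cDist (k : ℕ) (S T : GIET σ) : ℝ :=
  ∑ i, |S.top i - T.top i| + ∑ j, |S.bot j - T.bot j| + ∑ i, (S.φ i).cDist k (T.φ i)

/-- The `C¹` distance from `T` to a set of generalised interval exchange transformations. -/
def c1DistTo (T : GIET σ) (M : Set (GIET σ)) : ℝ := sInf ((fun P => cDist 1 T P) '' M)

/-- The non-linearity `η_T = D log DT`. -/
def nonlinearity (T : GIET σ) (x : ℝ) : ℝ := deriv (fun y => Real.log (deriv T.map y)) x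

/-- The total non-linearity `∫₀¹ η_T`. -/
def totalNonlinearity (T : GIET σ) : ℝ := ∫ x in (0 : ℝ)..1, T.nonlinearity x

/-- `n` is the first return time of `y` to `J` under `f`. -/
def IsFirstReturnTime (f : ℝ → ℝ) (J : Set ℝ) (y : ℝ) (n : ℕ) : Prop :=
  0 < n ∧ f^[n] y ∈ J ∧ ∀ m, 0 < m → m < n → f^[m] y ∉ J

/-- `T'` is the first return map of `T` to `[0,x)`, rescaled affinely to `[0,1)`. In particular
that first return map is again a generalised interval exchange with permutation `σ`. -/
def IsRescaledFirstReturn (x : ℝ) (T T' : GIET σ) : Prop :=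
  0 < x ∧ x < 1 ∧ ∀ y ∈ Ico (0 : ℝ) 1, ∃ n : ℕ,
    IsFirstReturnTime T.map (Ico 0 x) (x * y) n ∧ T.map^[n] (x * y) = x * T'.map y

/-- The `i`-th exchanged interval of the first return map of `T` to `[0,x)`, when `T` is
self-similar at `x`: the `i`-th top interval of `T`, scaled down by `x`. -/
def baseInterval (T : GIET σ) (x : ℝ) (i : Fin d) : Set ℝ :=
  Ico (x * T.topLeft i) (x * (T.topLeft i + T.top i))

/-- The first return time to `[0,x)` of the left endpoint of the `i`-th base interval. -/
def returnTime (T : GIET σ) (x : ℝ) (i : Fin d) : ℕ :=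
  sInf {n : ℕ | IsFirstReturnTime T.map (Ico 0 x) (x * T.topLeft i) n}

/-- The intersection (Rauzy) matrix of `T`, self-similar at `x`: entry `(i,j)` counts the floors
`T^m(I)`, `0 ≤ m <` return time, of the tower over the `i`-th base interval `I` that
meet the `j`-th top interval of `T`. -/
def intersectionMatrix (T : GIET σ) (x : ℝ) : Matrix (Fin d) (Fin d) ℕ :=
  Matrix.of fun i j =>
    {m : ℕ | m < T.returnTime x i ∧
      ((T.map^[m] '' T.baseInterval x i) ∩ T.topInterval j).Nonempty}.ncard

/-- `R` is a renormalisation operator at `T₀` on the `C³`-neighbourhood `W`: `R T` is the rescaled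
first return map of `T` to `[0, X T)`, where `X T` depends continuously on `T` and
`X T₀ = x₀`. -/
structure IsRenormalisationOperator (T₀ : GIET σ) (x₀ : ℝ) (W : Set (GIET σ))
    (X : GIET σ → ℝ) (R : GIET σ → GIET σ) : Prop where
  nhd : ∃ ε > 0, ∀ T : GIET σ, cDist 3 T T₀ < ε → T ∈ W
  base_point : X T₀ = x₀
  base_fixed : R T₀ = T₀
  continuous : ∀ T ∈ W, ∀ ε > 0, ∃ δ > 0, ∀ T' ∈ W, cDist 3 T' T < δ → |X T' - X T| < ε
  first_return : ∀ T ∈ W, IsRescaledFirstReturn (X T) T (R T)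

/-- The pre-stable set: all the renormalisations of `T` are defined and stay in `W`. -/
def preStable (W : Set (GIET σ)) (R : GIET σ → GIET σ) : Set (GIET σ) :=
  {T | ∀ n : ℕ, R^[n] T ∈ W}

end GIET

/-- Vertex identifications of the suspension polygon of `σ`, whose top vertices are
`inl 0, …, inl d` and bottom vertices `inr 0, …, inr d`: the two extreme vertices are
common to top and bottom, and the `i`-th top side is glued by translation to the
`σ i`-th bottom side. -/
inductive VertexGlue {d : ℕ} (σ : Equiv.Perm (Fin d)) : Fin (d + 1) ⊕ Fin (d + 1) →
    Fin (d + 1) ⊕ Fin (d + 1) → Prop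
  | first : VertexGlue σ (Sum.inl 0) (Sum.inr 0)
  | last : VertexGlue σ (Sum.inl (Fin.last d)) (Sum.inr (Fin.last d))
  | left (i : Fin d) : VertexGlue σ (Sum.inl i.castSucc) (Sum.inr (σ i).castSucc)
  | right (i : Fin d) : VertexGlue σ (Sum.inl i.succ) (Sum.inr (σ i).succ)

/-- The number `s` of marked points of the surface obtained by suspension. -/
def numMarkedPoints {d : ℕ} (σ : Equiv.Perm (Fin d)) : ℕ := Nat.card (Quot (VertexGlue σ))

/-- A matrix is hyperbolic if it has no complex eigenvalue of modulus one. -/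
def IsHyperbolicMatrix {d : ℕ} (A : Matrix (Fin d) (Fin d) ℕ) : Prop :=
  ∀ z ∈ spectrum ℂ (A.map (Nat.cast : ℕ → ℂ)), ‖z‖ ≠ 1

end

/-! The neighbourhood is a small `C³`-ball around `T₀` on which inducing keeps one fixed system of
towers (heights `N`, itineraries `w`). An orbit that stays in the ball obeys almost linear
recursions whose matrices come from `T₀`.

Combinatorics. A single marked point forbids four patterns of `σ` (`perm_first_ne`, `perm_last_ne`,
`perm_succ_ne`, `perm_succ_ne_of_last`), since each would close up a proper class of vertices. With
the absence of connections this makes the return time of `T₀` constant on every base interval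
(`exists_towers`): a discontinuity crossed in the interior would have to heal before the return,
which produces a connection between left germs or a forbidden pattern. The two-sided orbit of `0`
visits every interval that starts at a discontinuity (`exists_orbit_zero_mem_Ico`), so the
discontinuities correspond bijectively to the nonzero left endpoints of the base, whose orbits reach
them (`exists_towers_frame`). Near `T₀` the left endpoints are defined by pulling the
discontinuities back; what remains to be checked is essentially a finite list of strict
inequalities, hence stable, and the left endpoints determine the towers (`TowerFrame.towers`). The
rescaled return map is the renormalisation (`exists_giet`, `exists_renormalisation`).

Projective limit. The Schwarzian derivative is a cocycle weighted by the square of the derivative.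
Because the floors tile the exchanged intervals, the sum over the branches of the bounds for the
Schwarzian divided by the interval length is multiplied by about `x₀ < 1` at each step
(`schwarzian_contraction`). Since `G = (Df)^(-1/2)` solves `G'' = -(S/2) G`, a small Schwarzian
derivative means that `f` is close to a projective map (`exists_moebius_near`). This gives the first
assertion.

Affine limit. The total non-linearities of the branches are transformed, up to small errors, by the
matrix with entries `x₀ λ_i a_ij / λ_j`, where `λ` is the length vector of `T₀`. Its columns have
sum one because `λ` is an eigenvector, and some power has a positive row
(`exists_intersectionMatrix_row_pos`), so it contracts vectors of zero sum
(`exists_rate_of_stochastic`); the sum is the invariant total non-linearity (`sum_totalNonlin`).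
Hence the branches become affine. The logarithms of the slopes then follow the intersection matrix
up to exponentially small errors and remain bounded, so hyperbolicity makes them decay: contracted
directions are followed forwards, expanded ones are solved from the future
(`IsHyperbolicMatrix.exists_rate`). Finally the lengths at one time are expressed by those at the
next one through the transposed stochastic matrix, and this backward recursion forces them to
converge to `λ` (`exists_backward_of_stochastic`). `exists_convergence_rate` combines these
estimates. -/

noncomputable section

open Filter Topology

/-! ### Partial sums of a length vector and the cells they bound. -/

/-- Partial sums `c 0 + ⋯ + c (k - 1)`. -/
def partialSum {d : ℕ} (c : Fin d → ℝ) (k : ℕ) : ℝ :=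
  ∑ j ∈ Finset.univ.filter (fun j : Fin d => (j : ℕ) < k), c j

section PartialSum

variable {d : ℕ} {c : Fin d → ℝ}

@[simp] lemma partialSum_zero : partialSum c 0 = 0 := by simp [partialSum]

lemma partialSum_succ (i : Fin d) : partialSum c (i + 1) = partialSum c i + c i := by
  have h : Finset.univ.filter (fun j : Fin d => (j : ℕ) < i + 1) =
      insert i (Finset.univ.filter (fun j : Fin d => (j : ℕ) < i)) := by
    ext j
    simp only [Finset.mem_filter, Finset.mem_univ, true_and, Finset.mem_insert, Fin.ext_iff]
    omega
  rw [partialSum, h, Finset.sum_insert (by simp), partialSum, add_comm]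

lemma partialSum_of_le {k : ℕ} (hk : d ≤ k) : partialSum c k = ∑ j, c j := by
  rw [partialSum, Finset.filter_true_of_mem]
  intro j _
  exact lt_of_lt_of_le j.2 hk

lemma sum_Iio_eq_partialSum (i : Fin d) : ∑ j ∈ Finset.Iio i, c j = partialSum c i := by
  rw [partialSum]
  congr 1
  ext j
  simp only [Finset.mem_Iio, Finset.mem_filter, Finset.mem_univ, true_and, Fin.lt_def]

lemma partialSum_mono (hc : ∀ i, 0 < c i) : Monotone (partialSum c) := by
  intro k l hkl
  refine Finset.sum_le_sum_of_subset_of_nonneg ?_ fun i _ _ => (hc i).le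
  intro j hj
  simp only [Finset.mem_filter, Finset.mem_univ, true_and] at hj ⊢
  omega

lemma partialSum_lt (hc : ∀ i, 0 < c i) {k l : ℕ} (hkl : k < l) (hk : k < d) :
    partialSum c k < partialSum c l := by
  have h := partialSum_succ (c := c) ⟨k, hk⟩
  have h2 := partialSum_mono hc (show k + 1 ≤ l from hkl)
  have := hc ⟨k, hk⟩
  simp only at h
  linarith

lemma partialSum_nonneg (hc : ∀ i, 0 < c i) (k : ℕ) : 0 ≤ partialSum c k := by
  simpa using partialSum_mono hc (Nat.zero_le k)

lemma exists_mem_Ico_partialSum (hs : ∑ i, c i = 1) {x : ℝ}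
    (hx : x ∈ Ico (0 : ℝ) 1) : ∃ i : Fin d, x ∈ Ico (partialSum c i) (partialSum c (i + 1)) := by
  by_contra! h
  have key : ∀ k : ℕ, k ≤ d → partialSum c k ≤ x := by
    intro k
    induction k with
    | zero => intro _; simpa using hx.1
    | succ k ih =>
      intro hk
      have h1 := h ⟨k, hk⟩
      by_contra! h2
      exact h1 ⟨ih (by omega), h2⟩
  have := key d le_rfl
  rw [partialSum_of_le le_rfl, hs] at this
  exact absurd hx.2 (not_lt.2 this)

lemma index_eq_of_mem_Ico_partialSum (hc : ∀ i, 0 < c i) {x : ℝ} {i j : Fin d}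
    (hi : x ∈ Ico (partialSum c i) (partialSum c (i + 1)))
    (hj : x ∈ Ico (partialSum c j) (partialSum c (j + 1))) : i = j := by
  by_contra hne
  rcases lt_or_gt_of_ne hne with h | h
  · have := partialSum_mono hc (show (i : ℕ) + 1 ≤ j from h)
    linarith [hi.2, hj.1]
  · have := partialSum_mono hc (show (j : ℕ) + 1 ≤ i from h)
    linarith [hj.2, hi.1]

end PartialSum

/-! ### Diffeomorphisms of the unit interval as homeomorphisms of the line. -/

namespace IntervalDiffeo

lemma continuousOn (f : IntervalDiffeo) : ContinuousOn f.toFun (Icc 0 1) :=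
  f.contDiffOn.continuousOn

lemma strictMonoOn (f : IntervalDiffeo) : StrictMonoOn f.toFun (Icc 0 1) := by
  refine strictMonoOn_of_deriv_pos (convex_Icc _ _) f.continuousOn fun x hx => ?_
  have h := f.deriv_pos x (interior_subset hx)
  rwa [derivWithin_of_mem_nhds (mem_interior_iff_mem_nhds.1 hx)] at h

lemma mapsTo (f : IntervalDiffeo) : MapsTo f.toFun (Icc 0 1) (Icc 0 1) := by
  intro x hx
  constructor
  · have := f.strictMonoOn.monotoneOn (left_mem_Icc.2 zero_le_one) hx hx.1
    rwa [f.map_zero] at this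
  · have := f.strictMonoOn.monotoneOn hx (right_mem_Icc.2 zero_le_one) hx.2
    rwa [f.map_one] at this

/-- Thanks to the normalisation outside `[0,1]`, branches and their compositions become order
isomorphisms of `ℝ`, so that discontinuities can be pulled back without conditions on domains. -/
lemma strictMono (f : IntervalDiffeo) : StrictMono f.toFun := by
  intro x y hxy
  by_cases hx : x ∈ Icc (0 : ℝ) 1 <;> by_cases hy : y ∈ Icc (0 : ℝ) 1
  · exact f.strictMonoOn hx hy hxy
  · rw [f.eq_self y hy]
    have h1 := f.mapsTo hx
    have : 1 < y := by
      by_contra! h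
      exact hy ⟨hx.1.trans hxy.le, h⟩
    linarith [h1.2]
  · rw [f.eq_self x hx]
    have h1 := f.mapsTo hy
    have : x < 0 := by
      by_contra! h
      exact hx ⟨h, hxy.le.trans hy.2⟩
    linarith [h1.1]
  · rwa [f.eq_self x hx, f.eq_self y hy]

lemma surjective (f : IntervalDiffeo) : Function.Surjective f.toFun := by
  intro y
  by_cases hy : y ∈ Icc (0 : ℝ) 1
  · have h := intermediate_value_Icc zero_le_one f.continuousOn
    rw [f.map_zero, f.map_one] at h
    obtain ⟨x, -, hx⟩ := h hy
    exact ⟨x, hx⟩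
  · exact ⟨y, f.eq_self y hy⟩

end IntervalDiffeo

/-! ### Cuts, branches and bijectivity of a generalised interval exchange. -/

namespace GIET

variable {d : ℕ} {σ : Equiv.Perm (Fin d)}

/-- The `k`-th cut of the top partition. -/
def topCut (T : GIET σ) (k : ℕ) : ℝ := partialSum T.top k

/-- The `k`-th cut of the bottom partition. -/
def botCut (T : GIET σ) (k : ℕ) : ℝ := partialSum T.bot k

lemma topLeft_eq (T : GIET σ) (i : Fin d) : T.topLeft i = T.topCut i := sum_Iio_eq_partialSum i

lemma botLeft_eq (T : GIET σ) (i : Fin d) : T.botLeft i = T.botCut i := sum_Iio_eq_partialSum i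

lemma topCut_succ (T : GIET σ) (i : Fin d) : T.topCut (i + 1) = T.topCut i + T.top i :=
  partialSum_succ i

lemma botCut_succ (T : GIET σ) (i : Fin d) : T.botCut (i + 1) = T.botCut i + T.bot i :=
  partialSum_succ i

@[simp] lemma topCut_zero (T : GIET σ) : T.topCut 0 = 0 := partialSum_zero

@[simp] lemma botCut_zero (T : GIET σ) : T.botCut 0 = 0 := partialSum_zero

@[simp] lemma topCut_last (T : GIET σ) : T.topCut d = 1 :=
  (partialSum_of_le le_rfl).trans T.sum_top

@[simp] lemma botCut_last (T : GIET σ) : T.botCut d = 1 :=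
  (partialSum_of_le le_rfl).trans T.sum_bot

lemma topCut_mono (T : GIET σ) : Monotone T.topCut := partialSum_mono T.top_pos

lemma botCut_mono (T : GIET σ) : Monotone T.botCut := partialSum_mono T.bot_pos

lemma topCut_lt (T : GIET σ) {k l : ℕ} (h : k < l) (hk : k < d) : T.topCut k < T.topCut l :=
  partialSum_lt T.top_pos h hk

lemma botCut_lt (T : GIET σ) {k l : ℕ} (h : k < l) (hk : k < d) : T.botCut k < T.botCut l :=
  partialSum_lt T.bot_pos h hk

lemma topCut_nonneg (T : GIET σ) (k : ℕ) : 0 ≤ T.topCut k := partialSum_nonneg T.top_pos k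

lemma botCut_nonneg (T : GIET σ) (k : ℕ) : 0 ≤ T.botCut k := partialSum_nonneg T.bot_pos k

lemma topCut_le_one (T : GIET σ) {k : ℕ} (hk : k ≤ d) : T.topCut k ≤ 1 := by
  simpa using T.topCut_mono hk

lemma botCut_le_one (T : GIET σ) {k : ℕ} (hk : k ≤ d) : T.botCut k ≤ 1 := by
  simpa using T.botCut_mono hk

lemma topCut_lt_one (T : GIET σ) {k : ℕ} (hk : k < d) : T.topCut k < 1 := by
  simpa using T.topCut_lt hk hk

lemma botCut_lt_one (T : GIET σ) {k : ℕ} (hk : k < d) : T.botCut k < 1 := by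
  simpa using T.botCut_lt hk hk

lemma topCut_pos (T : GIET σ) {k : ℕ} (h0 : 0 < k) (hd : 0 < d) : 0 < T.topCut k := by
  simpa using T.topCut_lt h0 hd

lemma botCut_pos (T : GIET σ) {k : ℕ} (h0 : 0 < k) (hd : 0 < d) : 0 < T.botCut k := by
  simpa using T.botCut_lt h0 hd

lemma topInterval_eq (T : GIET σ) (i : Fin d) :
    T.topInterval i = Ico (T.topCut i) (T.topCut (i + 1)) := by
  rw [topInterval, topLeft_eq, topCut_succ]

lemma exists_mem_top (T : GIET σ) {x : ℝ} (hx : x ∈ Ico (0 : ℝ) 1) :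
    ∃ i : Fin d, x ∈ Ico (T.topCut i) (T.topCut (i + 1)) :=
  exists_mem_Ico_partialSum T.sum_top hx

lemma exists_mem_bot (T : GIET σ) {x : ℝ} (hx : x ∈ Ico (0 : ℝ) 1) :
    ∃ i : Fin d, x ∈ Ico (T.botCut i) (T.botCut (i + 1)) :=
  exists_mem_Ico_partialSum T.sum_bot hx

lemma top_index_eq (T : GIET σ) {x : ℝ} {i j : Fin d}
    (hi : x ∈ Ico (T.topCut i) (T.topCut (i + 1)))
    (hj : x ∈ Ico (T.topCut j) (T.topCut (j + 1))) : i = j :=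
  index_eq_of_mem_Ico_partialSum T.top_pos hi hj

lemma bot_index_eq (T : GIET σ) {x : ℝ} {i j : Fin d}
    (hi : x ∈ Ico (T.botCut i) (T.botCut (i + 1)))
    (hj : x ∈ Ico (T.botCut j) (T.botCut (j + 1))) : i = j :=
  index_eq_of_mem_Ico_partialSum T.bot_pos hi hj

lemma Ico_top_subset (T : GIET σ) (i : Fin d) :
    Ico (T.topCut i) (T.topCut (i + 1)) ⊆ Ico (0 : ℝ) 1 :=
  Ico_subset_Ico (T.topCut_nonneg _) (T.topCut_le_one i.2)

lemma Ico_bot_subset (T : GIET σ) (i : Fin d) :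
    Ico (T.botCut i) (T.botCut (i + 1)) ⊆ Ico (0 : ℝ) 1 :=
  Ico_subset_Ico (T.botCut_nonneg _) (T.botCut_le_one i.2)

/-- The `i`-th branch of `T`, extended to the real line. -/
def branchFun (T : GIET σ) (i : Fin d) (y : ℝ) : ℝ :=
  T.botCut (σ i) + T.bot (σ i) * (T.φ i).toFun ((y - T.topCut i) / T.top i)

lemma branchFun_strictMono (T : GIET σ) (i : Fin d) : StrictMono (T.branchFun i) := by
  intro x y hxy
  have h : (x - T.topCut i) / T.top i < (y - T.topCut i) / T.top i :=
    div_lt_div_of_pos_right (by linarith) (T.top_pos i)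
  have := mul_lt_mul_of_pos_left ((T.φ i).strictMono h) (T.bot_pos (σ i))
  simp only [branchFun]
  linarith

lemma branchFun_surjective (T : GIET σ) (i : Fin d) : Function.Surjective (T.branchFun i) := by
  intro y
  obtain ⟨z, hz⟩ := (T.φ i).surjective ((y - T.botCut (σ i)) / T.bot (σ i))
  refine ⟨T.topCut i + T.top i * z, ?_⟩
  have h1 : (T.topCut i + T.top i * z - T.topCut i) / T.top i = z := by
    field_simp [(T.top_pos i).ne']
    ring
  rw [branchFun, h1, hz]
  field_simp [(T.bot_pos (σ i)).ne']
  ring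

/-- The `i`-th branch of `T` as an increasing homeomorphism of the real line. -/
def branch (T : GIET σ) (i : Fin d) : ℝ ≃o ℝ :=
  StrictMono.orderIsoOfSurjective _ (T.branchFun_strictMono i) (T.branchFun_surjective i)

lemma branch_apply (T : GIET σ) (i : Fin d) (y : ℝ) : T.branch i y =
    T.botCut (σ i) + T.bot (σ i) * (T.φ i).toFun ((y - T.topCut i) / T.top i) := rfl

@[simp] lemma branch_left (T : GIET σ) (i : Fin d) :
    T.branch i (T.topCut i) = T.botCut (σ i) := by
  simp [branch_apply, (T.φ i).map_zero]

@[simp] lemma branch_right (T : GIET σ) (i : Fin d) :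
    T.branch i (T.topCut (i + 1)) = T.botCut (σ i + 1) := by
  rw [branch_apply, topCut_succ, botCut_succ]
  simp [(T.top_pos i).ne', (T.φ i).map_one]

lemma map_eq_branch (T : GIET σ) {i : Fin d} {x : ℝ}
    (hx : x ∈ Ico (T.topCut i) (T.topCut (i + 1))) : T.map x = T.branch i x := by
  rw [GIET.map, Finset.sum_eq_single i]
  · rw [indicator_of_mem (by rwa [topInterval_eq]), branch_apply, topLeft_eq, botLeft_eq]
  · intro j _ hj
    rw [indicator_of_notMem]
    rw [topInterval_eq]
    exact fun h => hj (T.top_index_eq h hx)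
  · simp

lemma branch_mem_bot_iff (T : GIET σ) {i : Fin d} {x : ℝ} :
    T.branch i x ∈ Ico (T.botCut (σ i)) (T.botCut (σ i + 1)) ↔
      x ∈ Ico (T.topCut i) (T.topCut (i + 1)) := by
  rw [← T.branch_left i, ← T.branch_right i]
  simp only [mem_Ico, OrderIso.le_iff_le, OrderIso.lt_iff_lt]

lemma map_mem (T : GIET σ) {x : ℝ} (hx : x ∈ Ico (0 : ℝ) 1) : T.map x ∈ Ico (0 : ℝ) 1 := by
  obtain ⟨i, hi⟩ := T.exists_mem_top hx
  rw [T.map_eq_branch hi]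
  exact T.Ico_bot_subset _ (T.branch_mem_bot_iff.2 hi)

lemma mapsTo_map (T : GIET σ) : MapsTo T.map (Ico 0 1) (Ico 0 1) := fun _ => T.map_mem

lemma injOn_map (T : GIET σ) : InjOn T.map (Ico 0 1) := by
  intro x hx y hy hxy
  obtain ⟨i, hi⟩ := T.exists_mem_top hx
  obtain ⟨j, hj⟩ := T.exists_mem_top hy
  rw [T.map_eq_branch hi, T.map_eq_branch hj] at hxy
  have h1 := T.branch_mem_bot_iff.2 hi
  have h2 := T.branch_mem_bot_iff.2 hj
  rw [hxy] at h1
  have h3 := σ.injective (T.bot_index_eq h1 h2)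
  subst h3
  exact (T.branch i).injective hxy

lemma surjOn_map (T : GIET σ) : SurjOn T.map (Ico 0 1) (Ico 0 1) := by
  intro y hy
  obtain ⟨j, hj⟩ := T.exists_mem_bot hy
  obtain ⟨i, rfl⟩ := σ.surjective j
  obtain ⟨x, rfl⟩ := (T.branch i).surjective y
  have hx := T.branch_mem_bot_iff.1 hj
  exact ⟨x, T.Ico_top_subset i hx, T.map_eq_branch hx⟩

lemma bijOn_map (T : GIET σ) : BijOn T.map (Ico 0 1) (Ico 0 1) :=
  ⟨T.mapsTo_map, T.injOn_map, T.surjOn_map⟩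

lemma iterate_mem (T : GIET σ) {x : ℝ} (hx : x ∈ Ico (0 : ℝ) 1) (n : ℕ) :
    T.map^[n] x ∈ Ico (0 : ℝ) 1 := T.mapsTo_map.iterate n hx

lemma iterate_injOn (T : GIET σ) (n : ℕ) : InjOn T.map^[n] (Ico 0 1) :=
  T.injOn_map.iterate T.mapsTo_map n

lemma topCut_mem (T : GIET σ) {k : ℕ} (hk : k < d) : T.topCut k ∈ Ico (0 : ℝ) 1 :=
  ⟨T.topCut_nonneg k, T.topCut_lt_one hk⟩

lemma botCut_mem (T : GIET σ) {k : ℕ} (hk : k < d) : T.botCut k ∈ Ico (0 : ℝ) 1 :=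
  ⟨T.botCut_nonneg k, T.botCut_lt_one hk⟩

lemma topCut_mem_top (T : GIET σ) (i : Fin d) :
    T.topCut i ∈ Ico (T.topCut i) (T.topCut (i + 1)) :=
  ⟨le_rfl, T.topCut_lt (Nat.lt_succ_self _) i.2⟩

lemma map_topCut (T : GIET σ) (i : Fin d) : T.map (T.topCut i) = T.botCut (σ i) := by
  rw [T.map_eq_branch (T.topCut_mem_top i), branch_left]

/-- `m - n` fewer iterates suffice when `f^n x = f^m y`. -/
lemma iterate_cancel (T : GIET σ) {x y : ℝ} (hx : x ∈ Ico (0 : ℝ) 1) (hy : y ∈ Ico (0 : ℝ) 1)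
    {n m : ℕ} (hnm : n ≤ m) (h : T.map^[n] x = T.map^[m] y) : x = T.map^[m - n] y := by
  obtain ⟨k, rfl⟩ := Nat.exists_eq_add_of_le hnm
  rw [Function.iterate_add_apply] at h
  rw [Nat.add_sub_cancel_left]
  exact T.iterate_injOn n hx (T.iterate_mem hy k) h

end GIET

/-! ### Piecewise translations: one-sided germs and recurrence. -/

/-- `f` is a translation on every subinterval of `[0,1)` that contains no point of `D` except
possibly its left endpoint. -/
def TranslatesOff (f : ℝ → ℝ) (D : Set ℝ) : Prop :=
  ∀ x ∈ Ico (0 : ℝ) 1, ∀ y ∈ Ico (0 : ℝ) 1, x ≤ y → (∀ w ∈ D, x < w → y < w) → f y = f x + (y - x)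

namespace TranslatesOff

variable {f : ℝ → ℝ} {D : Set ℝ}

lemma insert (hT : TranslatesOff f D) (a : ℝ) : TranslatesOff f (insert a D) :=
  fun x hx y hy hxy h => hT x hx y hy hxy fun w hw => h w (mem_insert_of_mem a hw)

/-- While no point of `D` separates them, the two orbits run in parallel at constant distance. -/
lemma iterate (hT : TranslatesOff f D) (hf : MapsTo f (Ico 0 1) (Ico 0 1)) {c δ : ℝ} {n : ℕ}
    (hc : c ∈ Ico (0 : ℝ) 1) (hδ : 0 ≤ δ) (hcδ : c + δ < 1)
    (h : ∀ s < n, ∀ w ∈ D, f^[s] c < w → f^[s] c + δ < w) :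
    ∀ s ≤ n, f^[s] (c + δ) = f^[s] c + δ := by
  intro s
  induction s with
  | zero => intro _; rfl
  | succ s ih =>
    intro hs
    have h1 := ih (by omega)
    have hc' : c + δ ∈ Ico (0 : ℝ) 1 := ⟨by linarith [hc.1], hcδ⟩
    have h2 := hf.iterate s hc'
    rw [h1] at h2
    rw [Function.iterate_succ_apply', Function.iterate_succ_apply', h1,
      hT _ (hf.iterate s hc) _ h2 (by linarith) (h s (by omega))]
    ring

/-- A jump is felt only by a segment having a point of `D` strictly beyond its left end, so right
germs are always carried rigidly, even from a point of `D`. -/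
lemma eventually_right (hT : TranslatesOff f D) (hD : D.Finite)
    (hf : MapsTo f (Ico 0 1) (Ico 0 1)) {c : ℝ} (hc : c ∈ Ico (0 : ℝ) 1) (n : ℕ) :
    ∀ᶠ δ in 𝓝[>] (0 : ℝ), f^[n] (c + δ) = f^[n] c + δ := by
  have key : ∀ x ∈ Ico (0 : ℝ) 1, ∀ᶠ δ in 𝓝[>] (0 : ℝ), f (x + δ) = f x + δ := by
    intro x hx
    have h1 : ∀ᶠ δ in 𝓝[>] (0 : ℝ), ∀ w ∈ D, x < w → x + δ < w := by
      refine (eventually_all_finite hD).2 fun w _ => ?_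
      by_cases hw : x < w
      · have : ∀ᶠ δ in 𝓝[>] (0 : ℝ), δ < w - x :=
          mem_nhdsWithin_of_mem_nhds (Iio_mem_nhds (by linarith))
        filter_upwards [this] with δ hδ _
        linarith
      · exact Eventually.of_forall fun _ h => absurd h hw
    have h2 : ∀ᶠ δ in 𝓝[>] (0 : ℝ), δ < 1 - x :=
      mem_nhdsWithin_of_mem_nhds (Iio_mem_nhds (by linarith [hx.2]))
    filter_upwards [h1, h2, self_mem_nhdsWithin] with δ h1 h2 h3
    have h3 : 0 < δ := h3
    rw [hT x hx (x + δ) ⟨by linarith [hx.1], by linarith⟩ (by linarith) h1]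
    ring
  induction n with
  | zero => exact Eventually.of_forall fun _ => rfl
  | succ n ih =>
    filter_upwards [ih, key _ (hf.iterate n hc)] with δ h1 h2
    rw [Function.iterate_succ_apply', Function.iterate_succ_apply', h1, h2]

/-- From the left a point of `D` is a jump, hence the condition on the orbit. The image is positive
because `f x - δ` is still a value of `f` in `[0,1)`. -/
lemma eventually_left (hT : TranslatesOff f D) (hD : D.Finite)
    (hf : MapsTo f (Ico 0 1) (Ico 0 1)) {c : ℝ} (hc : c ∈ Ioo (0 : ℝ) 1) (n : ℕ)
    (hn : ∀ s < n, f^[s] c ∉ D) :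
    f^[n] c ∈ Ioo (0 : ℝ) 1 ∧ ∀ᶠ δ in 𝓝[>] (0 : ℝ), f^[n] (c - δ) = f^[n] c - δ := by
  have key : ∀ x ∈ Ioo (0 : ℝ) 1, x ∉ D →
      f x ∈ Ioo (0 : ℝ) 1 ∧ ∀ᶠ δ in 𝓝[>] (0 : ℝ), f (x - δ) = f x - δ := by
    intro x hx hxD
    have h1 : ∀ᶠ δ in 𝓝[>] (0 : ℝ), ∀ w ∈ D, x - δ < w → x < w := by
      refine (eventually_all_finite hD).2 fun w hw => ?_
      rcases lt_trichotomy x w with h | h | h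
      · exact Eventually.of_forall fun _ _ => h
      · exact absurd (h ▸ hw) hxD
      · have : ∀ᶠ δ in 𝓝[>] (0 : ℝ), δ < x - w :=
          mem_nhdsWithin_of_mem_nhds (Iio_mem_nhds (by linarith))
        filter_upwards [this] with δ hδ hδ'
        linarith
    have h2 : ∀ᶠ δ in 𝓝[>] (0 : ℝ), δ < x :=
      mem_nhdsWithin_of_mem_nhds (Iio_mem_nhds hx.1)
    have h4 : ∀ᶠ δ in 𝓝[>] (0 : ℝ), 0 < δ ∧ x - δ ∈ Ico (0 : ℝ) 1 ∧ f (x - δ) = f x - δ := by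
      filter_upwards [h1, h2, self_mem_nhdsWithin] with δ h1 h2 h3
      have h3 : 0 < δ := h3
      have h5 : x - δ ∈ Ico (0 : ℝ) 1 := ⟨by linarith, by linarith [hx.2]⟩
      refine ⟨h3, h5, ?_⟩
      rw [hT (x - δ) h5 x ⟨hx.1.le, hx.2⟩ (by linarith) h1]
      ring
    refine ⟨?_, h4.mono fun δ h => h.2.2⟩
    obtain ⟨δ, h5, h6, h7⟩ := h4.exists
    have := (hf h6).1
    exact ⟨by linarith, (hf ⟨hx.1.le, hx.2⟩).2⟩
  induction n with
  | zero => exact ⟨hc, Eventually.of_forall fun _ => rfl⟩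
  | succ n ih =>
    obtain ⟨h1, h2⟩ := ih fun s hs => hn s (by omega)
    obtain ⟨h3, h4⟩ := key _ h1 (hn n (by omega))
    rw [Function.iterate_succ_apply']
    refine ⟨h3, ?_⟩
    filter_upwards [h2, h4] with δ h5 h6
    rw [Function.iterate_succ_apply', h5, h6]

/-- Recurrence from the right: if every interval `[c, c + ε]` is eventually cut, then `c`
returns to `(c, x)`. -/
lemma exists_return_right (hT : TranslatesOff f D) (hD : D.Finite)
    (hf : MapsTo f (Ico 0 1) (Ico 0 1)) (hinj : InjOn f (Ico 0 1)) {c x : ℝ}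
    (hc : c ∈ Ico (0 : ℝ) 1) (hx : c < x)
    (hcut : ∀ ε > 0, ∃ n, ∃ w ∈ D, f^[n] c < w ∧ w ≤ f^[n] c + ε) :
    ∃ n, f^[n] c ∈ Ioo c x := by
  classical
  -- A point `y` within `ε` to the right of `c` is carried onto the cut point `w` at time `n`; up to
  -- that time `[c, y]` moves rigidly and no point of `D` falls in the interior of its images.
  let Q : ℝ → ℝ → Prop := fun ε w => ∃ n y, c < y ∧ y ≤ c + ε ∧ y < 1 ∧ f^[n] y = w ∧
    f^[n] c < w ∧ w = f^[n] c + (y - c) ∧ (∀ s ≤ n, f^[s] y = f^[s] c + (y - c)) ∧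
    ∀ s ≤ n, ∀ w' ∈ D, f^[s] c < w' → f^[s] c + (y - c) ≤ w'
  have hQ : ∀ ε > 0, ∃ w ∈ D, Q ε w := by
    intro ε hε
    obtain ⟨ε', hε', h1, h2⟩ : ∃ ε' > 0, ε' ≤ ε ∧ c + ε' < 1 :=
      ⟨min ε ((1 - c) / 2), lt_min hε (by linarith [hc.2]), min_le_left _ _,
        by linarith [min_le_right ε ((1 - c) / 2), hc.2]⟩
    have hex := hcut ε' hε'
    let n := Nat.find hex
    have hn : ∃ w ∈ D, f^[n] c < w ∧ w ≤ f^[n] c + ε' := Nat.find_spec hex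
    have hmin : ∀ s < n, ∀ w ∈ D, f^[s] c < w → f^[s] c + ε' < w := by
      intro s hs w hw h
      by_contra! h'
      exact Nat.find_min hex hs ⟨w, hw, h, h'⟩
    have hfin : {w ∈ D | f^[n] c < w ∧ w ≤ f^[n] c + ε'}.Finite := hD.subset fun w hw => hw.1
    obtain ⟨w, ⟨hw1, hw2, hw3⟩, hw4⟩ := hfin.exists_minimal hn
    refine ⟨w, hw1, n, c + (w - f^[n] c), by linarith, by linarith, by linarith, ?_⟩
    have htr := hT.iterate hf (n := n) (δ := w - f^[n] c) hc (by linarith) (by linarith)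
      fun s hs w' hw' h => by linarith [hmin s hs w' hw' h]
    refine ⟨by rw [htr n le_rfl]; ring, hw2, by ring, fun s hs => by rw [htr s hs]; ring, ?_⟩
    intro s hs w' hw' h
    rcases hs.lt_or_eq with hs | rfl
    · linarith [hmin s hs w' hw' h]
    · by_contra! h'
      have := hw4 ⟨hw', h, by linarith⟩ (by linarith)
      linarith
  -- Pigeonhole on the finite set `D`: one cut point serves arbitrarily small scales.
  obtain ⟨w, hwD, hw⟩ : ∃ w ∈ D, ∃ᶠ ε in 𝓝[>] (0 : ℝ), Q ε w := by
    by_contra! h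
    have h1 : ∀ᶠ ε in 𝓝[>] (0 : ℝ), ∀ w ∈ D, ¬ Q ε w :=
      (eventually_all_finite hD).2 fun w hw => h w hw
    obtain ⟨ε, h2, h3⟩ := (h1.and self_mem_nhdsWithin).exists
    obtain ⟨w, hw, h4⟩ := hQ ε h3
    exact h2 w hw h4
  have hsmall : ∀ r > 0, ∃ ε, ε < r ∧ Q ε w := by
    intro r hr
    have h1 : ∀ᶠ ε in 𝓝[>] (0 : ℝ), ε < r := mem_nhdsWithin_of_mem_nhds (Iio_mem_nhds hr)
    obtain ⟨ε, h2, h3⟩ := (hw.and_eventually h1).exists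
    exact ⟨ε, h3, h2⟩
  -- Two scales for the same `w`, the second finer than `y₁ - c`. By injectivity `f^(n₂ - n₁)` sends
  -- `y₂` to `y₁`, hence `c` to the point at distance `y₂ - c < y₁ - c` on the left of `y₁`, which
  -- lies in `(c, x)`.
  obtain ⟨ε₁, h1, n₁, y₁, a1, a2, a3, a4, a5, a6, a7, a8⟩ := hsmall (x - c) (by linarith)
  obtain ⟨ε₂, h2, n₂, y₂, b1, b2, b3, b4, b5, b6, b7, b8⟩ := hsmall (y₁ - c) (by linarith)
  have hn : n₁ < n₂ := by
    by_contra! h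
    have := a8 n₂ h w hwD b5
    linarith
  have hy1 : y₁ ∈ Ico (0 : ℝ) 1 := ⟨by linarith [hc.1], a3⟩
  have hy2 : y₂ ∈ Ico (0 : ℝ) 1 := ⟨by linarith [hc.1], b3⟩
  have e1 : f^[n₂ - n₁] y₂ = y₁ := by
    refine hinj.iterate hf n₁ (hf.iterate _ hy2) hy1 ?_
    rw [← Function.iterate_add_apply, Nat.add_sub_cancel' hn.le, b4, a4]
  have e2 := b7 (n₂ - n₁) (by omega)
  rw [e1] at e2
  exact ⟨n₂ - n₁, by linarith, by linarith⟩

end TranslatesOff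

/-! ### The two-sided orbit of `0` meets every interval starting at a discontinuity. -/

section TwoSidedOrbit

variable {f g : ℝ → ℝ} {Df Dg : Set ℝ} {a b : ℝ}

/-- The points of `[0,1)` whose orbits under `f` and `g` avoid `J`. -/
def avoiding (f g : ℝ → ℝ) (J : Set ℝ) : Set ℝ :=
  {x | x ∈ Ico (0 : ℝ) 1 ∧ ∀ n, f^[n] x ∉ J ∧ g^[n] x ∉ J}

lemma avoiding_comm (f g : ℝ → ℝ) (J : Set ℝ) : avoiding f g J = avoiding g f J := by
  ext x
  simp only [avoiding, mem_ofPred_eq]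
  exact and_congr_right fun _ => forall_congr' fun _ => and_comm

lemma map_mem_avoiding {J : Set ℝ} (hf : MapsTo f (Ico 0 1) (Ico 0 1))
    (hgf : ∀ x ∈ Ico (0 : ℝ) 1, g (f x) = x) {x : ℝ} (hx : x ∈ avoiding f g J) :
    f x ∈ avoiding f g J := by
  refine ⟨hf hx.1, fun n => ⟨?_, ?_⟩⟩
  · have := (hx.2 (n + 1)).1
    rwa [Function.iterate_succ_apply] at this
  · cases n with
    | zero => exact (hx.2 1).1
    | succ n =>
      rw [Function.iterate_succ_apply, hgf x hx.1]
      exact (hx.2 n).2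

lemma iterate_mem_avoiding {J : Set ℝ} (hf : MapsTo f (Ico 0 1) (Ico 0 1))
    (hgf : ∀ x ∈ Ico (0 : ℝ) 1, g (f x) = x) {x : ℝ} (hx : x ∈ avoiding f g J) (n : ℕ) :
    f^[n] x ∈ avoiding f g J :=
  MapsTo.iterate (fun _ h => map_mem_avoiding hf hgf h) n hx

lemma iterate_iterate_cancel (hf : MapsTo f (Ico 0 1) (Ico 0 1))
    (hgf : ∀ x ∈ Ico (0 : ℝ) 1, g (f x) = x) {x : ℝ} (hx : x ∈ Ico (0 : ℝ) 1) (n : ℕ) :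
    g^[n] (f^[n] x) = x := by
  induction n generalizing x with
  | zero => rfl
  | succ n ih =>
    rw [Function.iterate_succ_apply, Function.iterate_succ_apply', hgf _ (hf.iterate n hx), ih hx]

/-- If `f^n x` hits `J` while `c < x` does not, then the interval `(c, x]` has been cut. -/
lemma exists_cut_of_hit (hT : TranslatesOff f Df) (hf : MapsTo f (Ico 0 1) (Ico 0 1)) {c x : ℝ}
    (hc : c ∈ Ico (0 : ℝ) 1) (hcx : c ≤ x) (hx : x < 1) {n : ℕ} (hn : f^[n] x ∈ Ico a b)
    (hcn : f^[n] c ∉ Ico a b) :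
    ∃ s, ∃ w ∈ insert a Df, f^[s] c < w ∧ w ≤ f^[s] c + (x - c) := by
  by_contra! h
  have h1 := hT.iterate hf (n := n) (δ := x - c) hc (by linarith) (by linarith)
    (fun s _ w hw h' => h s w (mem_insert_of_mem _ hw) h') n le_rfl
  rw [add_sub_cancel] at h1
  have h2 : f^[n] c < a := by
    by_contra! h2
    exact hcn ⟨h2, by linarith [hn.2]⟩
  have := h n a (mem_insert _ _) h2
  linarith [hn.1]

/-- Left-continuity along the `g`-orbit makes every `g^n c` a left limit of the avoiding set. If the
segments `[c, c + ε]` are cut at all scales, `c` returns slightly to its right and brings avoiding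
points there. Otherwise one segment travels rigidly for ever without meeting the avoiding set, and
the infinitely many points `g^n c` are `ε`-separated in `[0,1)`. -/
lemma not_leftLimit_of_avoiding {J : Set ℝ} (hDg : Dg.Finite) (hTg : TranslatesOff g Dg)
    (hf : MapsTo f (Ico 0 1) (Ico 0 1)) (hg : MapsTo g (Ico 0 1) (Ico 0 1))
    (hgf : ∀ x ∈ Ico (0 : ℝ) 1, g (f x) = x) (hfg : ∀ x ∈ Ico (0 : ℝ) 1, f (g x) = x) {c : ℝ}
    (hc : c ∈ Ioo (0 : ℝ) 1)
    (hright : ∃ ε > 0, ∀ y ∈ Icc c (c + ε), y ∉ avoiding f g J)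
    (hleft : ∃ᶠ δ in 𝓝[>] (0 : ℝ), c - δ ∈ avoiding f g J)
    (hD : ∀ n, g^[n] c ∉ Dg) (hper : ∀ n, 0 < n → g^[n] c ≠ c) : False := by
  have hcI : c ∈ Ico (0 : ℝ) 1 := ⟨hc.1.le, hc.2⟩
  have hginj : InjOn g (Ico 0 1) := fun x hx y hy h => by
    rw [← hfg x hx, ← hfg y hy, h]
  have hgE : ∀ x ∈ avoiding f g J, ∀ n, g^[n] x ∈ avoiding f g J := by
    intro x hx n
    rw [avoiding_comm] at hx ⊢
    exact iterate_mem_avoiding hg hfg hx n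
  have hleft' : ∀ n, ∀ x < g^[n] c, ∃ y ∈ avoiding f g J, x < y ∧ y < g^[n] c := by
    intro n x hx
    obtain ⟨-, h1⟩ := hTg.eventually_left hDg hg hc n fun s _ => hD s
    have h2 : ∀ᶠ δ in 𝓝[>] (0 : ℝ), δ < g^[n] c - x :=
      mem_nhdsWithin_of_mem_nhds (Iio_mem_nhds (by linarith))
    obtain ⟨δ, h3, h4, h5, h6⟩ :=
      (hleft.and_eventually (h1.and (h2.and self_mem_nhdsWithin))).exists
    have h6 : 0 < δ := h6
    refine ⟨g^[n] (c - δ), hgE _ h3 n, ?_, ?_⟩ <;> rw [h4] <;> linarith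
  obtain ⟨ε₀, hε₀, hE⟩ := hright
  obtain ⟨n, hn1, hn2⟩ := hTg.exists_return_right (x := c + ε₀) hDg hg hginj hcI (by linarith) (by
    intro ε' hε'
    by_contra! hno
    obtain ⟨ε, hε, e1, e2, e3⟩ : ∃ ε > 0, ε ≤ ε' ∧ ε ≤ ε₀ ∧ c + ε < 1 :=
      ⟨min ε' (min ε₀ ((1 - c) / 2)), lt_min hε' (lt_min hε₀ (by linarith [hc.2])),
        min_le_left _ _, (min_le_right _ _).trans (min_le_left _ _), by
        linarith [(min_le_right ε' (min ε₀ ((1 - c) / 2))).trans (min_le_right _ _), hc.2]⟩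
    have htr : ∀ n, ∀ δ, 0 ≤ δ → δ ≤ ε → g^[n] c + δ ∉ avoiding f g J := by
      intro n δ h1 h2 h3
      have h4 := hTg.iterate hg (n := n) (δ := δ) hcI h1 (by linarith)
        (fun s _ w hw h' => by linarith [hno s w hw h']) n le_rfl
      rw [← h4] at h3
      have h5 := iterate_mem_avoiding hf hgf h3 n
      rw [iterate_iterate_cancel hg hfg ⟨by linarith [hc.1], by linarith⟩] at h5
      exact hE (c + δ) ⟨by linarith, by linarith⟩ h5
    have hsep : ∀ n m, g^[n] c < g^[m] c → g^[n] c + ε < g^[m] c := by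
      intro n m h
      by_contra! h'
      obtain ⟨y, hy, h1, h2⟩ := hleft' m _ h
      have := htr n (y - g^[n] c) (by linarith) (by linarith)
      rw [add_sub_cancel] at this
      exact this hy
    have hne : ∀ n m, n < m → g^[n] c ≠ g^[m] c := by
      intro n m hnm h
      obtain ⟨k, rfl⟩ := Nat.exists_eq_add_of_lt hnm
      rw [show n + k + 1 = n + (k + 1) by ring, Function.iterate_add_apply] at h
      exact hper (k + 1) (by omega) (hginj.iterate hg n hcI (hg.iterate _ hcI) h).symm
    -- Separated points lie in different cells of length `ε`, and finitely many cells meet `[0,1)`.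
    have hinj : Function.Injective fun n : ℕ => ⌊g^[n] c / ε⌋₊ := by
      have : ∀ n m, g^[n] c < g^[m] c → ⌊g^[n] c / ε⌋₊ ≠ ⌊g^[m] c / ε⌋₊ := by
        intro n m h h'
        have h1 := hsep n m h
        have h2 : g^[m] c / ε < ⌊g^[m] c / ε⌋₊ + 1 := Nat.lt_floor_add_one _
        have h3 : (⌊g^[n] c / ε⌋₊ : ℝ) ≤ g^[n] c / ε :=
          Nat.floor_le (div_nonneg (hg.iterate n hcI).1 hε.le)
        rw [← h'] at h2
        have h4 : g^[m] c / ε - g^[n] c / ε < 1 := by linarith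
        rw [← sub_div, div_lt_one hε] at h4
        linarith
      intro n m h
      by_contra hnm
      have h1 : g^[n] c ≠ g^[m] c := by
        rcases lt_or_gt_of_ne hnm with h2 | h2
        · exact hne n m h2
        · exact (hne m n h2).symm
      rcases lt_or_gt_of_ne h1 with h2 | h2
      · exact this n m h2 h
      · exact this m n h2 h.symm
    refine Set.infinite_univ (α := ℕ) ?_
    refine Set.Finite.of_finite_image (f := fun n : ℕ => ⌊g^[n] c / ε⌋₊) ?_ hinj.injOn
    refine (Set.finite_Iic ⌊1 / ε⌋₊).subset ?_
    rintro _ ⟨n, -, rfl⟩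
    exact Nat.floor_le_floor (div_le_div_of_nonneg_right (hg.iterate n hcI).2.le hε.le))
  obtain ⟨y, hy, h1, h2⟩ := hleft' n c hn1
  exact hE y ⟨h1.le, by linarith⟩ hy

/-- The two-sided orbit of `0` under a piecewise translation without connections visits
every interval `[a,b)` that starts at a discontinuity. -/
theorem exists_orbit_zero_mem (hDf : Df.Finite) (hDg : Dg.Finite)
    (hTf : TranslatesOff f Df) (hTg : TranslatesOff g Dg)
    (hf : MapsTo f (Ico 0 1) (Ico 0 1)) (hg : MapsTo g (Ico 0 1) (Ico 0 1))
    (hgf : ∀ x ∈ Ico (0 : ℝ) 1, g (f x) = x) (hfg : ∀ x ∈ Ico (0 : ℝ) 1, f (g x) = x)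
    (h1 : ∀ c ∈ Ico (0 : ℝ) 1, ∀ m n, f^[m] c ∈ Df → g^[n] c ∉ Dg)
    (h2 : ∀ u ∈ Df, ∀ n, 0 < n → f^[n] u ∉ Df)
    (h3 : ∀ u ∈ Dg, ∀ n, 0 < n → g^[n] u ≠ u)
    (ha : a ∈ Df) (ha0 : 0 < a) (hab : a < b) (ha1 : a < 1) :
    ∃ n, f^[n] 0 ∈ Ico a b ∨ g^[n] 0 ∈ Ico a b := by
  by_contra! h0
  set E := avoiding f g (Ico a b) with hEdef
  have h0I : (0 : ℝ) ∈ Ico (0 : ℝ) 1 := ⟨le_rfl, zero_lt_one⟩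
  have hzero : (0 : ℝ) ∈ E := ⟨h0I, h0⟩
  have haI : a ∈ Ico (0 : ℝ) 1 := ⟨ha0.le, ha1⟩
  have haE : a ∉ E := fun h => (h.2 0).1 ⟨le_rfl, hab⟩
  have hbdd : BddAbove (E ∩ Icc 0 a) := ⟨a, fun x hx => hx.2.2⟩
  have hne : (E ∩ Icc 0 a).Nonempty := ⟨0, hzero, le_rfl, ha0.le⟩
  -- If the supremum belongs to `E`, it recurs into the gap between itself and `a`; if not, it is a
  -- left limit of `E` whose own orbit hits `[a, b)`.
  set c := sSup (E ∩ Icc 0 a) with hcdef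
  have hc0 : 0 ≤ c := le_csSup hbdd ⟨hzero, le_rfl, ha0.le⟩
  have hca : c ≤ a := csSup_le hne fun x hx => hx.2.2
  have hcI : c ∈ Ico (0 : ℝ) 1 := ⟨hc0, hca.trans_lt ha1⟩
  have hgap : ∀ x, c < x → x ≤ a → x ∉ E := by
    intro x h1 h2 h3
    exact absurd (le_csSup hbdd ⟨h3, hc0.trans h1.le, h2⟩) (not_le.2 h1)
  have hfinj : InjOn f (Ico 0 1) := fun x hx y hy h => by rw [← hgf x hx, ← hgf y hy, h]
  have hginj : InjOn g (Ico 0 1) := fun x hx y hy h => by rw [← hfg x hx, ← hfg y hy, h]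
  have hfE : ∀ x ∈ E, ∀ n, f^[n] x ∈ E := fun x hx n => iterate_mem_avoiding hf hgf hx n
  have hgE : ∀ x ∈ E, ∀ n, g^[n] x ∈ E := by
    intro x hx n
    rw [hEdef, avoiding_comm] at hx ⊢
    exact iterate_mem_avoiding hg hfg hx n
  by_cases hcE : c ∈ E
  · have hlt : c < a := lt_of_le_of_ne hca fun h => haE (h ▸ hcE)
    have hcut : ∀ ε > 0, c + ε ≤ a →
        (∃ s, ∃ w ∈ insert a Df, f^[s] c < w ∧ w ≤ f^[s] c + ε) ∨
        (∃ s, ∃ w ∈ insert a Dg, g^[s] c < w ∧ w ≤ g^[s] c + ε) := by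
      intro ε hε hεa
      have hx := hgap (c + ε) (by linarith) hεa
      have hxI : c + ε ∈ Ico (0 : ℝ) 1 := ⟨by linarith, by linarith⟩
      obtain ⟨n, hn⟩ : ∃ n, f^[n] (c + ε) ∈ Ico a b ∨ g^[n] (c + ε) ∈ Ico a b := by
        by_contra! h
        exact hx ⟨hxI, h⟩
      rcases hn with hn | hn
      · left
        have := exists_cut_of_hit hTf hf hcI (by linarith) hxI.2 hn (hcE.2 n).1
        simpa using this
      · right
        have := exists_cut_of_hit hTg hg hcI (by linarith) hxI.2 hn (hcE.2 n).2
        simpa using this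
    by_cases hfcut : ∀ ε > 0, ∃ s, ∃ w ∈ insert a Df, f^[s] c < w ∧ w ≤ f^[s] c + ε
    · obtain ⟨n, hn⟩ := (hTf.insert a).exists_return_right (hDf.insert a) hf hfinj hcI hlt hfcut
      exact hgap _ hn.1 hn.2.le (hfE c hcE n)
    -- When forward iteration makes no cut below some scale, all finer cuts come from `g`.
    · push Not at hfcut
      obtain ⟨ε₀, hε₀, hno⟩ := hfcut
      obtain ⟨n, hn⟩ := (hTg.insert a).exists_return_right (hDg.insert a) hg hginj hcI hlt (by
        intro ε hε
        have h4 : 0 < min ε (min ε₀ (a - c)) := lt_min hε (lt_min hε₀ (by linarith))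
        have h5 := min_le_left ε (min ε₀ (a - c))
        have h6 := (min_le_right ε (min ε₀ (a - c))).trans (min_le_left _ _)
        have h7 := (min_le_right ε (min ε₀ (a - c))).trans (min_le_right _ _)
        rcases hcut _ h4 (by linarith) with ⟨s, w, hw, h8, h9⟩ | ⟨s, w, hw, h8, h9⟩
        · linarith [hno s w hw h8]
        · exact ⟨s, w, hw, h8, by linarith⟩)
      exact hgap _ hn.1 hn.2.le (hgE c hcE n)
  · have hcpos : 0 < c := lt_of_le_of_ne hc0 fun h => hcE (h ▸ hzero)
    have hcoo : c ∈ Ioo (0 : ℝ) 1 := ⟨hcpos, hcI.2⟩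
    have hleft : ∃ᶠ δ in 𝓝[>] (0 : ℝ), c - δ ∈ E := by
      rw [frequently_iff]
      intro U hU
      obtain ⟨r, hr, hU⟩ := mem_nhdsGT_iff_exists_Ioo_subset.1 hU
      have hr : 0 < r := hr
      obtain ⟨y, hy, hy'⟩ := exists_lt_of_lt_csSup hne (show c - r < c by linarith)
      have h4 : y ≤ c := le_csSup hbdd hy
      have h5 : y ≠ c := fun h => hcE (h ▸ hy.1)
      have h6 : y < c := lt_of_le_of_ne h4 h5
      exact ⟨c - y, hU ⟨by linarith, by linarith⟩, by simpa using hy.1⟩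
    have hhit : ∃ n, f^[n] c ∈ Ico a b ∨ g^[n] c ∈ Ico a b := by
      by_contra! h
      exact hcE ⟨hcI, h⟩
    have hright : ∃ ε > 0, ∀ y ∈ Icc c (c + ε), y ∉ E := by
      have h4 : ∀ᶠ δ in 𝓝[>] (0 : ℝ), c + δ ∉ E := by
        obtain ⟨n, hn | hn⟩ := hhit
        · have h5 : ∀ᶠ δ in 𝓝[>] (0 : ℝ), δ < b - f^[n] c :=
            mem_nhdsWithin_of_mem_nhds (Iio_mem_nhds (by linarith [hn.2]))
          filter_upwards [hTf.eventually_right hDf hf hcI n, h5, self_mem_nhdsWithin] with δ h6 h7 h8 h9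
          have h8 : 0 < δ := h8
          refine (h9.2 n).1 ?_
          rw [h6]
          exact ⟨by linarith [hn.1], by linarith⟩
        · have h5 : ∀ᶠ δ in 𝓝[>] (0 : ℝ), δ < b - g^[n] c :=
            mem_nhdsWithin_of_mem_nhds (Iio_mem_nhds (by linarith [hn.2]))
          filter_upwards [hTg.eventually_right hDg hg hcI n, h5, self_mem_nhdsWithin] with δ h6 h7 h8 h9
          have h8 : 0 < δ := h8
          refine (h9.2 n).2 ?_
          rw [h6]
          exact ⟨by linarith [hn.1], by linarith⟩
      obtain ⟨r, hr, h5⟩ := mem_nhdsGT_iff_exists_Ioo_subset.1 h4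
      have hr : 0 < r := hr
      refine ⟨r / 2, by linarith, fun y hy hyE => ?_⟩
      rcases hy.1.eq_or_lt with h6 | h6
      · exact hcE (h6 ▸ hyE)
      · have : y - c ∈ Ioo 0 r := ⟨by linarith, by linarith [hy.2]⟩
        have := h5 this
        simp only [mem_ofPred_eq, add_sub_cancel] at this
        exact this hyE
    -- A forward hit of `Df` excludes every backward hit of `Dg` and every period, so `g` is
    -- continuous from the left along the whole orbit.
    have hfg' : (∃ l, f^[l] c ∈ Df) → False := by
      rintro ⟨l, hl⟩
      refine not_leftLimit_of_avoiding hDg hTg hf hg hgf hfg hcoo hright hleft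
        (fun n => h1 c hcI l n hl) fun n hn hper => ?_
      have h4 : f^[n] c = c := by
        have := iterate_iterate_cancel hg hfg hcI n
        rwa [hper] at this
      refine h2 _ hl n hn ?_
      rw [← Function.iterate_add_apply, Nat.add_comm, Function.iterate_add_apply, h4]
      exact hl
    obtain ⟨n, hn | hn⟩ := hhit
    · by_cases hl : ∃ l, f^[l] c ∈ Df
      · exact hfg' hl
      · push Not at hl
        obtain ⟨-, h4⟩ := hTf.eventually_left hDf hf hcoo n fun s _ => hl s
        have h5 : f^[n] c ≠ a := fun h => hl n (h ▸ ha)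
        have h5 : a < f^[n] c := lt_of_le_of_ne hn.1 h5.symm
        have h6 : ∀ᶠ δ in 𝓝[>] (0 : ℝ), δ < f^[n] c - a :=
          mem_nhdsWithin_of_mem_nhds (Iio_mem_nhds (by linarith))
        obtain ⟨δ, h7, h8, h9, h10⟩ :=
          (hleft.and_eventually (h4.and (h6.and self_mem_nhdsWithin))).exists
        have h10 : 0 < δ := h10
        refine (h7.2 n).1 ?_
        rw [h8]
        exact ⟨by linarith, by linarith [hn.2]⟩
    -- The same obstruction with the two maps exchanged.
    · have hswap : (∀ m, f^[m] c ∉ Df) → (∀ m, 0 < m → f^[m] c ≠ c) → False := by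
        intro h4 h5
        rw [hEdef, avoiding_comm] at hright hleft
        exact not_leftLimit_of_avoiding hDf hTf hg hf hfg hgf hcoo hright hleft h4 h5
      by_cases hl : ∃ l, g^[l] c ∈ Dg
      · obtain ⟨l, hl⟩ := hl
        refine hswap (fun m hm => h1 c hcI m l hm hl) fun m hm hper => ?_
        have h4 : g^[m] c = c := by
          have := iterate_iterate_cancel hf hgf hcI m
          rwa [hper] at this
        refine h3 _ hl m hm ?_
        rw [← Function.iterate_add_apply, Nat.add_comm, Function.iterate_add_apply, h4]
      · push Not at hl
        obtain ⟨-, h4⟩ := hTg.eventually_left hDg hg hcoo n fun s _ => hl s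
        rcases hn.1.eq_or_lt with h5 | h5
        -- Here `g^n c = a`: either `c` is the discontinuity `a`, or it is one of its strict forward
        -- iterates, which meet no discontinuity and are not periodic.
        · cases n with
          | zero => exact hfg' ⟨0, h5 ▸ ha⟩
          | succ n =>
            have h6 : c = f^[n + 1] a := by
              rw [h5, iterate_iterate_cancel hg hfg hcI]
            refine hswap (fun m hm => ?_) fun m hm hper => ?_
            · rw [h6, ← Function.iterate_add_apply] at hm
              exact h2 a ha _ (by omega) hm
            · have h7 : f^[m] a = a := by
                refine hfinj.iterate hf (n + 1) (hf.iterate m haI) haI ?_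
                rw [← Function.iterate_add_apply, Nat.add_comm, Function.iterate_add_apply, ← h6,
                  hper]
              exact h2 a ha m hm (h7.symm ▸ ha)
        · have h6 : ∀ᶠ δ in 𝓝[>] (0 : ℝ), δ < g^[n] c - a :=
            mem_nhdsWithin_of_mem_nhds (Iio_mem_nhds (by linarith))
          obtain ⟨δ, h7, h8, h9, h10⟩ :=
            (hleft.and_eventually (h4.and (h6.and self_mem_nhdsWithin))).exists
          have h10 : 0 < δ := h10
          refine (h7.2 n).2 ?_
          rw [h8]
          exact ⟨by linarith, by linarith [hn.2]⟩

end TwoSidedOrbit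

/-! ### Patterns of the permutation excluded by a single marked point. -/

section VertexGlue

variable {d : ℕ} {σ : Equiv.Perm (Fin d)}

/-- With only one class, a nonempty set of vertices saturated for the generating identifications is
everything; each of the following prohibitions comes from a proper saturated set. -/
lemma vertexGlue_invariant (hσ : numMarkedPoints σ = 1)
    {P : Fin (d + 1) ⊕ Fin (d + 1) → Prop} (hP : ∀ v w, VertexGlue σ v w → (P v ↔ P w))
    {v : Fin (d + 1) ⊕ Fin (d + 1)} (hv : P v) (w : Fin (d + 1) ⊕ Fin (d + 1)) : P w := by
  have hsub : Subsingleton (Quot (VertexGlue σ)) := (Nat.card_eq_one_iff_unique.1 hσ).1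
  let Q : Quot (VertexGlue σ) → Prop := Quot.lift P fun a b h => propext (hP a b h)
  have h1 : Q (Quot.mk _ v) := hv
  rw [Subsingleton.elim (Quot.mk _ v) (Quot.mk (VertexGlue σ) w)] at h1
  exact h1

/-- Otherwise the extreme left vertex would be glued to no other vertex. -/
lemma perm_first_ne (hd : 2 ≤ d) (hσ : numMarkedPoints σ = 1) {i : Fin d} (hi : (i : ℕ) = 0) :
    (σ i : ℕ) ≠ 0 := by
  intro h
  let P : Fin (d + 1) ⊕ Fin (d + 1) → Prop :=
    Sum.elim (fun a => (a : ℕ) = 0) fun a => (a : ℕ) = 0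
  have hP : ∀ v w, VertexGlue σ v w → (P v ↔ P w) := by
    rintro _ _ (_ | _ | j | j)
    · simp [P]
    · simp [P]
    · simp only [P, Sum.elim_inl, Sum.elim_inr, Fin.val_castSucc]
      rw [← hi, ← Fin.ext_iff, show ((σ j : ℕ) = i) ↔ (σ j : ℕ) = σ i by rw [h, hi], ← Fin.ext_iff,
        σ.apply_eq_iff_eq]
    · simp [P]
  have := vertexGlue_invariant hσ hP (v := Sum.inl 0) (by simp [P]) (Sum.inl (Fin.last d))
  simp only [P, Sum.elim_inl, Fin.val_last] at this
  omega

/-- Otherwise the extreme right vertex would be glued to no other vertex. -/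
lemma perm_last_ne (hd : 2 ≤ d) (hσ : numMarkedPoints σ = 1) {i : Fin d} (hi : (i : ℕ) + 1 = d) :
    (σ i : ℕ) + 1 ≠ d := by
  intro h
  let P : Fin (d + 1) ⊕ Fin (d + 1) → Prop :=
    Sum.elim (fun a => (a : ℕ) = d) fun a => (a : ℕ) = d
  have hP : ∀ v w, VertexGlue σ v w → (P v ↔ P w) := by
    rintro _ _ (_ | _ | j | j)
    · simp [P]
    · simp [P]
    · simp only [P, Sum.elim_inl, Sum.elim_inr, Fin.val_castSucc]
      have := j.2
      have := (σ j).2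
      omega
    · simp only [P, Sum.elim_inl, Sum.elim_inr, Fin.val_succ]
      have h1 : (j : ℕ) + 1 = d ↔ j = i := by rw [Fin.ext_iff]; omega
      have h2 : (σ j : ℕ) + 1 = d ↔ σ j = σ i := by rw [Fin.ext_iff]; omega
      rw [h1, h2, σ.apply_eq_iff_eq]
  have := vertexGlue_invariant hσ hP (v := Sum.inl (Fin.last d)) (by simp [P]) (Sum.inl 0)
  simp only [P, Sum.elim_inl, Fin.val_zero] at this
  omega

/-- Otherwise the vertex between two consecutive top sides would be glued only to the vertex between
their images: it would be a removable point. -/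
lemma perm_succ_ne (hσ : numMarkedPoints σ = 1) {i k : Fin d} (hik : (i : ℕ) + 1 = k) :
    (σ i : ℕ) + 1 ≠ σ k := by
  intro h
  let P : Fin (d + 1) ⊕ Fin (d + 1) → Prop :=
    Sum.elim (fun a => (a : ℕ) = k) fun a => (a : ℕ) = σ k
  have hk := k.2
  have hσk := (σ k).2
  have hP : ∀ v w, VertexGlue σ v w → (P v ↔ P w) := by
    rintro _ _ (_ | _ | j | j)
    · simp only [P, Sum.elim_inl, Sum.elim_inr, Fin.val_zero]
      omega
    · simp only [P, Sum.elim_inl, Sum.elim_inr, Fin.val_last]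
      omega
    · simp only [P, Sum.elim_inl, Sum.elim_inr, Fin.val_castSucc]
      rw [← Fin.ext_iff, ← Fin.ext_iff, σ.apply_eq_iff_eq]
    · simp only [P, Sum.elim_inl, Sum.elim_inr, Fin.val_succ]
      have h1 : (j : ℕ) + 1 = k ↔ j = i := by rw [Fin.ext_iff]; omega
      have h2 : (σ j : ℕ) + 1 = σ k ↔ σ j = σ i := by rw [Fin.ext_iff]; omega
      rw [h1, h2, σ.apply_eq_iff_eq]
  have := vertexGlue_invariant hσ hP (v := Sum.inl k.castSucc) (by simp [P]) (Sum.inl 0)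
  simp only [P, Sum.elim_inl, Fin.val_zero] at this
  omega

/-- The same obstruction with a detour through the extreme right vertex: the four vertices involved
would be saturated, and the left vertex is not among them. -/
lemma perm_succ_ne_of_last (hσ : numMarkedPoints σ = 1) {i j k : Fin d} (hik : (i : ℕ) + 1 = k)
    (hj : (j : ℕ) + 1 = d) (hi : (σ i : ℕ) + 1 = d) : (σ j : ℕ) + 1 ≠ σ k := by
  intro h
  let P : Fin (d + 1) ⊕ Fin (d + 1) → Prop :=
    Sum.elim (fun a => (a : ℕ) = k ∨ (a : ℕ) = d) fun a => (a : ℕ) = σ k ∨ (a : ℕ) = d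
  have hk := k.2
  have hσk := (σ k).2
  have hP : ∀ v w, VertexGlue σ v w → (P v ↔ P w) := by
    rintro _ _ (_ | _ | l | l)
    · simp only [P, Sum.elim_inl, Sum.elim_inr, Fin.val_zero]
      omega
    · simp [P]
    · simp only [P, Sum.elim_inl, Sum.elim_inr, Fin.val_castSucc]
      have h1 : (l : ℕ) = k ↔ l = k := by rw [Fin.ext_iff]
      have h2 : (σ l : ℕ) = σ k ↔ σ l = σ k := by rw [Fin.ext_iff]
      have := l.2
      have := (σ l).2
      rw [h1, h2, σ.apply_eq_iff_eq]
      omega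
    · simp only [P, Sum.elim_inl, Sum.elim_inr, Fin.val_succ]
      have h1 : (l : ℕ) + 1 = k ↔ l = i := by rw [Fin.ext_iff]; omega
      have h2 : (l : ℕ) + 1 = d ↔ l = j := by rw [Fin.ext_iff]; omega
      have h3 : (σ l : ℕ) + 1 = d ↔ σ l = σ i := by rw [Fin.ext_iff]; omega
      have h4 : (σ l : ℕ) + 1 = σ k ↔ σ l = σ j := by rw [Fin.ext_iff]; omega
      rw [h1, h2, h3, h4, σ.apply_eq_iff_eq, σ.apply_eq_iff_eq, or_comm]
  have := vertexGlue_invariant hσ hP (v := Sum.inl k.castSucc) (by simp [P]) (Sum.inl 0)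
  simp only [P, Sum.elim_inl, Fin.val_zero] at this
  omega

end VertexGlue

/-! ### Discontinuities of `T` and its inverse, and consequences of the absence of connections. -/

namespace GIET

variable {d : ℕ} {σ : Equiv.Perm (Fin d)} {T : GIET σ}

/-- The interior discontinuities of `T`. -/
def topCuts (T : GIET σ) : Set ℝ := {x | ∃ k : Fin d, 0 < (k : ℕ) ∧ x = T.topCut k}

/-- The interior discontinuities of the inverse of `T`. -/
def botCuts (T : GIET σ) : Set ℝ := {x | ∃ k : Fin d, 0 < (k : ℕ) ∧ x = T.botCut k}

lemma topCuts_finite (T : GIET σ) : T.topCuts.Finite :=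
  (Set.finite_range fun k : Fin d => T.topCut k).subset fun _ ⟨k, _, h⟩ => ⟨k, h.symm⟩

lemma botCuts_finite (T : GIET σ) : T.botCuts.Finite :=
  (Set.finite_range fun k : Fin d => T.botCut k).subset fun _ ⟨k, _, h⟩ => ⟨k, h.symm⟩

lemma mem_top_of_no_cut (T : GIET σ) {i : Fin d} {x y : ℝ}
    (hx : x ∈ Ico (T.topCut i) (T.topCut (i + 1))) (hxy : x ≤ y) (hy : y < 1)
    (h : ∀ w ∈ T.topCuts, x < w → y < w) : y ∈ Ico (T.topCut i) (T.topCut (i + 1)) := by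
  refine ⟨hx.1.trans hxy, ?_⟩
  by_cases hi : (i : ℕ) + 1 < d
  · exact h _ ⟨⟨i + 1, hi⟩, Nat.succ_pos _, rfl⟩ hx.2
  · rw [show (i : ℕ) + 1 = d by omega, topCut_last]
    exact hy

lemma mem_bot_of_no_cut (T : GIET σ) {i : Fin d} {x y : ℝ}
    (hx : x ∈ Ico (T.botCut i) (T.botCut (i + 1))) (hxy : x ≤ y) (hy : y < 1)
    (h : ∀ w ∈ T.botCuts, x < w → y < w) : y ∈ Ico (T.botCut i) (T.botCut (i + 1)) := by
  refine ⟨hx.1.trans hxy, ?_⟩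
  by_cases hi : (i : ℕ) + 1 < d
  · exact h _ ⟨⟨i + 1, hi⟩, Nat.succ_pos _, rfl⟩ hx.2
  · rw [show (i : ℕ) + 1 = d by omega, botCut_last]
    exact hy

lemma IsStandard.branch_eq (hT : T.IsStandard) {i : Fin d} {x : ℝ}
    (hx : x ∈ Icc (T.topCut i) (T.topCut (i + 1))) :
    T.branch i x = x + (T.botCut (σ i) - T.topCut i) := by
  rw [topCut_succ] at hx
  have h0 := T.top_pos i
  rw [branch_apply, hT.2 i _ ⟨div_nonneg (by linarith [hx.1]) h0.le,
    (div_le_one h0).2 (by linarith [hx.2])⟩, hT.1 i]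
  field_simp
  ring

lemma IsStandard.map_eq (hT : T.IsStandard) {i : Fin d} {x : ℝ}
    (hx : x ∈ Ico (T.topCut i) (T.topCut (i + 1))) :
    T.map x = x + (T.botCut (σ i) - T.topCut i) := by
  rw [T.map_eq_branch hx, hT.branch_eq (Ico_subset_Icc_self hx)]

lemma IsStandard.translatesOff (hT : T.IsStandard) : TranslatesOff T.map T.topCuts := by
  intro x hx y hy hxy h
  obtain ⟨i, hi⟩ := T.exists_mem_top hx
  rw [hT.map_eq hi, hT.map_eq (T.mem_top_of_no_cut hi hxy hy.2 h)]
  ring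

/-- The inverse of `T` on `[0,1)`. -/
def inv (T : GIET σ) : ℝ → ℝ := Function.invFunOn T.map (Ico 0 1)

lemma inv_map (T : GIET σ) {x : ℝ} (hx : x ∈ Ico (0 : ℝ) 1) : T.inv (T.map x) = x :=
  T.bijOn_map.invOn_invFunOn.1 hx

lemma map_inv (T : GIET σ) {x : ℝ} (hx : x ∈ Ico (0 : ℝ) 1) : T.map (T.inv x) = x :=
  T.bijOn_map.invOn_invFunOn.2 hx

lemma mapsTo_inv (T : GIET σ) : MapsTo T.inv (Ico 0 1) (Ico 0 1) :=
  T.surjOn_map.mapsTo_invFunOn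

lemma IsStandard.inv_translatesOff (hT : T.IsStandard) : TranslatesOff T.inv T.botCuts := by
  have key : ∀ i, ∀ x ∈ Ico (T.botCut (σ i)) (T.botCut (σ i + 1)),
      T.inv x = x - (T.botCut (σ i) - T.topCut i) := by
    intro i x hx
    obtain ⟨y, rfl⟩ := (T.branch i).surjective x
    have hy := T.branch_mem_bot_iff.1 hx
    rw [← T.map_eq_branch hy, T.inv_map (T.Ico_top_subset i hy), hT.map_eq hy]
    ring
  intro x hx y hy hxy h
  obtain ⟨j, hj⟩ := T.exists_mem_bot hx
  obtain ⟨i, rfl⟩ := σ.surjective j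
  rw [key i x hj, key i y (T.mem_bot_of_no_cut hj hxy hy.2 h)]
  ring

lemma NoConnection.iterate_notMem (hc : T.NoConnection) {k : Fin d} (hk : 0 < (k : ℕ)) {m : ℕ}
    (hm : 0 < m) : T.map^[m] (T.topCut k) ∉ T.topCuts := by
  rintro ⟨j, hj, h⟩
  have := hc k j hk hj m hm
  rw [topLeft_eq, topLeft_eq] at this
  exact this h

section Arithmetic

variable (hd : 2 ≤ d) (hσ : numMarkedPoints σ = 1) (hc : T.NoConnection)

include hd hσ

/-- The first interval is not sent to the first place, so `0` is the image of an interior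
discontinuity and its forward orbit inherits the absence of connections. -/
lemma exists_map_eq_zero (T : GIET σ) :
    ∃ k : Fin d, (σ k : ℕ) = 0 ∧ 0 < (k : ℕ) ∧ T.map (T.topCut k) = 0 := by
  have h0 : (σ (σ.symm ⟨0, by omega⟩) : ℕ) = 0 := by simp
  refine ⟨σ.symm ⟨0, by omega⟩, h0, ?_, ?_⟩
  · by_contra! h
    exact perm_first_ne hd hσ (Nat.le_zero.1 h) h0
  · rw [map_topCut, h0, botCut_zero]

include hc

lemma iterate_zero_notMem_topCuts (m : ℕ) : T.map^[m] 0 ∉ T.topCuts := by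
  obtain ⟨k, -, hk, h⟩ := T.exists_map_eq_zero hd hσ
  rw [← h, ← Function.iterate_succ_apply]
  exact hc.iterate_notMem hk (Nat.succ_pos m)

lemma iterate_topCut_notMem_topCuts (k : Fin d) {m : ℕ} (hm : 0 < m) :
    T.map^[m] (T.topCut k) ∉ T.topCuts := by
  rcases Nat.eq_zero_or_pos (k : ℕ) with h | h
  · rw [h, topCut_zero]
    exact iterate_zero_notMem_topCuts hd hσ hc m
  · exact hc.iterate_notMem h hm

/-- By injectivity a return to `0` would pass through the discontinuity that is sent to `0`. -/
lemma iterate_zero_ne_zero {m : ℕ} (hm : 0 < m) : T.map^[m] 0 ≠ 0 := by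
  intro h
  obtain ⟨k, -, hk, h'⟩ := T.exists_map_eq_zero hd hσ
  obtain ⟨m, rfl⟩ := Nat.exists_eq_succ_of_ne_zero hm.ne'
  rw [Function.iterate_succ_apply'] at h
  nth_rewrite 2 [← h'] at h
  have := T.injOn_map (T.iterate_mem ⟨le_rfl, zero_lt_one⟩ m) (T.topCut_mem k.2) h
  exact iterate_zero_notMem_topCuts hd hσ hc m ⟨k, hk, this⟩

lemma iterate_botCut_notMem_topCuts (l : Fin d) (m : ℕ) : T.map^[m] (T.botCut l) ∉ T.topCuts := by
  have h := iterate_topCut_notMem_topCuts hd hσ hc (σ.symm l) (Nat.succ_pos m)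
  rwa [Function.iterate_succ_apply, map_topCut, Equiv.apply_symm_apply] at h

/-- The two-sided orbit of `0` visits every interval starting at a discontinuity. -/
theorem exists_orbit_zero_mem_Ico (hT : T.IsStandard) {a b : ℝ} (ha : a ∈ T.topCuts)
    (hab : a < b) : ∃ n, T.map^[n] 0 ∈ Ico a b ∨ T.inv^[n] 0 ∈ Ico a b := by
  have hmi : ∀ x ∈ Ico (0 : ℝ) 1, T.map (T.inv x) = x := fun x hx => T.map_inv hx
  have him : ∀ x ∈ Ico (0 : ℝ) 1, T.inv (T.map x) = x := fun x hx => T.inv_map hx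
  have hpos : 0 < a := by
    obtain ⟨k, hk, rfl⟩ := ha
    exact T.topCut_pos hk (by omega)
  have hlt : a < 1 := by
    obtain ⟨k, hk, rfl⟩ := ha
    exact T.topCut_lt_one k.2
  refine exists_orbit_zero_mem T.topCuts_finite T.botCuts_finite hT.translatesOff
    hT.inv_translatesOff T.mapsTo_map T.mapsTo_inv him hmi ?_ ?_ ?_ ha hpos hab hlt
  -- A backward hit of a bottom cut followed by a forward hit of a top cut would be a connection.
  · rintro c hcI m n h1 ⟨l, hl, h2⟩
    have h3 := iterate_iterate_cancel T.mapsTo_inv hmi hcI n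
    rw [h2] at h3
    rw [← h3, ← Function.iterate_add_apply] at h1
    exact iterate_botCut_notMem_topCuts hd hσ hc l _ h1
  · rintro _ ⟨k, hk, rfl⟩ n hn
    exact hc.iterate_notMem hk hn
  · rintro _ ⟨l, hl, rfl⟩ n hn h1
    have h2 := iterate_iterate_cancel T.mapsTo_inv hmi (T.botCut_mem l.2) n
    rw [h1] at h2
    have h3 : T.map^[n] (T.topCut (σ.symm l)) = T.topCut (σ.symm l) := by
      refine T.injOn_map (T.iterate_mem (T.topCut_mem (σ.symm l).2) n)
        (T.topCut_mem (σ.symm l).2) ?_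
      rw [← Function.iterate_succ_apply' T.map n, Function.iterate_succ_apply, map_topCut,
        Equiv.apply_symm_apply, h2]
    rcases Nat.eq_zero_or_pos (σ.symm l : ℕ) with h | h
    · rw [h, topCut_zero] at h3
      exact iterate_zero_ne_zero hd hσ hc hn h3
    · exact hc.iterate_notMem h hn ⟨_, h, h3⟩

end Arithmetic

/-! ### First returns to the base and the points cut before returning. -/

section ReturnTime

lemma IsFirstReturnTime.unique {f : ℝ → ℝ} {J : Set ℝ} {y : ℝ} {n m : ℕ}
    (hn : IsFirstReturnTime f J y n) (hm : IsFirstReturnTime f J y m) : n = m := by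
  by_contra h
  rcases lt_or_gt_of_ne h with h | h
  · exact hm.2.2 n hn.1 h hn.2.1
  · exact hn.2.2 m hm.1 h hm.2.1

lemma IsFirstReturnTime.le_iterate {x₀ y : ℝ} {n s : ℕ}
    (hn : IsFirstReturnTime T.map (Ico 0 x₀) y n) (hy : y ∈ Ico (0 : ℝ) 1) (hs : 0 < s)
    (hsn : s < n) : x₀ ≤ T.map^[s] y := by
  by_contra! h
  exact hn.2.2 s hs hsn ⟨(T.iterate_mem hy s).1, h⟩

/-- The points of the base `[0,x₀)` whose orbit hits `w` before returning. -/
def cutsBefore (T : GIET σ) (x₀ w : ℝ) : Set ℝ :=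
  {y | y ∈ Ico 0 x₀ ∧ ∃ s, T.map^[s] y = w ∧ ∀ s', 0 < s' → s' ≤ s → x₀ ≤ T.map^[s'] y}

/-- If two base points reach `w`, injectivity puts one of them on the orbit of the other, before the
latter is back in the base. Hence only finitely many base points are cut in total. -/
lemma cutsBefore_subsingleton {x₀ : ℝ} (hx₀ : x₀ < 1) (w : ℝ) :
    (T.cutsBefore x₀ w).Subsingleton := by
  have key : ∀ y₁ ∈ Ico 0 x₀, ∀ y₂ ∈ Ico 0 x₀, ∀ s₁ s₂ : ℕ, s₁ ≤ s₂ →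
      T.map^[s₁] y₁ = T.map^[s₂] y₂ → (∀ s', 0 < s' → s' ≤ s₂ → x₀ ≤ T.map^[s'] y₂) →
      y₁ = y₂ := by
    intro y₁ h₁ y₂ h₂ s₁ s₂ hs he ha
    have h3 := T.iterate_cancel ⟨h₁.1, h₁.2.trans hx₀⟩ ⟨h₂.1, h₂.2.trans hx₀⟩ hs he
    rcases hs.eq_or_lt with h | h
    · simpa [h] using h3
    · have := ha (s₂ - s₁) (by omega) (by omega)
      rw [← h3] at this
      exact absurd h₁.2 (not_lt.2 this)
  rintro y₁ ⟨h₁, s₁, e₁, a₁⟩ y₂ ⟨h₂, s₂, e₂, a₂⟩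
  rcases le_total s₁ s₂ with h | h
  · exact key y₁ h₁ y₂ h₂ s₁ s₂ h (e₁.trans e₂.symm) a₂
  · exact (key y₂ h₂ y₁ h₁ s₂ s₁ h (e₂.trans e₁.symm) a₁).symm

/-- If no point of `(y₁, y₂]` is cut before returning to `[0,x₀)`, then `y₂` returns with `y₁`. -/
lemma IsStandard.returns_together (hT : T.IsStandard) {x₀ y₁ y₂ : ℝ} {n : ℕ} (hx₀ : x₀ < 1)
    (h₁ : 0 ≤ y₁) (h₁₂ : y₁ ≤ y₂) (h₂ : y₂ < x₀)
    (hn : IsFirstReturnTime T.map (Ico 0 x₀) y₁ n)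
    (hcut : ∀ y ∈ Ioc y₁ y₂, ∀ w ∈ insert x₀ T.topCuts, y ∉ T.cutsBefore x₀ w) :
    IsFirstReturnTime T.map (Ico 0 x₀) y₂ n ∧
      (∀ s ≤ n, T.map^[s] y₂ = T.map^[s] y₁ + (y₂ - y₁)) ∧
      ∀ s < n, ∀ w ∈ T.topCuts, T.map^[s] y₁ < w → T.map^[s] y₂ < w := by
  have hI₁ : y₁ ∈ Ico (0 : ℝ) 1 := ⟨h₁, by linarith⟩
  have hI₂ : y₂ ∈ Ico (0 : ℝ) 1 := ⟨by linarith, by linarith⟩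
  -- The point of the first segment carried onto `w` would be cut before returning. At the return
  -- time itself only `w = x₀` matters, since what happens to the other discontinuities then belongs
  -- to the next excursion.
  have hcut' : ∀ s ≤ n, (∀ s' < s, ∀ w ∈ T.topCuts, T.map^[s'] y₁ < w →
      T.map^[s'] y₁ + (y₂ - y₁) < w) → ∀ w ∈ insert x₀ T.topCuts, T.map^[s] y₁ < w →
      (s < n ∨ w = x₀) → T.map^[s] y₁ + (y₂ - y₁) < w := by
    intro s hs ih w hw hlt hsn
    by_contra! hle
    have hs0 : ∀ s', 0 < s' → s' < n → x₀ ≤ T.map^[s'] y₁ := fun s' h h' =>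
      hn.le_iterate hI₁ h h'
    have htr := hT.translatesOff.iterate T.mapsTo_map (n := s) (δ := w - T.map^[s] y₁) hI₁
      (by linarith) (by linarith [hI₂.2]) fun s' hs' w' hw' h' => by
        linarith [ih s' hs' w' hw' h']
    refine hcut (y₁ + (w - T.map^[s] y₁)) ⟨by linarith, by linarith⟩ w hw
      ⟨⟨by linarith, by linarith⟩, s, by rw [htr s le_rfl]; ring, ?_⟩
    intro s' h1 h2
    rw [htr s' h2]
    rcases (h2.trans hs).lt_or_eq with h3 | h3
    · linarith [hs0 s' h1 h3]
    · have : s' = s := by omega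
      subst this
      rcases hsn with h4 | h4
      · omega
      · linarith
  have hno : ∀ s < n, ∀ w ∈ T.topCuts, T.map^[s] y₁ < w → T.map^[s] y₁ + (y₂ - y₁) < w := by
    intro s
    induction s using Nat.strong_induction_on with
    | _ s ih =>
      intro hs w hw hlt
      exact hcut' s hs.le (fun s' hs' => ih s' hs' (by omega)) w (mem_insert_of_mem _ hw) hlt
        (Or.inl hs)
  have htr : ∀ s ≤ n, T.map^[s] y₂ = T.map^[s] y₁ + (y₂ - y₁) := by
    have := hT.translatesOff.iterate T.mapsTo_map (n := n) (δ := y₂ - y₁) hI₁ (by linarith)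
      (by linarith [hI₂.2]) hno
    rwa [add_sub_cancel] at this
  refine ⟨⟨hn.1, ⟨(T.iterate_mem hI₂ n).1, ?_⟩, ?_⟩, htr, fun s hs w hw h => ?_⟩
  · rw [htr n le_rfl]
    exact hcut' n le_rfl hno x₀ (mem_insert _ _) hn.2.1.2 (Or.inr rfl)
  · intro s hs hsn h
    have := hn.le_iterate hI₁ hs hsn
    rw [htr s hsn.le] at h
    linarith [h.2]
  · rw [htr s hs.le]
    exact hno s hs w hw h

end ReturnTime

/-! ### Left germs of discontinuities have no connections either. -/

section LeftGerm

/-- `f^r` maps `x - δ` to `x' - δ` for all small `δ > 0`. -/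
def LeftGerm (f : ℝ → ℝ) (r : ℕ) (x x' : ℝ) : Prop :=
  ∀ᶠ δ in 𝓝[>] (0 : ℝ), f^[r] (x - δ) = x' - δ

lemma LeftGerm.trans {f : ℝ → ℝ} {r s : ℕ} {x y z : ℝ} (h₁ : LeftGerm f r x y)
    (h₂ : LeftGerm f s y z) : LeftGerm f (r + s) x z := by
  filter_upwards [h₁, h₂] with δ h₁ h₂
  rw [Nat.add_comm, Function.iterate_add_apply, h₁, h₂]

lemma LeftGerm.unique {f : ℝ → ℝ} {r : ℕ} {x y z : ℝ} (h₁ : LeftGerm f r x y)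
    (h₂ : LeftGerm f r x z) : y = z := by
  obtain ⟨δ, h₁, h₂⟩ := (h₁.and h₂).exists
  linarith [h₁.symm.trans h₂]

lemma LeftGerm.of_trans {f : ℝ → ℝ} {r s : ℕ} {x y z : ℝ} (h₁ : LeftGerm f r x y)
    (h₂ : LeftGerm f (r + s) x z) : LeftGerm f s y z := by
  filter_upwards [h₁, h₂] with δ h₁ h₂
  rw [Nat.add_comm, Function.iterate_add_apply, h₁] at h₂
  exact h₂

lemma IsStandard.leftGerm_topCut_succ (hT : T.IsStandard) (i : Fin d) :
    LeftGerm T.map 1 (T.topCut (i + 1)) (T.botCut (σ i + 1)) := by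
  have h : ∀ᶠ δ in 𝓝[>] (0 : ℝ), δ < T.top i :=
    mem_nhdsWithin_of_mem_nhds (Iio_mem_nhds (T.top_pos i))
  filter_upwards [h, self_mem_nhdsWithin] with δ h1 h2
  have h2 : 0 < δ := h2
  have h3 := T.topCut_succ i
  rw [Function.iterate_one, hT.map_eq (i := i) ⟨by linarith, by linarith⟩, botCut_succ, hT.1]
  linarith

section

variable (hd : 2 ≤ d) (hσ : numMarkedPoints σ = 1) (hT : T.IsStandard) (hc : T.NoConnection)
include hd hσ hT hc

/-- Forward orbits of bottom cuts avoid the top discontinuities, so their left germs follow the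
points themselves. -/
lemma leftGerm_botCut {l : ℕ} (hl0 : 0 < l) (hl : l < d) (s : ℕ) :
    T.map^[s] (T.botCut l) ∈ Ioo (0 : ℝ) 1 ∧
      LeftGerm T.map s (T.botCut l) (T.map^[s] (T.botCut l)) :=
  hT.translatesOff.eventually_left T.topCuts_finite T.mapsTo_map
    ⟨T.botCut_pos hl0 (by omega), T.botCut_lt_one hl⟩ s
    fun s _ => iterate_botCut_notMem_topCuts hd hσ hc ⟨l, hl⟩ s

/-- There are no connections between left germs of discontinuities. -/
lemma leftGerm_topCut_succ_notMem (i : Fin d) {r : ℕ} (hr : 0 < r) {v : ℝ}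
    (h : LeftGerm T.map r (T.topCut (i + 1)) v) :
    v ∉ T.topCuts ∧ (v = 1 → r = 1 ∧ (σ i : ℕ) + 1 = d) := by
  have key : ∀ (l s : ℕ), 0 < l → l < d → LeftGerm T.map s (T.botCut l) v →
      v ∉ T.topCuts ∧ v ≠ 1 := by
    intro l s hl0 hl hg
    have h1 := leftGerm_botCut hd hσ hT hc hl0 hl s
    rw [hg.unique h1.2]
    exact ⟨iterate_botCut_notMem_topCuts hd hσ hc ⟨l, hl⟩ s, h1.1.2.ne⟩
  have h1 := hT.leftGerm_topCut_succ i
  obtain ⟨r, rfl⟩ := Nat.exists_eq_add_of_le' hr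
  rw [Nat.add_comm] at h
  have h2 := h1.of_trans h
  by_cases hi : (σ i : ℕ) + 1 < d
  · have := key _ r (Nat.succ_pos _) hi h2
    exact ⟨this.1, fun h => absurd h this.2⟩
  · have hi : (σ i : ℕ) + 1 = d := by omega
    rw [hi, botCut_last] at h2
    cases r with
    | zero =>
      have h3 : v = 1 := h2.unique (Eventually.of_forall fun _ => rfl)
      refine ⟨?_, fun _ => ⟨rfl, hi⟩⟩
      rintro ⟨k, -, hk⟩
      have := T.topCut_lt_one k.2
      linarith
    | succ r =>
      -- A germ that has reached `1` from the left continues through the last interval, whose image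
      -- does not end at `1`.
      let j : Fin d := ⟨d - 1, by omega⟩
      have hj : (j : ℕ) + 1 = d := by simp only [j]; omega
      have h3 := hT.leftGerm_topCut_succ j
      rw [hj, topCut_last] at h3
      rw [Nat.add_comm] at h2
      have hlt : (σ j : ℕ) + 1 < d := by
        have := perm_last_ne hd hσ hj
        have := (σ j).2
        omega
      have := key _ r (Nat.succ_pos _) hlt (h3.of_trans h2)
      exact ⟨this.1, fun h => absurd h this.2⟩

end

end LeftGerm

/-! ### Constancy of the return time on the base intervals of a self-similar exchange. -/

section SelfSimilar

variable {x₀ : ℝ}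

lemma IsRescaledFirstReturn.exists_returnTime {T' : GIET σ} (h : IsRescaledFirstReturn x₀ T T')
    {z : ℝ} (hz : z ∈ Ico 0 x₀) :
    ∃ n, IsFirstReturnTime T.map (Ico 0 x₀) z n ∧ T.map^[n] z = x₀ * T'.map (z / x₀) := by
  have h0 := h.1
  obtain ⟨n, hn⟩ := h.2.2 (z / x₀) ⟨div_nonneg hz.1 h0.le, (div_lt_one h0).2 hz.2⟩
  rw [mul_div_cancel₀ _ h0.ne'] at hn
  exact ⟨n, hn⟩

variable (hd : 2 ≤ d) (hσ : numMarkedPoints σ = 1) (hT : T.IsStandard) (hc : T.NoConnection)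
  (hself : IsRescaledFirstReturn x₀ T T)
include hself

lemma baseInterval_subset {i : Fin d} {y : ℝ}
    (hy : y ∈ Ico (x₀ * T.topCut i) (x₀ * T.topCut (i + 1))) : y ∈ Ico 0 x₀ :=
  ⟨(mul_nonneg hself.1.le (T.topCut_nonneg _)).trans hy.1,
    hy.2.trans_le (by simpa using mul_le_mul_of_nonneg_left (T.topCut_le_one i.2) hself.1.le)⟩

include hT

/-- Self-similarity fixes the return point, even before the return times are known to agree. -/
lemma first_return_eq {i : Fin d} {y : ℝ} {n : ℕ}
    (hy : y ∈ Ico (x₀ * T.topCut i) (x₀ * T.topCut (i + 1)))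
    (hn : IsFirstReturnTime T.map (Ico 0 x₀) y n) :
    T.map^[n] y = x₀ * T.botCut (σ i) + (y - x₀ * T.topCut i) := by
  have h0 := hself.1
  have h1 : y / x₀ ∈ Ico (T.topCut i) (T.topCut (i + 1)) :=
    ⟨(le_div_iff₀' h0).2 hy.1, (div_lt_iff₀' h0).2 hy.2⟩
  have h2 := T.Ico_top_subset i h1
  obtain ⟨m, hm, he⟩ := hself.exists_returnTime (z := y)
    ⟨by linarith [hy.1, mul_nonneg h0.le (T.topCut_nonneg i)], (div_lt_one h0).1 h2.2⟩
  rw [hn.unique hm, he, hT.map_eq h1]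
  field_simp
  ring

include hd hσ hc

/-- The orbit of an interior point of a base interval meets no discontinuity before it returns. -/
lemma iterate_notMem_topCuts_of_mem_interior {i : Fin d} {y : ℝ} {n m : ℕ}
    (hy : y ∈ Ioo (x₀ * T.topCut i) (x₀ * T.topCut (i + 1)))
    (hn : IsFirstReturnTime T.map (Ico 0 x₀) y n) (hm : m < n) : T.map^[m] y ∉ T.topCuts := by
  rintro ⟨k, hk, hmk⟩
  have h0 := hself.1
  have hx1 := hself.2.1
  have hyI := baseInterval_subset hself (Ioo_subset_Ico_self hy)
  have hy1 : y ∈ Ico (0 : ℝ) 1 := ⟨hyI.1, hyI.2.trans hx1⟩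
  have hypos : 0 < y := (mul_nonneg h0.le (T.topCut_nonneg _)).trans_lt hy.1
  set z := x₀ * T.botCut (σ i) + (y - x₀ * T.topCut i) with hz
  have hzn : T.map^[n] y = z := first_return_eq hT hself (Ioo_subset_Ico_self hy) hn
  have hzpos : 0 < z := by
    have := mul_nonneg h0.le (T.botCut_nonneg (σ i))
    linarith [hy.1]
  have hbl : T.map^[m + 1] y = T.botCut (σ k) := by
    rw [Function.iterate_succ_apply', hmk, map_topCut]
  -- Otherwise the orbit reaches `0`, a point of the base, at time `m + 1 ≤ n`, whereas the first
  -- return point `z` is positive.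
  have hl0 : 0 < (σ k : ℕ) := by
    by_contra! h
    rw [Nat.le_zero.1 h, botCut_zero] at hbl
    rcases (show m + 1 ≤ n from hm).lt_or_eq with h1 | h1
    · exact hn.2.2 (m + 1) (Nat.succ_pos m) h1 (by rw [hbl]; exact ⟨le_rfl, h0⟩)
    · rw [h1] at hbl
      linarith
  let l' : Fin d := ⟨σ k - 1, by omega⟩
  have hl' : (σ (σ.symm l') : ℕ) + 1 = σ k := by
    rw [Equiv.apply_symm_apply]
    simp only [l']
    omega
  set i' := σ.symm l' with hi'
  -- What lies just left of the image of the discontinuity comes from just left of another cut, the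
  -- right end of the interval `i'` whose image precedes that of `k`. This germ flows to the left
  -- germ of `z`.
  have g1 : LeftGerm T.map (n - m) (T.topCut (i' + 1)) z := by
    have h1 := hT.leftGerm_topCut_succ i'
    rw [hl'] at h1
    have h2 := (leftGerm_botCut hd hσ hT hc hl0 (σ k).2 (n - m - 1)).2
    rw [← hbl, ← Function.iterate_add_apply, show n - m - 1 + (m + 1) = n by omega, hzn, hbl] at h2
    have := h1.trans h2
    rwa [show 1 + (n - m - 1) = n - m by omega] at this
  -- No discontinuity occurs earlier on the orbit of `y`, since it would be connected to the `k`-th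
  -- one.
  have g2 : LeftGerm T.map m y (T.topCut k) := by
    rw [← hmk]
    refine (hT.translatesOff.eventually_left T.topCuts_finite T.mapsTo_map
      ⟨hypos, hy1.2⟩ m ?_).2
    rintro s hs ⟨j, hj, hsj⟩
    refine hc.iterate_notMem hj (show 0 < m - s by omega) ⟨k, hk, ?_⟩
    rw [← hsj, ← Function.iterate_add_apply, Nat.sub_add_cancel hs.le, hmk]
  -- The finitely many cut points do not accumulate at `y`, so the points just left of `y` share a
  -- return time; self-similarity makes them return just left of the same `z`, although they were
  -- separated from `y`.
  obtain ⟨N', g3⟩ : ∃ N', LeftGerm T.map N' y z := by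
    have hfin : (⋃ w ∈ insert x₀ T.topCuts, T.cutsBefore x₀ w).Finite :=
      (T.topCuts_finite.insert x₀).biUnion fun w _ =>
        (cutsBefore_subsingleton hx1 w).finite
    have h1 : ∀ᶠ a in 𝓝[<] y, ∀ c ∈ (⋃ w ∈ insert x₀ T.topCuts, T.cutsBefore x₀ w),
        c < y → c < a := by
      refine (eventually_all_finite hfin).2 fun c _ => ?_
      by_cases hcy : c < y
      · filter_upwards [Ioo_mem_nhdsLT hcy] with a ha _ using ha.1
      · exact Eventually.of_forall fun _ h => absurd h hcy
    obtain ⟨a, h2, h3⟩ := (h1.and (Ioo_mem_nhdsLT hy.1)).exists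
    have haJ : a ∈ Ico (x₀ * T.topCut i) (x₀ * T.topCut (i + 1)) :=
      ⟨h3.1.le, h3.2.trans hy.2⟩
    have haI := baseInterval_subset hself haJ
    obtain ⟨N, hN, -⟩ := hself.exists_returnTime haI
    refine ⟨N, ?_⟩
    have h4 : ∀ᶠ δ in 𝓝[>] (0 : ℝ), δ < y - a :=
      mem_nhdsWithin_of_mem_nhds (Iio_mem_nhds (by linarith [h3.2]))
    filter_upwards [h4, self_mem_nhdsWithin] with δ h5 h6
    have h6 : 0 < δ := h6
    have h7 := (hT.returns_together hx1 haI.1 (y₂ := y - δ) (by linarith) (by linarith [hyI.2])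
      hN fun c hc w hw hcw => by
        have := h2 c (mem_biUnion hw hcw) (by linarith [hc.2])
        linarith [hc.1]).1
    rw [first_return_eq hT hself (i := i) ⟨by linarith [h3.1], by linarith [hy.2]⟩ h7]
    rw [hz]
    ring
  have hIδ : ∀ i : Fin d, ∀ᶠ δ in 𝓝[>] (0 : ℝ), T.topCut (i + 1) - δ ∈ Ico (0 : ℝ) 1 := by
    intro i
    have h : ∀ᶠ δ in 𝓝[>] (0 : ℝ), δ < T.top i :=
      mem_nhdsWithin_of_mem_nhds (Iio_mem_nhds (T.top_pos i))
    filter_upwards [h, self_mem_nhdsWithin] with δ h1 h2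
    have h2 : 0 < δ := h2
    have h3 := T.topCut_succ i
    exact ⟨by linarith [T.topCut_nonneg i], by linarith [T.topCut_le_one i.2]⟩
  have hyδ : ∀ᶠ δ in 𝓝[>] (0 : ℝ), y - δ ∈ Ico (0 : ℝ) 1 := by
    have h : ∀ᶠ δ in 𝓝[>] (0 : ℝ), δ < y := mem_nhdsWithin_of_mem_nhds (Iio_mem_nhds hypos)
    filter_upwards [h, self_mem_nhdsWithin] with δ h1 h2
    have h2 : 0 < δ := h2
    exact ⟨by linarith, by linarith [hy1.2]⟩
  obtain ⟨k', hk'⟩ : ∃ k' : Fin d, (k' : ℕ) + 1 = k := ⟨⟨k - 1, by omega⟩, by simp; omega⟩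
  -- Two left germs flow to that of `z`, so by injectivity one lies on the orbit of the other.
  -- Comparison with the passage of the germ of `y` through the `k`-th cut relates the germs at the
  -- two cuts.
  have hA : (∃ r, LeftGerm T.map r (T.topCut k) (T.topCut (i' + 1))) ∨
      ∃ r, 0 < r ∧ LeftGerm T.map r (T.topCut (i' + 1)) (T.topCut k) := by
    by_cases hN : n - m ≤ N'
    · have g4 : LeftGerm T.map (N' - (n - m)) y (T.topCut (i' + 1)) := by
        filter_upwards [g1, g3, hIδ i', hyδ] with δ e1 e2 e3 e4
        exact (T.iterate_cancel e3 e4 hN (e1.trans e2.symm)).symm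
      by_cases hN2 : m ≤ N' - (n - m)
      · left
        refine ⟨N' - (n - m) - m, g2.of_trans ?_⟩
        rwa [Nat.add_sub_cancel' hN2]
      · right
        refine ⟨m - (N' - (n - m)), by omega, g4.of_trans ?_⟩
        rwa [Nat.add_sub_cancel' (by omega)]
    · right
      have g4 : LeftGerm T.map (n - m - N') (T.topCut (i' + 1)) y := by
        filter_upwards [g1, g3, hIδ i', hyδ] with δ e1 e2 e3 e4
        exact (T.iterate_cancel e4 e3 (by omega) (e2.trans e1.symm)).symm
      exact ⟨n - m - N' + m, by omega, g4.trans g2⟩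
  rcases hA with ⟨r, hr⟩ | ⟨r, hr0, hr⟩
  · rcases Nat.eq_zero_or_pos r with rfl | hr0
    · have h1 : T.topCut k = T.topCut (i' + 1) :=
        (hr.unique (y := T.topCut (i' + 1)) (Eventually.of_forall fun _ => rfl)).symm
      have h2 : (k : ℕ) = i' + 1 := by
        rcases lt_trichotomy (k : ℕ) (i' + 1) with h | h | h
        · exact absurd h1 (T.topCut_lt h k.2).ne
        · exact h
        · exact absurd h1 (T.topCut_lt h (by omega)).ne'
      -- Equal germs mean that the `k`-th discontinuity is removable.
      exact perm_succ_ne hσ h2.symm hl'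
    · rw [← hk'] at hr
      have h1 := leftGerm_topCut_succ_notMem hd hσ hT hc k' hr0 hr
      by_cases hi1 : (i' : ℕ) + 1 < d
      · exact h1.1 ⟨⟨i' + 1, hi1⟩, Nat.succ_pos _, rfl⟩
      -- The only other possible connection ends at `1`.
      · have hi1 : (i' : ℕ) + 1 = d := by omega
        rw [hi1, topCut_last] at h1
        exact perm_succ_ne_of_last hσ hk' hi1 (h1.2 rfl).2 hl'
  · exact (leftGerm_topCut_succ_notMem hd hσ hT hc i' hr0 hr).1 ⟨k, hk, rfl⟩

/-- The orbit of an interior point of a base interval does not meet `x₀` before it returns. -/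
lemma iterate_ne_of_mem_interior {i : Fin d} {y : ℝ} {s : ℕ}
    (hy : y ∈ Ioo (x₀ * T.topCut i) (x₀ * T.topCut (i + 1)))
    (hs : ∀ s', 0 < s' → s' ≤ s → x₀ ≤ T.map^[s'] y) : T.map^[s] y ≠ x₀ := by
  intro he
  have h0 := hself.1
  have hx1 := hself.2.1
  have hyI := baseInterval_subset hself (Ioo_subset_Ico_self hy)
  have hypos : 0 < y := (mul_nonneg h0.le (T.topCut_nonneg _)).trans_lt hy.1
  classical
  have hex : ∃ s', T.map^[s'] y = x₀ := ⟨s, he⟩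
  set r := Nat.find hex
  have hr : T.map^[r] y = x₀ := Nat.find_spec hex
  have hrs : r ≤ s := Nat.find_min' hex he
  have hr0 : 0 < r := by
    rw [Nat.pos_iff_ne_zero]
    intro h
    rw [h] at hr
    exact absurd hyI.2 (not_lt.2 hr.ge)
  obtain ⟨n, hn, -⟩ := hself.exists_returnTime hyI
  have hrn : r < n := by
    by_contra! h
    have := hs n hn.1 (h.trans hrs)
    linarith [hn.2.1.2]
  have g : ∀ s' ≤ r, LeftGerm T.map s' y (T.map^[s'] y) := fun s' hs' =>
    (hT.translatesOff.eventually_left T.topCuts_finite T.mapsTo_map ⟨hypos, hyI.2.trans hx1⟩ s'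
      fun s'' h => iterate_notMem_topCuts_of_mem_interior hd hσ hT hc hself hy hn
        (by omega)).2
  have h1 : ∀ᶠ δ in 𝓝[>] (0 : ℝ), ∀ s' ∈ Iic r, 0 < s' → s' < r → x₀ < T.map^[s'] (y - δ) := by
    refine (eventually_all_finite (finite_Iic r)).2 fun s' hs' => ?_
    by_cases hs1 : 0 < s' ∧ s' < r
    · have h2 : x₀ < T.map^[s'] y :=
        lt_of_le_of_ne (hs s' hs1.1 (by omega)) fun h => Nat.find_min hex hs1.2 h.symm
      have h3 : ∀ᶠ δ in 𝓝[>] (0 : ℝ), δ < T.map^[s'] y - x₀ :=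
        mem_nhdsWithin_of_mem_nhds (Iio_mem_nhds (by linarith))
      filter_upwards [g s' hs', h3] with δ h4 h5 _ _
      rw [h4]
      linarith
    · exact Eventually.of_forall fun _ a b => absurd ⟨a, b⟩ hs1
  have h2 : ∀ᶠ δ in 𝓝[>] (0 : ℝ), δ < min x₀ (y - x₀ * T.topCut i) :=
    mem_nhdsWithin_of_mem_nhds (Iio_mem_nhds (lt_min h0 (by linarith [hy.1])))
  obtain ⟨δ, h3, h4, h5, h6⟩ := (h1.and (h2.and ((g r le_rfl).and self_mem_nhdsWithin))).exists
  have h6 : 0 < δ := h6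
  rw [hr] at h5
  have h7 := h4.trans_le (min_le_left _ _)
  have h8 := h4.trans_le (min_le_right _ _)
  -- Points just left of `y` enter the base just left of `x₀` at time `r`. The translation formula
  -- then makes the return point of `y` equal to `x₀`, which is outside the base.
  have hret : IsFirstReturnTime T.map (Ico 0 x₀) (y - δ) r := by
    refine ⟨hr0, ?_, fun s' a b c => ?_⟩
    · rw [h5]
      exact ⟨by linarith, by linarith⟩
    · exact absurd c.2 (not_lt.2 (h3 s' b.le a b).le)
  have h9 := first_return_eq hT hself (i := i) ⟨by linarith, by linarith [hy.2]⟩ hret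
  have h10 := first_return_eq hT hself (Ioo_subset_Ico_self hy) hn
  have := hn.2.1.2
  linarith

/-- The return time is constant on each base interval, and the floors of the towers are contained
in the exchanged intervals. -/
theorem exists_towers : ∃ (N : Fin d → ℕ) (w : Fin d → ℕ → Fin d), ∀ i : Fin d,
    ∀ y ∈ Ico (x₀ * T.topCut i) (x₀ * T.topCut (i + 1)),
      IsFirstReturnTime T.map (Ico 0 x₀) y (N i) ∧
      (∀ s ≤ N i, T.map^[s] y = T.map^[s] (x₀ * T.topCut i) + (y - x₀ * T.topCut i)) ∧
      ∀ s < N i, T.map^[s] y ∈ Ico (T.topCut (w i s)) (T.topCut (w i s + 1)) := by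
  have h0 := hself.1
  have hx1 := hself.2.1
  have hl : ∀ i : Fin d, x₀ * T.topCut i ∈ Ico (x₀ * T.topCut i) (x₀ * T.topCut (i + 1)) :=
    fun i => ⟨le_rfl, mul_lt_mul_of_pos_left (T.topCut_lt (Nat.lt_succ_self _) i.2) h0⟩
  have h1 : ∀ i : Fin d, ∃ n, IsFirstReturnTime T.map (Ico 0 x₀) (x₀ * T.topCut i) n := fun i =>
    (hself.exists_returnTime (baseInterval_subset hself (hl i))).imp fun _ h => h.1
  choose N hN using h1
  have hI : ∀ i : Fin d, x₀ * T.topCut i ∈ Ico (0 : ℝ) 1 := fun i => by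
    have := baseInterval_subset hself (hl i)
    exact ⟨this.1, this.2.trans hx1⟩
  have h2 : ∀ (i : Fin d) (s : ℕ), ∃ j : Fin d,
      T.map^[s] (x₀ * T.topCut i) ∈ Ico (T.topCut j) (T.topCut (j + 1)) :=
    fun i s => T.exists_mem_top (T.iterate_mem (hI i) s)
  choose w hw using h2
  refine ⟨N, w, fun i y hy => ?_⟩
  have hyI := baseInterval_subset hself hy
  obtain ⟨h3, h4, h5⟩ := hT.returns_together hx1 (hI i).1 hy.1 hyI.2 (hN i) (by
    rintro c hcy v hv ⟨hcI, s, hs, hs'⟩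
    have hcJ : c ∈ Ioo (x₀ * T.topCut i) (x₀ * T.topCut (i + 1)) :=
      ⟨hcy.1, hcy.2.trans_lt hy.2⟩
    rcases hv with rfl | hv
    · exact iterate_ne_of_mem_interior hd hσ hT hc hself hcJ hs' hs
    · obtain ⟨n, hn, -⟩ := hself.exists_returnTime hcI
      refine iterate_notMem_topCuts_of_mem_interior hd hσ hT hc hself hcJ hn (m := s) ?_ (hs ▸ hv)
      by_contra! h
      have := hs' n hn.1 h
      linarith [hn.2.1.2])
  refine ⟨h3, h4, fun s hs => ?_⟩
  refine T.mem_top_of_no_cut (hw i s) ?_ (T.iterate_mem ⟨hyI.1, hyI.2.trans hx1⟩ s).2 (h5 s hs)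
  rw [h4 s hs.le]
  linarith [hy.1]

end SelfSimilar

end GIET

/-! ### Itineraries and abstract systems of towers; the floors cover `[0,1)`. -/

namespace GIET

variable {d : ℕ} {σ : Equiv.Perm (Fin d)} {T : GIET σ}

/-- The composition of the first `n` branches of `T` along the itinerary `w`. -/
def word (T : GIET σ) (w : ℕ → Fin d) : ℕ → (ℝ ≃o ℝ)
  | 0 => OrderIso.refl ℝ
  | n + 1 => (word T w n).trans (T.branch (w n))

@[simp] lemma word_zero (T : GIET σ) (w : ℕ → Fin d) (y : ℝ) : T.word w 0 y = y := rfl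

lemma word_succ (T : GIET σ) (w : ℕ → Fin d) (n : ℕ) (y : ℝ) :
    T.word w (n + 1) y = T.branch (w n) (T.word w n y) := rfl

lemma iterate_eq_word (T : GIET σ) {w : ℕ → Fin d} {n : ℕ} {y : ℝ}
    (h : ∀ s < n, T.word w s y ∈ Ico (T.topCut (w s)) (T.topCut (w s + 1))) :
    ∀ s ≤ n, T.map^[s] y = T.word w s y := by
  intro s
  induction s with
  | zero => intro _; rfl
  | succ s ih =>
    intro hs
    rw [Function.iterate_succ_apply', ih (by omega), word_succ, T.map_eq_branch (h s (by omega))]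

lemma word_eq_iterate (T : GIET σ) {w : ℕ → Fin d} {n : ℕ} {y : ℝ}
    (h : ∀ s < n, T.map^[s] y ∈ Ico (T.topCut (w s)) (T.topCut (w s + 1))) :
    ∀ s ≤ n, T.word w s y = T.map^[s] y := by
  intro s
  induction s with
  | zero => intro _; rfl
  | succ s ih =>
    intro hs
    rw [Function.iterate_succ_apply', word_succ, ih (by omega), T.map_eq_branch (h s (by omega))]

/-- The left endpoints of the floors of a system of towers: the `i`-th tower has height `N i`,
itinerary `w i` and base with left endpoint `p i`; for `i > 0` the left endpoint
reaches the discontinuity `κ i` at floor `τ i`. -/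
structure TowerFrame (T : GIET σ) (N : Fin d → ℕ) (w : Fin d → ℕ → Fin d) (κ : Fin d → Fin d)
    (τ : Fin d → ℕ) (p : ℕ → ℝ) : Prop where
  zero : p 0 = 0
  lt_succ : ∀ i : Fin d, p i < p (i + 1)
  lt_one : p d < 1
  N_pos : ∀ i, 0 < N i
  left_mem : ∀ i : Fin d, ∀ s < N i,
    T.word (w i) s (p i) ∈ Ico (T.topCut (w i s)) (T.topCut (w i s + 1))
  cut : ∀ i : Fin d, 0 < (i : ℕ) → T.word (w i) (τ i) (p i) = T.topCut (κ i)
  τ_lt : ∀ i : Fin d, 0 < (i : ℕ) → τ i < N i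
  κ_pos : ∀ i : Fin d, 0 < (i : ℕ) → 0 < (κ i : ℕ)
  κ_surj : ∀ k : Fin d, 0 < (k : ℕ) → ∃ i : Fin d, 0 < (i : ℕ) ∧ κ i = k
  notMem : ∀ i : Fin d, ∀ s < N i, (0 < (i : ℕ) → s ≠ τ i) →
    T.word (w i) s (p i) ∉ T.topCuts
  base_le : ∀ i : Fin d, ∀ s < N i, 0 < s → p d ≤ T.word (w i) s (p i)

/-- A system of towers over the partition `p` of the base `[0, p d)`. -/
structure Towers (T : GIET σ) (N : Fin d → ℕ) (w : Fin d → ℕ → Fin d) (κ : Fin d → Fin d)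
    (τ : Fin d → ℕ) (p : ℕ → ℝ) : Prop extends TowerFrame T N w κ τ p where
  mem : ∀ i : Fin d, ∀ y ∈ Ico (p i) (p (i + 1)), ∀ s < N i,
    T.word (w i) s y ∈ Ico (T.topCut (w i s)) (T.topCut (w i s + 1))
  ret : ∀ i : Fin d, ∀ y ∈ Ico (p i) (p (i + 1)), T.word (w i) (N i) y < p d

namespace TowerFrame

variable {N : Fin d → ℕ} {w : Fin d → ℕ → Fin d} {κ : Fin d → Fin d} {τ : Fin d → ℕ} {p : ℕ → ℝ}

lemma mono (h : TowerFrame T N w κ τ p) {k l : ℕ} (hkl : k ≤ l) (hl : l ≤ d) : p k ≤ p l := by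
  induction l, hkl using Nat.le_induction with
  | base => exact le_rfl
  | succ l hkl ih => exact (ih (by omega)).trans (h.lt_succ ⟨l, hl⟩).le

lemma lt (h : TowerFrame T N w κ τ p) {k l : ℕ} (hkl : k < l) (hl : l ≤ d) : p k < p l :=
  (h.lt_succ ⟨k, by omega⟩).trans_le (h.mono (show k + 1 ≤ l from hkl) hl)

lemma nonneg (h : TowerFrame T N w κ τ p) {k : ℕ} (hk : k ≤ d) : 0 ≤ p k := by
  have := h.mono (Nat.zero_le k) hk
  rwa [h.zero] at this

lemma mem_base (h : TowerFrame T N w κ τ p) {i : Fin d} {y : ℝ} (hy : y ∈ Ico (p i) (p (i + 1))) :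
    y ∈ Ico 0 (p d) :=
  ⟨(h.nonneg i.2.le).trans hy.1, hy.2.trans_le (h.mono i.2 le_rfl)⟩

lemma mem_unit (h : TowerFrame T N w κ τ p) {i : Fin d} {y : ℝ} (hy : y ∈ Ico (p i) (p (i + 1))) :
    y ∈ Ico (0 : ℝ) 1 := Ico_subset_Ico_right h.lt_one.le (h.mem_base hy)

lemma left_mem_base (h : TowerFrame T N w κ τ p) (i : Fin d) : p i ∈ Ico (p i) (p (i + 1)) :=
  ⟨le_rfl, h.lt_succ i⟩

lemma exists_mem_base (h : TowerFrame T N w κ τ p) {y : ℝ} (hy : y ∈ Ico 0 (p d)) :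
    ∃ i : Fin d, y ∈ Ico (p i) (p (i + 1)) := by
  by_contra! hno
  have key : ∀ k : ℕ, k ≤ d → p k ≤ y := by
    intro k
    induction k with
    | zero => intro _; rw [h.zero]; exact hy.1
    | succ k ih =>
      intro hk
      have h1 := hno ⟨k, hk⟩
      by_contra! h2
      exact h1 ⟨ih (by omega), h2⟩
  exact absurd hy.2 (not_lt.2 (key d le_rfl))

lemma base_index_eq (h : TowerFrame T N w κ τ p) {i j : Fin d} {y : ℝ}
    (hi : y ∈ Ico (p i) (p (i + 1))) (hj : y ∈ Ico (p j) (p (j + 1))) : i = j := by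
  by_contra hne
  rcases lt_or_gt_of_ne hne with h1 | h1
  · have := h.mono (show (i : ℕ) + 1 ≤ j from h1) j.2.le
    linarith [hi.2, hj.1]
  · have := h.mono (show (j : ℕ) + 1 ≤ i from h1) i.2.le
    linarith [hj.2, hi.1]

end TowerFrame

namespace Towers

variable {N : Fin d → ℕ} {w : Fin d → ℕ → Fin d} {κ : Fin d → Fin d} {τ : Fin d → ℕ} {p : ℕ → ℝ}

lemma iterate_eq (h : Towers T N w κ τ p) {i : Fin d} {y : ℝ} (hy : y ∈ Ico (p i) (p (i + 1)))
    {s : ℕ} (hs : s ≤ N i) : T.map^[s] y = T.word (w i) s y :=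
  T.iterate_eq_word (h.mem i y hy) s hs

lemma base_le' (h : Towers T N w κ τ p) {i : Fin d} {y : ℝ} (hy : y ∈ Ico (p i) (p (i + 1)))
    {s : ℕ} (hs : s < N i) (hs0 : 0 < s) : p d ≤ T.word (w i) s y :=
  (h.base_le i s hs hs0).trans ((T.word (w i) s).monotone hy.1)

lemma isFirstReturnTime (h : Towers T N w κ τ p) {i : Fin d} {y : ℝ}
    (hy : y ∈ Ico (p i) (p (i + 1))) : IsFirstReturnTime T.map (Ico 0 (p d)) y (N i) := by
  refine ⟨h.N_pos i, ⟨(T.iterate_mem (h.mem_unit hy) _).1, ?_⟩, fun m h1 h2 h3 => ?_⟩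
  · rw [h.iterate_eq hy le_rfl]
    exact h.ret i y hy
  · rw [h.iterate_eq hy h2.le] at h3
    exact absurd h3.2 (not_lt.2 (h.base_le' hy h2 h1))

/-- The floors of the towers are disjoint. -/
lemma floor_index_eq (h : Towers T N w κ τ p) {i j : Fin d} {y z : ℝ} {s t : ℕ}
    (hy : y ∈ Ico (p i) (p (i + 1))) (hz : z ∈ Ico (p j) (p (j + 1))) (hs : s < N i) (ht : t < N j)
    (he : T.word (w i) s y = T.word (w j) t z) : i = j ∧ s = t := by
  have key : ∀ {i j : Fin d} {y z : ℝ} {s t : ℕ}, y ∈ Ico (p i) (p (i + 1)) →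
      z ∈ Ico (p j) (p (j + 1)) → s < N i → t < N j → s ≤ t →
      T.word (w i) s y = T.word (w j) t z → i = j ∧ s = t := by
    intro i j y z s t hy hz hs ht hst he
    rw [← h.iterate_eq hy hs.le, ← h.iterate_eq hz ht.le] at he
    have h1 := T.iterate_cancel (h.mem_unit hy) (h.mem_unit hz) hst he
    rcases hst.eq_or_lt with h2 | h2
    · subst h2
      rw [Nat.sub_self, Function.iterate_zero_apply] at h1
      exact ⟨h.base_index_eq hy (h1 ▸ hz), rfl⟩
    · rw [h.iterate_eq hz (by omega)] at h1
      have := h.base_le' hz (s := t - s) (by omega) (by omega)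
      rw [← h1] at this
      exact absurd (h.mem_base hy).2 (not_lt.2 this)
  rcases le_total s t with h1 | h1
  · exact key hy hz hs ht h1 he
  · have := key hz hy ht hs h1 he.symm
    exact ⟨this.1.symm, this.2.symm⟩

/-- The union of the floors of the towers. -/
def floors (T : GIET σ) (N : Fin d → ℕ) (w : Fin d → ℕ → Fin d) (p : ℕ → ℝ) : Set ℝ :=
  {x | ∃ i : Fin d, ∃ y ∈ Ico (p i) (p (i + 1)), ∃ s < N i, T.word (w i) s y = x}

lemma base_subset_floors (h : Towers T N w κ τ p) : Ico 0 (p d) ⊆ floors T N w p := by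
  intro y hy
  obtain ⟨i, hi⟩ := h.exists_mem_base hy
  exact ⟨i, y, hi, 0, h.N_pos i, rfl⟩

lemma map_mem_floors (h : Towers T N w κ τ p) {x : ℝ} (hx : x ∈ floors T N w p) :
    T.map x ∈ floors T N w p := by
  obtain ⟨i, y, hy, s, hs, rfl⟩ := hx
  have h1 : T.map (T.word (w i) s y) = T.word (w i) (s + 1) y := by
    rw [word_succ, T.map_eq_branch (h.mem i y hy s hs)]
  rw [h1]
  rcases (show s + 1 ≤ N i from hs).lt_or_eq with h2 | h2
  · exact ⟨i, y, hy, s + 1, h2, rfl⟩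
  · refine h.base_subset_floors ⟨?_, ?_⟩
    · rw [← h1]
      exact (T.map_mem (T.Ico_top_subset _ (h.mem i y hy s hs))).1
    · rw [h2]
      exact h.ret i y hy

/-- The floors are forward invariant, and a branch carries left neighbourhoods to left
neighbourhoods, also at the right end of its interval. -/
lemma eventually_left_branch (h : Towers T N w κ τ p) {j : Fin d} {v : ℝ}
    (hv : v ∈ Ioc (T.topCut j) (T.topCut (j + 1)))
    (hL : ∀ᶠ y in 𝓝[<] v, y ∈ floors T N w p) :
    ∀ᶠ z in 𝓝[<] (T.branch j v), z ∈ floors T N w p := by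
  have ht : Tendsto (T.branch j).symm (𝓝[<] (T.branch j v)) (𝓝[<] v) := by
    refine tendsto_nhdsWithin_iff.2 ⟨?_, ?_⟩
    · have := (T.branch j).symm.continuous.tendsto (T.branch j v)
      rw [OrderIso.symm_apply_apply] at this
      exact this.mono_left nhdsWithin_le_nhds
    · filter_upwards [self_mem_nhdsWithin] with z hz
      have hz : z < T.branch j v := hz
      rw [mem_Iio, ← (T.branch j).lt_iff_lt, OrderIso.apply_symm_apply]
      exact hz
  filter_upwards [ht.eventually hL, ht.eventually (Ioo_mem_nhdsLT hv.1)] with z h1 h2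
  have h3 := h.map_mem_floors h1
  rwa [T.map_eq_branch (i := j) ⟨h2.1.le, h2.2.trans_le hv.2⟩, OrderIso.apply_symm_apply] at h3

lemma eventually_left_base (h : Towers T N w κ τ p) {k : ℕ} (hk0 : 0 < k) (hk : k ≤ d) :
    ∀ᶠ y in 𝓝[<] (p k), y ∈ floors T N w p := by
  have h1 : 0 < p k := by simpa [h.zero] using h.lt hk0 hk
  filter_upwards [Ioo_mem_nhdsLT h1] with y hy
  exact h.base_subset_floors ⟨hy.1.le, hy.2.trans_le (h.mono hk le_rfl)⟩

section

variable (hd : 2 ≤ d) (hσ : numMarkedPoints σ = 1)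
include hd

/-- Some left endpoint of the base reaches this discontinuity. Strictly between, its orbit stays
inside the branches, so the left neighbourhood of the base point, which is covered, travels along.
-/
lemma eventually_left_topCut (h : Towers T N w κ τ p) {k : Fin d} (hk : 0 < (k : ℕ)) :
    ∀ᶠ y in 𝓝[<] (T.topCut k), y ∈ floors T N w p := by
  obtain ⟨i, hi, rfl⟩ := h.κ_surj k hk
  have key : ∀ s ≤ τ i, ∀ᶠ y in 𝓝[<] (T.word (w i) s (p i)), y ∈ floors T N w p := by
    intro s
    induction s with
    | zero => intro _; exact h.eventually_left_base hi i.2.le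
    | succ s ih =>
      intro hs
      have hsN : s < N i := by have := h.τ_lt i hi; omega
      have h1 := h.left_mem i s hsN
      have h2 := h.notMem i s hsN fun _ => by omega
      refine h.eventually_left_branch ⟨lt_of_le_of_ne h1.1
        fun he : T.topCut (w i s) = T.word (w i) s (p i) => ?_, h1.2.le⟩ (ih (by omega))
      rcases Nat.eq_zero_or_pos (w i s : ℕ) with h0 | h0
      · rw [h0, topCut_zero] at he
        have hpd : 0 < p d := by simpa [h.zero] using h.lt (show 0 < d by omega) le_rfl
        rcases Nat.eq_zero_or_pos s with rfl | hs0
        · have : 0 < p i := by simpa [h.zero] using h.lt hi i.2.le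
          rw [word_zero] at he
          linarith
        · have := h.base_le i s hsN hs0
          linarith
      · exact h2 ⟨_, h0, he.symm⟩
  rw [← h.cut i hi]
  exact key _ le_rfl

include hσ

/-- A bottom cut is approached by images of points just left of a top cut. When that top cut is `1`
one needs the covering near `1`, obtained first: by `perm_last_ne` the interval sent to the last
place is not itself the last one. -/
lemma eventually_left_botCut (h : Towers T N w κ τ p) {l : ℕ} (hl0 : 0 < l) (hl : l ≤ d) :
    ∀ᶠ y in 𝓝[<] (T.botCut l), y ∈ floors T N w p := by
  have key : ∀ j : Fin d, (j : ℕ) + 1 < d →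
      ∀ᶠ y in 𝓝[<] (T.botCut (σ j + 1)), y ∈ floors T N w p := by
    intro j hj
    rw [← T.branch_right j]
    exact h.eventually_left_branch ⟨T.topCut_lt (Nat.lt_succ_self _) j.2, le_rfl⟩
      (h.eventually_left_topCut hd (k := ⟨j + 1, hj⟩) (Nat.succ_pos _))
  have hone : ∀ᶠ y in 𝓝[<] (1 : ℝ), y ∈ floors T N w p := by
    let b : Fin d := ⟨d - 1, by omega⟩
    have h1 : (σ (σ.symm b) : ℕ) + 1 = d := by
      rw [Equiv.apply_symm_apply]
      simp only [b]
      omega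
    have h2 := key (σ.symm b) (by
      by_contra! h3
      exact perm_last_ne hd hσ (le_antisymm (σ.symm b).2 h3) h1)
    rwa [h1, botCut_last] at h2
  let b : Fin d := ⟨l - 1, by omega⟩
  have h1 : (σ (σ.symm b) : ℕ) + 1 = l := by
    rw [Equiv.apply_symm_apply]
    simp only [b]
    omega
  rw [← h1]
  by_cases hj : (σ.symm b : ℕ) + 1 < d
  · exact key _ hj
  · have hj : (σ.symm b : ℕ) + 1 = d := by have := (σ.symm b).2; omega
    rw [← T.branch_right]
    refine h.eventually_left_branch ⟨T.topCut_lt (Nat.lt_succ_self _) (σ.symm b).2, le_rfl⟩ ?_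
    rw [hj, topCut_last]
    exact hone

/-- A floor starting inside an exchanged interval inherits the property from the floor below; one
starting at a cut is sent to a bottom cut. -/
lemma eventually_left_floor (h : Towers T N w κ τ p) (i : Fin d) :
    ∀ s < N i, 0 < T.word (w i) s (p i) →
      ∀ᶠ y in 𝓝[<] (T.word (w i) s (p i)), y ∈ floors T N w p := by
  intro s
  induction s with
  | zero =>
    intro _ hpos
    refine h.eventually_left_base (Nat.pos_of_ne_zero fun h0 => ?_) i.2.le
    rw [word_zero, h0, h.zero] at hpos
    exact lt_irrefl _ hpos
  | succ s ih =>
    intro hs hpos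
    have h1 := h.left_mem i s (by omega)
    rcases h1.1.eq_or_lt with he | hlt
    · rw [word_succ, ← he, branch_left] at hpos ⊢
      refine h.eventually_left_botCut hd hσ (Nat.pos_of_ne_zero fun h0 => ?_) (σ (w i s)).2.le
      rw [h0, botCut_zero] at hpos
      exact lt_irrefl _ hpos
    · exact h.eventually_left_branch ⟨hlt, h1.2.le⟩
        (ih (by omega) ((T.topCut_nonneg _).trans_lt hlt))

/-- The floors of the towers cover `[0,1)`. -/
theorem mem_floors (h : Towers T N w κ τ p) {x : ℝ} (hx : x ∈ Ico (0 : ℝ) 1) :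
    x ∈ floors T N w p := by
  by_contra hxU
  -- The left ends of the floors, together with `1`. The next such point `q` after an uncovered `x`
  -- is approached from the left by floors; a floor meeting `(x, q)` must begin at or before `x`,
  -- hence contains it.
  let Q : Set ℝ := insert 1 (⋃ i : Fin d, (fun s => T.word (w i) s (p i)) '' Iio (N i))
  have hQ : Q.Finite :=
    (Set.finite_iUnion fun i => (finite_Iio (N i)).image _).insert 1
  obtain ⟨q, ⟨hq1, hq2⟩, hqmin⟩ := (hQ.subset (sep_subset Q fun q => x < q)).exists_minimal
    ⟨1, mem_insert _ _, hx.2⟩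
  have hL : ∀ᶠ y in 𝓝[<] q, y ∈ floors T N w p := by
    rcases hq1 with rfl | hq1
    · simpa using h.eventually_left_botCut hd hσ (show 0 < d by omega) le_rfl
    · obtain ⟨i, s, hs, rfl⟩ := mem_iUnion.1 hq1
      exact h.eventually_left_floor hd hσ i s hs (hx.1.trans_lt hq2)
  obtain ⟨y, ⟨i, y₀, hy₀, s, hs, rfl⟩, hy2⟩ := (hL.and (Ioo_mem_nhdsLT hq2)).exists
  have h1 : T.word (w i) s (p i) ≤ T.word (w i) s y₀ := (T.word (w i) s).monotone hy₀.1
  have h2 : T.word (w i) s (p i) ≤ x := by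
    by_contra! h3
    have := hqmin ⟨mem_insert_of_mem _ (mem_iUnion.2 ⟨i, s, hs, rfl⟩), h3⟩ (h1.trans hy2.2.le)
    linarith [hy2.2]
  refine hxU ⟨i, (T.word (w i) s).symm x, ⟨?_, ?_⟩, s, hs, OrderIso.apply_symm_apply _ _⟩
  · rwa [OrderIso.le_symm_apply]
  · rw [OrderIso.symm_apply_lt]
    exact hy2.1.trans ((T.word (w i) s).strictMono hy₀.2)

/-- The first return map to the base is onto. -/
theorem exists_return_eq (h : Towers T N w κ τ p) {z : ℝ} (hz : z ∈ Ico 0 (p d)) :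
    ∃ i : Fin d, ∃ y ∈ Ico (p i) (p (i + 1)), T.word (w i) (N i) y = z := by
  obtain ⟨x, hx, hxz⟩ := T.surjOn_map (Ico_subset_Ico_right h.lt_one.le hz)
  obtain ⟨i, y, hy, s, hs, rfl⟩ := h.mem_floors hd hσ hx
  rw [T.map_eq_branch (h.mem i y hy s hs), ← word_succ] at hxz
  rcases (show s + 1 ≤ N i from hs).lt_or_eq with h2 | h2
  · have := h.base_le' hy h2 (Nat.succ_pos s)
    rw [hxz] at this
    exact absurd hz.2 (not_lt.2 this)
  · exact ⟨i, y, hy, h2 ▸ hxz⟩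

end

end Towers

/-! ### The towers of a self-similar standard exchange. -/

section SelfSimilar

variable {x₀ : ℝ} (hd : 2 ≤ d) (hσ : numMarkedPoints σ = 1) (hT : T.IsStandard)
  (hc : T.NoConnection) (hself : IsRescaledFirstReturn x₀ T T)

include hd hσ hT hc hself

/-- A self-similar standard interval exchange decomposes `[0,1)` into towers. -/
theorem exists_towers_frame : ∃ (N : Fin d → ℕ) (w : Fin d → ℕ → Fin d) (κ : Fin d → Fin d)
    (τ : Fin d → ℕ) (i₁ : Fin d) (m₁ : ℕ), Towers T N w κ τ (fun k => x₀ * T.topCut k) ∧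
      0 < m₁ ∧ m₁ < N i₁ ∧ T.word (w i₁) m₁ (x₀ * T.topCut i₁) = x₀ := by
  obtain ⟨N, w, hNw⟩ := exists_towers hd hσ hT hc hself
  have h0 := hself.1
  have hx1 := hself.2.1
  have hl : ∀ i : Fin d, x₀ * T.topCut i ∈ Ico (x₀ * T.topCut i) (x₀ * T.topCut (i + 1)) :=
    fun i => ⟨le_rfl, mul_lt_mul_of_pos_left (T.topCut_lt (Nat.lt_succ_self _) i.2) h0⟩
  have hbase : ∀ {i : Fin d} {y : ℝ}, y ∈ Ico (x₀ * T.topCut i) (x₀ * T.topCut (i + 1)) →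
      y ∈ Ico 0 x₀ := fun hy => baseInterval_subset hself hy
  have hunit : ∀ {i : Fin d} {y : ℝ}, y ∈ Ico (x₀ * T.topCut i) (x₀ * T.topCut (i + 1)) →
      y ∈ Ico (0 : ℝ) 1 := fun hy => Ico_subset_Ico_right hx1.le (hbase hy)
  have hword : ∀ (i : Fin d), ∀ y ∈ Ico (x₀ * T.topCut i) (x₀ * T.topCut (i + 1)), ∀ s ≤ N i,
      T.word (w i) s y = T.map^[s] y := fun i y hy => T.word_eq_iterate (hNw i y hy).2.2
  have hindex : ∀ y ∈ Ico 0 x₀, ∃ i : Fin d,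
      y ∈ Ico (x₀ * T.topCut i) (x₀ * T.topCut (i + 1)) := by
    intro y hy
    obtain ⟨i, hi⟩ := T.exists_mem_top (x := y / x₀) ⟨div_nonneg hy.1 h0.le, (div_lt_one h0).2 hy.2⟩
    exact ⟨i, (le_div_iff₀' h0).1 hi.1, (div_lt_iff₀' h0).1 hi.2⟩
  have hbl : ∀ i : Fin d, ∀ y ∈ Ico (x₀ * T.topCut i) (x₀ * T.topCut (i + 1)), ∀ s < N i, 0 < s →
      x₀ ≤ T.map^[s] y := fun i y hy s hs hs0 =>
    (hNw i y hy).1.le_iterate (hunit hy) hs0 hs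
  -- the union of the floors
  let U : Set ℝ := {x | ∃ i : Fin d, ∃ y ∈ Ico (x₀ * T.topCut i) (x₀ * T.topCut (i + 1)),
    ∃ s < N i, T.map^[s] y = x}
  have hUbase : ∀ y ∈ Ico 0 x₀, y ∈ U := fun y hy => by
    obtain ⟨i, hi⟩ := hindex y hy
    exact ⟨i, y, hi, 0, (hNw i y hi).1.1, rfl⟩
  have hUmap : ∀ x ∈ U, T.map x ∈ U := by
    rintro _ ⟨i, y, hy, s, hs, rfl⟩
    rw [← Function.iterate_succ_apply' T.map s]
    rcases (show s + 1 ≤ N i from hs).lt_or_eq with h2 | h2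
    · exact ⟨i, y, hy, s + 1, h2, rfl⟩
    · have h3 := hUbase _ (hNw i y hy).1.2.1
      rwa [← h2] at h3
  -- Below the base one needs the return map to be onto, which self-similarity supplies.
  have hUinv : ∀ x ∈ U, T.inv x ∈ U := by
    have hb : ∀ z ∈ Ico 0 x₀, T.inv z ∈ U := by
      intro z hz
      obtain ⟨v, hv, hvz⟩ := T.surjOn_map (a := z / x₀)
        ⟨div_nonneg hz.1 h0.le, (div_lt_one h0).2 hz.2⟩
      have hv' : x₀ * v ∈ Ico 0 x₀ := ⟨mul_nonneg h0.le hv.1, by nlinarith [hv.2]⟩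
      obtain ⟨i, hi⟩ := hindex _ hv'
      obtain ⟨n, hn, he⟩ := hself.exists_returnTime hv'
      rw [mul_div_cancel_left₀ _ h0.ne', hvz, mul_div_cancel₀ _ h0.ne'] at he
      rw [hn.unique (hNw i _ hi).1] at he
      obtain ⟨r, hr⟩ := Nat.exists_eq_add_of_le' (hNw i _ hi).1.1
      rw [hr, Function.iterate_succ_apply'] at he
      rw [← he, T.inv_map (T.iterate_mem (hunit hi) r)]
      exact ⟨i, _, hi, r, by omega, rfl⟩
    rintro _ ⟨i, y, hy, s, hs, rfl⟩
    cases s with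
    | zero => exact hb _ (hbase hy)
    | succ s =>
      rw [Function.iterate_succ_apply', T.inv_map (T.iterate_mem (hunit hy) s)]
      exact ⟨i, y, hy, s, by omega, rfl⟩
  have hzero : (0 : ℝ) ∈ U := hUbase 0 ⟨le_rfl, h0⟩
  -- There are finitely many floors, each closed on the left, so the complement is open on the
  -- right.
  have hUright : ∀ x, x ∉ U → ∃ b > x, ∀ y ∈ Ico x b, y ∉ U := by
    intro x hx
    let I : Set (Fin d × ℕ) := ⋃ i : Fin d, (fun s => (i, s)) '' Iio (N i)
    have hI : I.Finite := Set.finite_iUnion fun i => (finite_Iio (N i)).image _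
    have h1 : ∀ᶠ b in 𝓝[>] x, ∀ q ∈ I, x < T.map^[q.2] (x₀ * T.topCut q.1) →
        b < T.map^[q.2] (x₀ * T.topCut q.1) := by
      refine (eventually_all_finite hI).2 fun q _ => ?_
      by_cases hq : x < T.map^[q.2] (x₀ * T.topCut q.1)
      · filter_upwards [Ioo_mem_nhdsGT hq] with b hb _ using hb.2
      · exact Eventually.of_forall fun _ h => absurd h hq
    obtain ⟨b, h2, h3⟩ := (h1.and self_mem_nhdsWithin).exists
    refine ⟨b, h3, ?_⟩
    rintro y hy ⟨i, z, hz, s, hs, rfl⟩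
    have hmem : (i, s) ∈ I := mem_iUnion.2 ⟨i, s, hs, rfl⟩
    have h4 := (hNw i z hz).2.1 s hs.le
    have h5 : T.map^[s] (x₀ * T.topCut i) ≤ x := by
      by_contra! h5
      have := h2 _ hmem h5
      simp only at this
      linarith [hy.2, hz.1]
    refine hx ⟨i, x₀ * T.topCut i + (x - T.map^[s] (x₀ * T.topCut i)),
      ⟨by linarith, by linarith [hy.1, hz.2]⟩, s, hs, ?_⟩
    rw [(hNw i _ ⟨by linarith, by linarith [hy.1, hz.2]⟩).2.1 s hs.le]
    ring
  -- every discontinuity lies in some floor, hence is the orbit of a left endpoint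
  have hcutU : ∀ k : Fin d, 0 < (k : ℕ) → T.topCut k ∈ U := by
    intro k hk
    by_contra hkU
    obtain ⟨b, hb, hbU⟩ := hUright _ hkU
    obtain ⟨n, hn | hn⟩ := exists_orbit_zero_mem_Ico hd hσ hc hT ⟨k, hk, rfl⟩ hb
    · exact hbU _ hn (MapsTo.iterate (fun x => hUmap x) n hzero)
    · exact hbU _ hn (MapsTo.iterate (fun x => hUinv x) n hzero)
  have hleft : ∀ k : Fin d, 0 < (k : ℕ) → ∃ i : Fin d, 0 < (i : ℕ) ∧ ∃ s < N i,
      T.map^[s] (x₀ * T.topCut i) = T.topCut k := by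
    intro k hk
    obtain ⟨i, y, hy, s, hs, he⟩ := hcutU k hk
    have hy' : y = x₀ * T.topCut i := by
      by_contra hne
      exact iterate_notMem_topCuts_of_mem_interior hd hσ hT hc hself
        ⟨lt_of_le_of_ne hy.1 (Ne.symm hne), hy.2⟩ (hNw i y hy).1 hs ⟨k, hk, he⟩
    subst hy'
    refine ⟨i, Nat.pos_of_ne_zero fun hi => ?_, s, hs, he⟩
    rw [hi, topCut_zero, mul_zero] at he
    exact iterate_zero_notMem_topCuts hd hσ hc s ⟨k, hk, he⟩
  choose! ι hι0 s₀ hs₀ hs₁ using hleft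
  let P := {k : Fin d // 0 < (k : ℕ)}
  have huniq : ∀ {i k k' : Fin d} {s s' : ℕ}, 0 < (k : ℕ) → 0 < (k' : ℕ) →
      T.map^[s] (x₀ * T.topCut i) = T.topCut k → T.map^[s'] (x₀ * T.topCut i) = T.topCut k' →
      s = s' ∧ k = k' := by
    have key : ∀ {i k k' : Fin d} {s s' : ℕ}, s ≤ s' → 0 < (k : ℕ) → 0 < (k' : ℕ) →
        T.map^[s] (x₀ * T.topCut i) = T.topCut k → T.map^[s'] (x₀ * T.topCut i) = T.topCut k' →
        s = s' ∧ k = k' := by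
      intro i k k' s s' hss hk hk' h1 h2
      obtain ⟨r, rfl⟩ := Nat.exists_eq_add_of_le' hss
      rw [Function.iterate_add_apply, h1] at h2
      rcases Nat.eq_zero_or_pos r with rfl | hr
      · refine ⟨by omega, ?_⟩
        have h2 : T.topCut k = T.topCut k' := h2
        by_contra hne
        rcases lt_or_gt_of_ne hne with h | h
        · exact (T.topCut_lt h k.2).ne h2
        · exact (T.topCut_lt h k'.2).ne' h2
      · exact absurd ⟨k', hk', h2⟩ (hc.iterate_notMem hk hr)
    intro i k k' s s' hk hk' h1 h2
    rcases le_total s s' with h | h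
    · exact key h hk hk' h1 h2
    · have := key h hk' hk h2 h1
      exact ⟨this.1.symm, this.2.symm⟩
  -- Different discontinuities lie over different left endpoints. Both are indexed by the same
  -- finite set, so every nonzero left endpoint meets exactly one discontinuity.
  let f : P → P := fun k => ⟨ι k.1, hι0 k.1 k.2⟩
  have hfinj : Function.Injective f := by
    intro k k' h
    have h1 : ι k.1 = ι k'.1 := congrArg Subtype.val h
    have h2 := hs₁ k.1 k.2
    have h3 := hs₁ k'.1 k'.2
    rw [← h1] at h3
    exact Subtype.ext (huniq k.2 k'.2 h2 h3).2
  have hfsurj : Function.Surjective f := Finite.surjective_of_injective hfinj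
  have hκ : ∀ i : Fin d, 0 < (i : ℕ) → ∃ k : Fin d, 0 < (k : ℕ) ∧ ∃ s < N i,
      T.map^[s] (x₀ * T.topCut i) = T.topCut k := by
    intro i hi
    obtain ⟨k, hk⟩ := hfsurj ⟨i, hi⟩
    have hk : ι k.1 = i := congrArg Subtype.val hk
    refine ⟨k.1, k.2, s₀ k.1, hk ▸ hs₀ k.1 k.2, ?_⟩
    have := hs₁ k.1 k.2
    rwa [hk] at this
  choose! κ hκ0 τ hτ hκτ using hκ
  have hpd : x₀ * T.topCut d = x₀ := by rw [topCut_last, mul_one]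
  have htow : Towers T N w κ τ (fun k => x₀ * T.topCut k) := by
    refine ⟨⟨by simp, fun i => (hl i).2, by simpa [hpd] using hx1, fun i => (hNw i _ (hl i)).1.1,
      fun i s hs => ?_, fun i hi => ?_, hτ, hκ0, fun k hk => ⟨ι k, hι0 k hk, ?_⟩,
      fun i s hs hne hmem => ?_, fun i s hs hs0 => ?_⟩, fun i y hy s hs => ?_, fun i y hy => ?_⟩
    · rw [hword i _ (hl i) s hs.le]
      exact (hNw i _ (hl i)).2.2 s hs
    · rw [hword i _ (hl i) _ (hτ i hi).le]
      exact hκτ i hi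
    · exact (huniq (hκ0 _ (hι0 k hk)) hk (hκτ _ (hι0 k hk)) (hs₁ k hk)).2
    · rw [hword i _ (hl i) s hs.le] at hmem
      obtain ⟨k, hk, he⟩ := hmem
      rcases Nat.eq_zero_or_pos (i : ℕ) with hi | hi
      · rw [hi, topCut_zero, mul_zero] at he
        exact iterate_zero_notMem_topCuts hd hσ hc s ⟨k, hk, he⟩
      · exact hne hi (huniq hk (hκ0 i hi) he (hκτ i hi)).1
    · rw [hword i _ (hl i) s hs.le, hpd]
      exact hbl i _ (hl i) s hs hs0
    · rw [hword i _ hy s hs.le]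
      exact (hNw i _ hy).2.2 s hs
    · rw [hword i _ hy _ le_rfl, hpd]
      exact (hNw i _ hy).1.2.1.2
  -- The end `x₀` of the base is covered, and can only be the left end of a floor; this describes it
  -- as an orbit point, in a form that makes sense for nearby maps.
  obtain ⟨i, y, hy, s, hs, he⟩ := htow.mem_floors hd hσ (x := x₀) ⟨h0.le, hx1⟩
  simp only at hy
  have hs0 : 0 < s := Nat.pos_of_ne_zero fun h => by
    subst h
    rw [word_zero] at he
    have := (hbase hy).2
    linarith
  refine ⟨N, w, κ, τ, i, s, htow, hs0, hs, ?_⟩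
  rw [hword i y hy s hs.le] at he
  have hy' : y = x₀ * T.topCut i := by
    by_contra hne
    exact iterate_ne_of_mem_interior hd hσ hT hc hself
      ⟨lt_of_le_of_ne hy.1 (Ne.symm hne), hy.2⟩
      (fun s' h1 h2 => hbl i y hy s' (by omega) h1) he
  rw [hword i _ (hl i) s hs.le, ← hy', he]

end SelfSimilar

end GIET

/-! ### The distances on diffeomorphisms. -/

namespace IntervalDiffeo

lemma bddAbove_abs_sub (f g : IntervalDiffeo) {i : ℕ} (hi : i ≤ 3) :
    BddAbove (range fun x : Icc (0 : ℝ) 1 =>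
      |iteratedDerivWithin i f.toFun (Icc 0 1) x - iteratedDerivWithin i g.toFun (Icc 0 1) x|) := by
  have hu : UniqueDiffOn ℝ (Icc (0 : ℝ) 1) := uniqueDiffOn_Icc zero_lt_one
  have hi' : ((i : ℕ) : WithTop ℕ∞) ≤ 3 := by exact_mod_cast hi
  have hcont : ContinuousOn (fun x => |iteratedDerivWithin i f.toFun (Icc 0 1) x -
      iteratedDerivWithin i g.toFun (Icc 0 1) x|) (Icc 0 1) :=
    ((f.contDiffOn.continuousOn_iteratedDerivWithin hi' hu).sub
      (g.contDiffOn.continuousOn_iteratedDerivWithin hi' hu)).abs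
  have := isCompact_Icc.bddAbove_image hcont
  refine this.mono ?_
  rintro _ ⟨x, rfl⟩
  exact ⟨x, x.2, rfl⟩

lemma abs_sub_le_cDist (f g : IntervalDiffeo) {k i : ℕ} (hk : k ≤ 3) (hi : i ≤ k) {x : ℝ}
    (hx : x ∈ Icc (0 : ℝ) 1) :
    |iteratedDerivWithin i f.toFun (Icc 0 1) x - iteratedDerivWithin i g.toFun (Icc 0 1) x| ≤
      cDist k f g := by
  have h1 := le_ciSup (bddAbove_abs_sub f g (hi.trans hk)) ⟨x, hx⟩
  refine h1.trans ?_
  exact le_ciSup (f := fun i : Fin (k + 1) => ⨆ x : Icc (0 : ℝ) 1,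
    |iteratedDerivWithin i f.toFun (Icc 0 1) x - iteratedDerivWithin i g.toFun (Icc 0 1) x|)
    (Set.finite_range _).bddAbove ⟨i, by omega⟩

lemma cDist_le {f g : IntervalDiffeo} {k : ℕ} {M : ℝ} (h : ∀ i ≤ k, ∀ x ∈ Icc (0 : ℝ) 1,
    |iteratedDerivWithin i f.toFun (Icc 0 1) x - iteratedDerivWithin i g.toFun (Icc 0 1) x| ≤ M) :
    cDist k f g ≤ M := by
  have : Nonempty (Icc (0 : ℝ) 1) := ⟨⟨0, left_mem_Icc.2 zero_le_one⟩⟩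
  exact ciSup_le fun i => ciSup_le fun x => h i (by omega) x x.2

lemma cDist_nonneg (f g : IntervalDiffeo) (k : ℕ) : 0 ≤ cDist k f g :=
  Real.iSup_nonneg fun _ => Real.iSup_nonneg fun _ => abs_nonneg _

lemma cDist_self (f : IntervalDiffeo) (k : ℕ) : cDist k f f = 0 :=
  le_antisymm (cDist_le fun _ _ _ _ => by simp) (cDist_nonneg _ _ _)

/-- The diffeomorphism extended by the identity, as an increasing homeomorphism of the line. -/
def iso (f : IntervalDiffeo) : ℝ ≃o ℝ :=
  StrictMono.orderIsoOfSurjective _ f.strictMono f.surjective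

lemma iso_apply (f : IntervalDiffeo) (x : ℝ) : f.iso x = f.toFun x := rfl

end IntervalDiffeo

/-! ### Limits of increasing homeomorphisms. -/

section OrderIsoLimits

variable {ι : Type*} {l : Filter ι} {e : ι → ℝ ≃o ℝ} {e₀ : ℝ ≃o ℝ}

/-- Monotonicity upgrades pointwise convergence to convergence along moving points. -/
lemma tendsto_orderIso_apply (h : ∀ z, Tendsto (fun s => e s z) l (𝓝 (e₀ z))) {x : ι → ℝ} {x₀ : ℝ}
    (hx : Tendsto x l (𝓝 x₀)) : Tendsto (fun s => e s (x s)) l (𝓝 (e₀ x₀)) := by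
  refine tendsto_order.2 ⟨fun a ha => ?_, fun a ha => ?_⟩
  · have h1 : e₀.symm ((a + e₀ x₀) / 2) < x₀ := by
      rw [OrderIso.symm_apply_lt]; linarith
    have h2 := h (e₀.symm ((a + e₀ x₀) / 2))
    rw [OrderIso.apply_symm_apply] at h2
    filter_upwards [hx.eventually (lt_mem_nhds h1),
      h2.eventually (lt_mem_nhds (show a < (a + e₀ x₀) / 2 by linarith))] with s h3 h4
    exact h4.trans ((e s).strictMono h3)
  · have h1 : x₀ < e₀.symm ((a + e₀ x₀) / 2) := by
      rw [OrderIso.lt_symm_apply]; linarith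
    have h2 := h (e₀.symm ((a + e₀ x₀) / 2))
    rw [OrderIso.apply_symm_apply] at h2
    filter_upwards [hx.eventually (gt_mem_nhds h1),
      h2.eventually (gt_mem_nhds (show (a + e₀ x₀) / 2 < a by linarith))] with s h3 h4
    exact ((e s).strictMono h3).trans h4

lemma tendsto_orderIso_symm (h : ∀ z, Tendsto (fun s => e s z) l (𝓝 (e₀ z))) (z : ℝ) :
    Tendsto (fun s => (e s).symm z) l (𝓝 (e₀.symm z)) := by
  refine tendsto_order.2 ⟨fun a ha => ?_, fun a ha => ?_⟩
  · rw [OrderIso.lt_symm_apply] at ha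
    filter_upwards [(h a).eventually (gt_mem_nhds ha)] with s hs
    rwa [OrderIso.lt_symm_apply]
  · replace ha : e₀.symm z < a := ha
    rw [OrderIso.symm_apply_lt] at ha
    filter_upwards [(h a).eventually (lt_mem_nhds ha)] with s hs
    rwa [OrderIso.symm_apply_lt]

end OrderIsoLimits

/-! ### Stability of the towers under small perturbations. -/

namespace GIET

variable {d : ℕ} {σ : Equiv.Perm (Fin d)} {T : GIET σ}

lemma cDist_nonneg (k : ℕ) (S T : GIET σ) : 0 ≤ cDist k S T :=
  add_nonneg (add_nonneg (Finset.sum_nonneg fun _ _ => abs_nonneg _)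
    (Finset.sum_nonneg fun _ _ => abs_nonneg _))
    (Finset.sum_nonneg fun _ _ => IntervalDiffeo.cDist_nonneg _ _ _)

lemma cDist_self (k : ℕ) (T : GIET σ) : cDist k T T = 0 := by
  simp [cDist, IntervalDiffeo.cDist_self]

lemma abs_top_sub_le (k : ℕ) (S T : GIET σ) (i : Fin d) : |S.top i - T.top i| ≤ cDist k S T := by
  have h1 := Finset.single_le_sum (f := fun i => |S.top i - T.top i|)
    (fun _ _ => abs_nonneg _) (Finset.mem_univ i)
  have h2 : 0 ≤ ∑ j, |S.bot j - T.bot j| := Finset.sum_nonneg fun _ _ => abs_nonneg _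
  have h3 : 0 ≤ ∑ i, (S.φ i).cDist k (T.φ i) :=
    Finset.sum_nonneg fun _ _ => IntervalDiffeo.cDist_nonneg _ _ _
  simp only [cDist]
  linarith

lemma abs_bot_sub_le (k : ℕ) (S T : GIET σ) (i : Fin d) : |S.bot i - T.bot i| ≤ cDist k S T := by
  have h1 := Finset.single_le_sum (f := fun i => |S.bot i - T.bot i|)
    (fun _ _ => abs_nonneg _) (Finset.mem_univ i)
  have h2 : 0 ≤ ∑ j, |S.top j - T.top j| := Finset.sum_nonneg fun _ _ => abs_nonneg _
  have h3 : 0 ≤ ∑ i, (S.φ i).cDist k (T.φ i) :=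
    Finset.sum_nonneg fun _ _ => IntervalDiffeo.cDist_nonneg _ _ _
  simp only [cDist]
  linarith

lemma cDist_φ_le (k : ℕ) (S T : GIET σ) (i : Fin d) : (S.φ i).cDist k (T.φ i) ≤ cDist k S T := by
  have h1 := Finset.single_le_sum (f := fun i => (S.φ i).cDist k (T.φ i))
    (fun _ _ => IntervalDiffeo.cDist_nonneg _ _ _) (Finset.mem_univ i)
  have h2 : 0 ≤ ∑ j, |S.top j - T.top j| := Finset.sum_nonneg fun _ _ => abs_nonneg _
  have h3 : 0 ≤ ∑ j, |S.bot j - T.bot j| := Finset.sum_nonneg fun _ _ => abs_nonneg _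
  simp only [cDist]
  linarith

/-- The filter of `C³`-neighbourhoods of `T`. -/
def near (T : GIET σ) : Filter (GIET σ) := comap (fun S => cDist 3 S T) (𝓝 0)

lemma tendsto_cDist_near (T : GIET σ) : Tendsto (fun S => cDist 3 S T) T.near (𝓝 0) :=
  tendsto_comap

lemma eventually_near_iff {P : GIET σ → Prop} :
    (∀ᶠ S in T.near, P S) ↔ ∃ ε > 0, ∀ S, cDist 3 S T < ε → P S := by
  rw [near, eventually_comap, Metric.eventually_nhds_iff]
  constructor
  · rintro ⟨ε, hε, h⟩
    refine ⟨ε, hε, fun S hS => h (y := cDist 3 S T) ?_ S rfl⟩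
    rw [Real.dist_0_eq_abs, abs_of_nonneg (cDist_nonneg _ _ _)]
    exact hS
  · rintro ⟨ε, hε, h⟩
    refine ⟨ε, hε, fun y hy S hS => h S ?_⟩
    rw [Real.dist_0_eq_abs, ← hS, abs_of_nonneg (cDist_nonneg _ _ _)] at hy
    exact hy

lemma tendsto_top (T : GIET σ) (i : Fin d) : Tendsto (fun S => S.top i) T.near (𝓝 (T.top i)) :=
  tendsto_iff_dist_tendsto_zero.2 (squeeze_zero (fun _ => dist_nonneg)
    (fun S => abs_top_sub_le 3 S T i) T.tendsto_cDist_near)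

lemma tendsto_bot (T : GIET σ) (i : Fin d) : Tendsto (fun S => S.bot i) T.near (𝓝 (T.bot i)) :=
  tendsto_iff_dist_tendsto_zero.2 (squeeze_zero (fun _ => dist_nonneg)
    (fun S => abs_bot_sub_le 3 S T i) T.tendsto_cDist_near)

lemma tendsto_topCut (T : GIET σ) (k : ℕ) :
    Tendsto (fun S => S.topCut k) T.near (𝓝 (T.topCut k)) := by
  simp only [topCut, partialSum]
  exact tendsto_finsetSum _ fun i _ => T.tendsto_top i

lemma tendsto_botCut (T : GIET σ) (k : ℕ) :
    Tendsto (fun S => S.botCut k) T.near (𝓝 (T.botCut k)) := by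
  simp only [botCut, partialSum]
  exact tendsto_finsetSum _ fun i _ => T.tendsto_bot i

lemma tendsto_φ (T : GIET σ) (i : Fin d) (z : ℝ) :
    Tendsto (fun S => (S.φ i).iso z) T.near (𝓝 ((T.φ i).iso z)) := by
  by_cases hz : z ∈ Icc (0 : ℝ) 1
  · refine tendsto_iff_dist_tendsto_zero.2 (squeeze_zero (fun _ => dist_nonneg)
      (fun S => ?_) T.tendsto_cDist_near)
    have := IntervalDiffeo.abs_sub_le_cDist (S.φ i) (T.φ i) (k := 3) le_rfl (Nat.zero_le 3) hz
    simp only [iteratedDerivWithin_zero] at this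
    exact this.trans (cDist_φ_le 3 S T i)
  · simp only [IntervalDiffeo.iso_apply, IntervalDiffeo.eq_self _ _ hz]
    exact tendsto_const_nhds

lemma tendsto_branch (T : GIET σ) (i : Fin d) (z : ℝ) :
    Tendsto (fun S => S.branch i z) T.near (𝓝 (T.branch i z)) := by
  simp only [branch_apply]
  refine (T.tendsto_botCut _).add ((T.tendsto_bot _).mul ?_)
  exact tendsto_orderIso_apply (T.tendsto_φ i)
    ((tendsto_const_nhds.sub (T.tendsto_topCut i)).div (T.tendsto_top i) (T.top_pos i).ne')

lemma tendsto_word (T : GIET σ) (w : ℕ → Fin d) (n : ℕ) (z : ℝ) :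
    Tendsto (fun S => S.word w n z) T.near (𝓝 (T.word w n z)) := by
  induction n with
  | zero => exact tendsto_const_nhds
  | succ n ih => exact tendsto_orderIso_apply (T.tendsto_branch (w n)) ih

/-- The left endpoint of the base of the `i`-th tower: the point whose orbit reaches the
discontinuity `κ i` after `τ i` steps along the itinerary `w i`. -/
def leftPoint (T : GIET σ) (w : Fin d → ℕ → Fin d) (κ : Fin d → Fin d) (τ : Fin d → ℕ)
    (i : Fin d) : ℝ :=
  if (i : ℕ) = 0 then 0 else (T.word (w i) (τ i)).symm (T.topCut (κ i))

/-- The right endpoint of the base. -/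
def baseLength (T : GIET σ) (w : Fin d → ℕ → Fin d) (κ : Fin d → Fin d) (τ : Fin d → ℕ)
    (i₁ : Fin d) (m₁ : ℕ) : ℝ :=
  T.word (w i₁) m₁ (T.leftPoint w κ τ i₁)

/-- The partition of the base. -/
def basePoint (T : GIET σ) (w : Fin d → ℕ → Fin d) (κ : Fin d → Fin d) (τ : Fin d → ℕ)
    (i₁ : Fin d) (m₁ : ℕ) (k : ℕ) : ℝ :=
  if h : k < d then T.leftPoint w κ τ ⟨k, h⟩ else T.baseLength w κ τ i₁ m₁

variable {w : Fin d → ℕ → Fin d} {κ : Fin d → Fin d} {τ : Fin d → ℕ} {i₁ : Fin d} {m₁ : ℕ}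
  {N : Fin d → ℕ} {p : ℕ → ℝ}

lemma basePoint_fin (i : Fin d) : T.basePoint w κ τ i₁ m₁ i = T.leftPoint w κ τ i := by
  simp [basePoint]

lemma basePoint_last : T.basePoint w κ τ i₁ m₁ d = T.baseLength w κ τ i₁ m₁ := by
  simp [basePoint]

lemma tendsto_leftPoint (T : GIET σ) (i : Fin d) :
    Tendsto (fun S => S.leftPoint w κ τ i) T.near (𝓝 (T.leftPoint w κ τ i)) := by
  by_cases hi : (i : ℕ) = 0
  · simp only [leftPoint, if_pos hi]
    exact tendsto_const_nhds
  · simp only [leftPoint, if_neg hi]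
    exact tendsto_orderIso_apply (tendsto_orderIso_symm (T.tendsto_word (w i) (τ i)))
      (T.tendsto_topCut _)

lemma tendsto_baseLength (T : GIET σ) :
    Tendsto (fun S => S.baseLength w κ τ i₁ m₁) T.near (𝓝 (T.baseLength w κ τ i₁ m₁)) :=
  tendsto_orderIso_apply (T.tendsto_word _ _) (T.tendsto_leftPoint i₁)

lemma tendsto_basePoint (T : GIET σ) (k : ℕ) :
    Tendsto (fun S => S.basePoint w κ τ i₁ m₁ k) T.near (𝓝 (T.basePoint w κ τ i₁ m₁ k)) := by
  by_cases h : k < d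
  · simp only [basePoint, dif_pos h]
    exact T.tendsto_leftPoint _
  · simp only [basePoint, dif_neg h]
    exact T.tendsto_baseLength

lemma tendsto_word_basePoint (T : GIET σ) (w' : ℕ → Fin d) (n k : ℕ) :
    Tendsto (fun S => S.word w' n (S.basePoint w κ τ i₁ m₁ k)) T.near
      (𝓝 (T.word w' n (T.basePoint w κ τ i₁ m₁ k))) :=
  tendsto_orderIso_apply (T.tendsto_word _ _) (T.tendsto_basePoint k)

lemma TowerFrame.leftPoint_eq (h : TowerFrame T N w κ τ p) (i : Fin d) :
    T.leftPoint w κ τ i = p i := by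
  by_cases hi : (i : ℕ) = 0
  · rw [leftPoint, if_pos hi, hi, h.zero]
  · rw [leftPoint, if_neg hi, ← h.cut i (Nat.pos_of_ne_zero hi), OrderIso.symm_apply_apply]

lemma TowerFrame.basePoint_eq (h : TowerFrame T N w κ τ p)
    (hX : T.word (w i₁) m₁ (p i₁) = p d) {k : ℕ} (hk : k ≤ d) :
    T.basePoint w κ τ i₁ m₁ k = p k := by
  rcases hk.lt_or_eq with hk | rfl
  · exact (basePoint_fin (⟨k, hk⟩ : Fin d)).trans (h.leftPoint_eq _)
  · rw [basePoint_last, baseLength, h.leftPoint_eq, hX]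

lemma notMem_topCuts_of_mem_Ioo {j : Fin d} {x : ℝ}
    (hx : x ∈ Ioo (T.topCut j) (T.topCut (j + 1))) : x ∉ T.topCuts := by
  rintro ⟨k, -, rfl⟩
  have := T.top_index_eq (Ioo_subset_Ico_self hx) (T.topCut_mem_top k)
  subst this
  exact lt_irrefl _ hx.1

/-- Apart from the floors forced to begin at a cut, the position is strict on both sides and
therefore survives perturbation. -/
lemma TowerFrame.left_mem_Ioo (h : TowerFrame T N w κ τ p) {i : Fin d} {s : ℕ} (hs : s < N i)
    (hne : 0 < (i : ℕ) → s ≠ τ i) (h0 : ¬ ((i : ℕ) = 0 ∧ s = 0)) :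
    T.word (w i) s (p i) ∈ Ioo (T.topCut (w i s)) (T.topCut (w i s + 1)) := by
  have h1 := h.left_mem i s hs
  refine ⟨lt_of_le_of_ne h1.1 fun he : T.topCut (w i s) = T.word (w i) s (p i) => ?_, h1.2⟩
  rcases Nat.eq_zero_or_pos (w i s : ℕ) with hw | hw
  · rw [hw, topCut_zero] at he
    have hd : 0 < d := i.pos
    have hpd : 0 < p d := by simpa [h.zero] using h.lt hd le_rfl
    rcases Nat.eq_zero_or_pos s with rfl | hs0
    · have hi : 0 < (i : ℕ) := Nat.pos_of_ne_zero fun hi => h0 ⟨hi, rfl⟩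
      have : 0 < p i := by simpa [h.zero] using h.lt hi i.2.le
      rw [word_zero] at he
      linarith
    · have := h.base_le i s hs hs0
      linarith
  · exact h.notMem i s hs hne ⟨_, hw, he.symm⟩

/-- A nearby interval exchange has the same tower combinatorics (left endpoints). -/
theorem Towers.eventually_frame (h : Towers T N w κ τ p) (hm₁ : m₁ < N i₁)
    (hX : T.word (w i₁) m₁ (p i₁) = p d) :
    ∀ᶠ S in T.near, TowerFrame S N w κ τ (S.basePoint w κ τ i₁ m₁) := by
  have hd : 0 < d := i₁.pos
  have hp : ∀ {k : ℕ}, k ≤ d → T.basePoint w κ τ i₁ m₁ k = p k := fun hk =>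
    h.toTowerFrame.basePoint_eq hX hk
  have htp : ∀ {k : ℕ}, k ≤ d →
      Tendsto (fun S => S.basePoint w κ τ i₁ m₁ k) T.near (𝓝 (p k)) := fun hk => by
    rw [← hp hk]
    exact T.tendsto_basePoint _
  have htw : ∀ (i : Fin d) (s : ℕ),
      Tendsto (fun S => S.word (w i) s (S.basePoint w κ τ i₁ m₁ i)) T.near
        (𝓝 (T.word (w i) s (p i))) := fun i s => by
    rw [← hp i.2.le]
    exact T.tendsto_word_basePoint _ _ _
  have hzero : ∀ S : GIET σ, S.basePoint w κ τ i₁ m₁ 0 = 0 := fun S => by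
    simp [basePoint, hd, leftPoint]
  have hcut : ∀ S : GIET σ, ∀ i : Fin d, 0 < (i : ℕ) →
      S.word (w i) (τ i) (S.basePoint w κ τ i₁ m₁ i) = S.topCut (κ i) := fun S i hi => by
    rw [basePoint_fin, leftPoint, if_neg hi.ne', OrderIso.apply_symm_apply]
  have hwκ : ∀ i : Fin d, 0 < (i : ℕ) → w i (τ i) = κ i := fun i hi => by
    have h1 := h.left_mem i (τ i) (h.τ_lt i hi)
    rw [h.cut i hi] at h1
    exact T.top_index_eq h1 (T.topCut_mem_top _)
  have e1 : ∀ᶠ S in T.near, ∀ i : Fin d,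
      S.basePoint w κ τ i₁ m₁ i < S.basePoint w κ τ i₁ m₁ (i + 1) :=
    eventually_all.2 fun i => (htp i.2.le).eventually_lt (htp i.2) (h.lt_succ i)
  have e2 : ∀ᶠ S in T.near, S.basePoint w κ τ i₁ m₁ d < 1 :=
    (htp le_rfl).eventually (gt_mem_nhds h.lt_one)
  have e3 : ∀ᶠ S in T.near, ∀ i : Fin d, ∀ s ∈ Iio (N i), (0 < (i : ℕ) → s ≠ τ i) →
      ¬ ((i : ℕ) = 0 ∧ s = 0) →
      S.word (w i) s (S.basePoint w κ τ i₁ m₁ i) ∈ Ioo (S.topCut (w i s)) (S.topCut (w i s + 1)) := by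
    refine eventually_all.2 fun i => (eventually_all_finite (finite_Iio _)).2 fun s hs => ?_
    by_cases hne : (0 < (i : ℕ) → s ≠ τ i) ∧ ¬ ((i : ℕ) = 0 ∧ s = 0)
    · have h1 := h.left_mem_Ioo hs hne.1 hne.2
      filter_upwards [(T.tendsto_topCut _).eventually_lt (htw i s) h1.1,
        (htw i s).eventually_lt (T.tendsto_topCut _) h1.2] with S h2 h3 _ _ using ⟨h2, h3⟩
    · exact Eventually.of_forall fun _ h1 h2 => absurd ⟨h1, h2⟩ hne
  have e4 : ∀ᶠ S in T.near, ∀ i : Fin d, ∀ s ∈ Iio (N i), 0 < s →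
      S.basePoint w κ τ i₁ m₁ d ≤ S.word (w i) s (S.basePoint w κ τ i₁ m₁ i) := by
    refine eventually_all.2 fun i => (eventually_all_finite (finite_Iio _)).2 fun s hs => ?_
    by_cases hs0 : 0 < s
    -- Equality can occur only for the floor `(i₁, m₁)`, because floors are disjoint; there it
    -- persists by the definition of the base length.
    · rcases (h.base_le i s hs hs0).eq_or_lt with he | hlt
      · rw [← hX] at he
        obtain ⟨rfl, rfl⟩ := h.floor_index_eq (h.left_mem_base i₁) (h.left_mem_base i) hm₁ hs he
        refine Eventually.of_forall fun S _ => ?_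
        rw [basePoint_last, baseLength, basePoint_fin]
      · filter_upwards [(htp le_rfl).eventually_lt (htw i s) hlt] with S h1 _ using h1.le
    · exact Eventually.of_forall fun _ h1 => absurd h1 hs0
  filter_upwards [e1, e2, e3, e4] with S h1 h2 h3 h4
  refine ⟨hzero S, h1, h2, h.N_pos, fun i s hs => ?_, hcut S, h.τ_lt, h.κ_pos, h.κ_surj,
    fun i s hs hne => ?_, fun i s hs hs0 => h4 i s hs hs0⟩
  · by_cases hi : 0 < (i : ℕ) ∧ s = τ i
    · obtain ⟨hi, rfl⟩ := hi
      rw [hcut S i hi, hwκ i hi]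
      exact S.topCut_mem_top _
    · by_cases h0 : (i : ℕ) = 0 ∧ s = 0
      · obtain ⟨h0, rfl⟩ := h0
        have h5 := h.left_mem i 0 hs
        rw [word_zero, h0, h.zero] at h5
        have h6 : (w i 0 : ℕ) = 0 := by
          by_contra h7
          have := T.topCut_pos (Nat.pos_of_ne_zero h7) hd
          linarith [h5.1]
        rw [word_zero, h0, hzero]
        have h7 := S.topCut_mem_top (w i 0)
        rw [h6, topCut_zero] at h7
        rwa [h6, topCut_zero]
      · exact Ioo_subset_Ico_self (h3 i s hs (fun h5 h6 => hi ⟨h5, h6⟩) h0)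
  · by_cases h0 : (i : ℕ) = 0 ∧ s = 0
    · obtain ⟨h0, rfl⟩ := h0
      rw [word_zero, h0, hzero]
      rintro ⟨k, hk, he⟩
      have := S.topCut_pos hk hd
      linarith
    · exact notMem_topCuts_of_mem_Ioo (h3 i s hs hne h0)

/-- A discontinuity which is the orbit of a left endpoint does not cut any floor. -/
lemma TowerFrame.no_cut (h : TowerFrame T N w κ τ p) {i j : Fin d} {s t : ℕ} {y : ℝ}
    (hs : s ≤ N i) (ht : t < N j) (hst : s < N i ∨ 0 < t) (hy : y ∈ Ico (p i) (p (i + 1)))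
    (hmem : ∀ z ∈ Ico (p i) (p (i + 1)), ∀ r < s,
      T.word (w i) r z ∈ Ico (T.topCut (w i r)) (T.topCut (w i r + 1)))
    (h1 : T.word (w i) s (p i) < T.word (w j) t (p j)) :
    T.word (w i) s y < T.word (w j) t (p j) := by
  by_contra! h2
  set q := T.word (w j) t (p j) with hq
  set z := (T.word (w i) s).symm q with hz
  have hzq : T.word (w i) s z = q := OrderIso.apply_symm_apply _ _
  have hz1 : p i < z := by rwa [hz, OrderIso.lt_symm_apply]
  have hz2 : z ≤ y := by rwa [hz, OrderIso.symm_apply_le]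
  have hzJ : z ∈ Ico (p i) (p (i + 1)) := ⟨hz1.le, hz2.trans_lt hy.2⟩
  have hzs : ∀ r ≤ s, T.map^[r] z = T.word (w i) r z :=
    T.iterate_eq_word (hmem z hzJ)
  have hpt : ∀ r ≤ N j, T.map^[r] (p j) = T.word (w j) r (p j) :=
    T.iterate_eq_word (h.left_mem j)
  have hpj := h.left_mem_base j
  -- A base point `z` strictly after `p i` and the left endpoint `p j` have orbits that meet. For `s
  -- = t` they coincide; otherwise one lies on the orbit of the other before its return, the
  -- hypothesis `hst` ensuring `s - t < N i`.
  have he : T.map^[s] z = T.map^[t] (p j) := by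
    rw [hzs s le_rfl, hzq, hpt t ht.le]
  rcases lt_trichotomy s t with hlt | heq | hlt
  · have h3 := T.iterate_cancel (h.mem_unit hzJ) (h.mem_unit hpj) hlt.le he
    rw [hpt _ (by omega)] at h3
    have := h.base_le j (t - s) (by omega) (by omega)
    linarith [(h.mem_base hzJ).2]
  · subst heq
    have h3 := T.iterate_injOn s (h.mem_unit hzJ) (h.mem_unit hpj) he
    have h4 := h.base_index_eq (j := j) hzJ (by rw [h3]; exact hpj)
    subst h4
    linarith
  · have h3 := T.iterate_cancel (h.mem_unit hpj) (h.mem_unit hzJ) hlt.le he.symm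
    rw [hzs _ (by omega)] at h3
    have h4 := h.base_le i (s - t) (by omega) (by omega)
    have h5 := (T.word (w i) (s - t)).monotone hzJ.1
    linarith [(h.mem_base hpj).2]

/-- Towers are determined by their left endpoints. -/
theorem TowerFrame.towers (h : TowerFrame T N w κ τ p) (hm₀ : 0 < m₁) (hm₁ : m₁ < N i₁)
    (hX : T.word (w i₁) m₁ (p i₁) = p d) (hret : ∀ i : Fin d, T.word (w i) (N i) (p i) < p d) :
    Towers T N w κ τ p := by
  have hmem : ∀ i : Fin d, ∀ s < N i, ∀ y ∈ Ico (p i) (p (i + 1)),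
      T.word (w i) s y ∈ Ico (T.topCut (w i s)) (T.topCut (w i s + 1)) := by
    intro i s
    induction s using Nat.strong_induction_on with
    | _ s ih =>
      intro hs y hy
      have hmem : ∀ z ∈ Ico (p i) (p (i + 1)), ∀ r < s,
          T.word (w i) r z ∈ Ico (T.topCut (w i r)) (T.topCut (w i r + 1)) :=
        fun z hz r hr => ih r hr (by omega) z hz
      have h1 := h.left_mem i s hs
      refine ⟨h1.1.trans ((T.word (w i) s).monotone hy.1), ?_⟩
      by_cases hlast : (w i s : ℕ) + 1 < d
      -- The right end of the exchanged interval is an orbit point of a left endpoint, so it cannot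
      -- fall inside the floor.
      · obtain ⟨j, hj, hjk⟩ := h.κ_surj ⟨w i s + 1, hlast⟩ (Nat.succ_pos _)
        have h2 := h.cut j hj
        rw [hjk] at h2
        simp only at h2
        rw [← h2] at h1 ⊢
        exact h.no_cut hs.le (h.τ_lt j hj) (Or.inl hs) hy hmem h1.2
      · rw [show (w i s : ℕ) + 1 = d by omega, topCut_last,
          ← T.iterate_eq_word (hmem y hy) s le_rfl]
        exact (T.iterate_mem (h.mem_unit hy) s).2
  refine ⟨h, fun i y hy s hs => hmem i s hs y hy, fun i y hy => ?_⟩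
  rw [← hX]
  exact h.no_cut le_rfl hm₁ (Or.inr hm₀) hy (fun z hz r hr => hmem i r hr z hz)
    (by rw [hX]; exact hret i)

/-- Nearby interval exchanges have the same towers. -/
theorem Towers.eventually_towers (h : Towers T N w κ τ p) (hm₀ : 0 < m₁) (hm₁ : m₁ < N i₁)
    (hX : T.word (w i₁) m₁ (p i₁) = p d) :
    ∀ᶠ S in T.near, Towers S N w κ τ (S.basePoint w κ τ i₁ m₁) := by
  have hp : ∀ {k : ℕ}, k ≤ d → T.basePoint w κ τ i₁ m₁ k = p k := fun hk =>
    h.toTowerFrame.basePoint_eq hX hk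
  have e1 : ∀ᶠ S in T.near, ∀ i : Fin d,
      S.word (w i) (N i) (S.basePoint w κ τ i₁ m₁ i) < S.basePoint w κ τ i₁ m₁ d := by
    refine eventually_all.2 fun i =>
      (T.tendsto_word_basePoint (w i) (N i) i).eventually_lt (T.tendsto_basePoint d) ?_
    rw [hp i.2.le, hp le_rfl]
    exact h.ret i _ (h.left_mem_base i)
  filter_upwards [h.eventually_frame hm₁ hX, e1] with S h1 h2
  refine h1.towers hm₀ hm₁ ?_ h2
  rw [basePoint_fin, basePoint_last, baseLength]

/-- The order in which the towers return to the base is stable. -/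
theorem Towers.eventually_order (h : Towers T N w κ τ p)
    (hX : T.word (w i₁) m₁ (p i₁) = p d)
    (hord : ∀ i j : Fin d, σ i < σ j → T.word (w i) (N i) (p i) < T.word (w j) (N j) (p j)) :
    ∀ᶠ S in T.near, ∀ i j : Fin d, σ i < σ j →
      S.word (w i) (N i) (S.basePoint w κ τ i₁ m₁ i) <
        S.word (w j) (N j) (S.basePoint w κ τ i₁ m₁ j) := by
  have hp : ∀ {k : ℕ}, k ≤ d → T.basePoint w κ τ i₁ m₁ k = p k := fun hk =>
    h.toTowerFrame.basePoint_eq hX hk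
  refine eventually_all.2 fun i => eventually_all.2 fun j => ?_
  by_cases hij : σ i < σ j
  · have h1 := hord i j hij
    rw [← hp i.2.le, ← hp j.2.le] at h1
    filter_upwards [(T.tendsto_word_basePoint (w i) (N i) i).eventually_lt
      (T.tendsto_word_basePoint (w j) (N j) j) h1] with S h2 _ using h2
  · exact Eventually.of_forall fun _ h1 => absurd h1 hij

end GIET

/-! ### Logarithmic derivative, non-linearity and Schwarzian derivative. -/

/-- `ψ` is the logarithm of the derivative of `f` on `s`, `η` its non-linearity and `S` its
Schwarzian derivative. -/
structure LogJet (f ψ η S : ℝ → ℝ) (s : Set ℝ) : Prop where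
  d1 : ∀ x ∈ s, HasDerivWithinAt f (Real.exp (ψ x)) s x
  d2 : ∀ x ∈ s, HasDerivWithinAt ψ (η x) s x
  d3 : ∀ x ∈ s, HasDerivWithinAt η (S x + η x ^ 2 / 2) s x

namespace LogJet

variable {f ψ η S f' ψ' η' S' : ℝ → ℝ} {s t : Set ℝ}

lemma affine {a : ℝ} (ha : 0 < a) (b : ℝ) (s : Set ℝ) :
    LogJet (fun x => a * x + b) (fun _ => Real.log a) (fun _ => 0) (fun _ => 0) s := by
  refine ⟨fun x _ => ?_, fun x _ => hasDerivWithinAt_const _ _ _, fun x _ => ?_⟩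
  · rw [Real.exp_log ha]
    simpa using (((hasDerivAt_id x).const_mul a).add_const b).hasDerivWithinAt
  · simpa using hasDerivWithinAt_const x s (0 : ℝ)

/-- Chain rules of the three cocycles. The quadratic term in `d3` is what removes the cross terms
from the rule for the Schwarzian. -/
lemma comp (hf : LogJet f ψ η S t) (hg : LogJet f' ψ' η' S' s) (h : MapsTo f' s t) :
    LogJet (fun x => f (f' x)) (fun x => ψ (f' x) + ψ' x)
      (fun x => η (f' x) * Real.exp (ψ' x) + η' x)
      (fun x => S (f' x) * Real.exp (ψ' x) ^ 2 + S' x) s := by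
  refine ⟨fun x hx => ?_, fun x hx => ?_, fun x hx => ?_⟩
  · rw [Real.exp_add]
    exact (hf.d1 _ (h hx)).comp x (hg.d1 x hx) h
  · exact ((hf.d2 _ (h hx)).comp x (hg.d1 x hx) h).add (hg.d2 x hx)
  · have h1 := (((hf.d3 _ (h hx)).comp x (hg.d1 x hx) h).mul (hg.d2 x hx).exp).add (hg.d3 x hx)
    refine h1.congr_deriv ?_
    simp only [Function.comp_apply]
    ring

lemma congr (hf : LogJet f ψ η S s) (h : ∀ x ∈ s, f' x = f x) (hψ : ∀ x ∈ s, ψ' x = ψ x)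
    (hη : ∀ x ∈ s, η' x = η x) (hS : ∀ x ∈ s, S' x = S x) : LogJet f' ψ' η' S' s := by
  refine ⟨fun x hx => ?_, fun x hx => ?_, fun x hx => ?_⟩
  · rw [hψ x hx]
    exact (hf.d1 x hx).congr h (h x hx)
  · rw [hη x hx]
    exact (hf.d2 x hx).congr hψ (hψ x hx)
  · rw [hS x hx, hη x hx]
    exact (hf.d3 x hx).congr hη (hη x hx)

/-- The jet of a function on an interval is determined by the function. -/
lemma unique {a b : ℝ} (hab : a < b) (hf : LogJet f ψ η S (Icc a b))
    (hg : LogJet f ψ' η' S' (Icc a b)) {x : ℝ} (hx : x ∈ Icc a b) :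
    ψ x = ψ' x ∧ η x = η' x ∧ S x = S' x := by
  have hu := uniqueDiffOn_Icc hab
  have h1 : ∀ x ∈ Icc a b, ψ x = ψ' x := fun x hx =>
    Real.exp_injective ((hu x hx).eq_deriv _ (hf.d1 x hx) (hg.d1 x hx))
  have h2 : ∀ x ∈ Icc a b, η x = η' x := fun x hx =>
    (hu x hx).eq_deriv _ (hf.d2 x hx) ((hg.d2 x hx).congr h1 (h1 x hx))
  refine ⟨h1 x hx, h2 x hx, ?_⟩
  have h3 := (hu x hx).eq_deriv _ (hf.d3 x hx) ((hg.d3 x hx).congr h2 (h2 x hx))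
  rw [h2 x hx] at h3
  linarith

/-- The mean slope of `f` lies between the bounds for its derivative. -/
lemma slope_bounds {a b m M : ℝ} (hf : LogJet f ψ η S (Icc a b))
    (hm : ∀ x ∈ Icc a b, m ≤ ψ x) (hM : ∀ x ∈ Icc a b, ψ x ≤ M) {x y : ℝ} (hx : x ∈ Icc a b)
    (hy : y ∈ Icc a b) (hxy : x ≤ y) :
    Real.exp m * (y - x) ≤ f y - f x ∧ f y - f x ≤ Real.exp M * (y - x) := by
  have hc : ContinuousOn f (Icc a b) := fun z hz => (hf.d1 z hz).continuousWithinAt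
  have hdiff : ∀ z ∈ interior (Icc a b), HasDerivAt f (Real.exp (ψ z)) z := fun z hz => by
    rw [interior_Icc] at hz
    exact (hf.d1 z (Ioo_subset_Icc_self hz)).hasDerivAt (Icc_mem_nhds hz.1 hz.2)
  constructor
  · refine (convex_Icc a b).mul_sub_le_image_sub_of_le_deriv hc
      (fun z hz => (hdiff z hz).differentiableAt.differentiableWithinAt) (fun z hz => ?_) x hx y hy
      hxy
    rw [(hdiff z hz).deriv]
    exact Real.exp_le_exp.2 (hm z (interior_subset hz))
  · refine (convex_Icc a b).image_sub_le_mul_sub_of_deriv_le hc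
      (fun z hz => (hdiff z hz).differentiableAt.differentiableWithinAt) (fun z hz => ?_) x hx y hy
      hxy
    rw [(hdiff z hz).deriv]
    exact Real.exp_le_exp.2 (hM z (interior_subset hz))

end LogJet

namespace IntervalDiffeo

/-- The `k`-th derivative of `f` on `[0,1]`. -/
def der (f : IntervalDiffeo) (k : ℕ) : ℝ → ℝ := iteratedDerivWithin k f.toFun (Icc 0 1)

/-- The logarithm of the derivative. -/
def logDer (f : IntervalDiffeo) (x : ℝ) : ℝ := Real.log (f.der 1 x)

/-- The non-linearity. -/
def nonlin (f : IntervalDiffeo) (x : ℝ) : ℝ := f.der 2 x / f.der 1 x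

/-- The Schwarzian derivative. -/
def schwarzian (f : IntervalDiffeo) (x : ℝ) : ℝ :=
  f.der 3 x / f.der 1 x - 3 / 2 * (f.der 2 x / f.der 1 x) ^ 2

variable (f : IntervalDiffeo)

lemma der_zero : f.der 0 = f.toFun := by simp [der]

lemma der_one {x : ℝ} : f.der 1 x = derivWithin f.toFun (Icc 0 1) x := by
  rw [der, iteratedDerivWithin_one]

lemma hasDerivWithinAt_der {k : ℕ} (hk : k < 3) {x : ℝ} (hx : x ∈ Icc (0 : ℝ) 1) :
    HasDerivWithinAt (f.der k) (f.der (k + 1) x) (Icc 0 1) x := by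
  have hu := uniqueDiffOn_Icc (zero_lt_one' ℝ)
  have h1 := f.contDiffOn.differentiableOn_iteratedDerivWithin (m := k) (by exact_mod_cast hk) hu
  rw [der, der, iteratedDerivWithin_succ]
  exact (h1 x hx).hasDerivWithinAt

lemma der_one_pos {x : ℝ} (hx : x ∈ Icc (0 : ℝ) 1) : 0 < f.der 1 x := by
  rw [der_one]
  exact f.deriv_pos x hx

lemma logJet : LogJet f.toFun f.logDer f.nonlin f.schwarzian (Icc 0 1) := by
  refine ⟨fun x hx => ?_, fun x hx => ?_, fun x hx => ?_⟩
  · rw [logDer, Real.exp_log (f.der_one_pos hx), ← der_zero]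
    exact f.hasDerivWithinAt_der (by norm_num) hx
  · exact (f.hasDerivWithinAt_der (by norm_num) hx).log (f.der_one_pos hx).ne'
  · have h0 := (f.der_one_pos hx).ne'
    have h1 := (f.hasDerivWithinAt_der (k := 2) (by norm_num) hx).div
      (f.hasDerivWithinAt_der (k := 1) (by norm_num) hx) h0
    refine h1.congr_deriv ?_
    simp only [schwarzian, nonlin]
    field_simp
    ring

/-- A diffeomorphism between two intervals, rescaled affinely to `[0,1]`. -/
def rescale {g : ℝ → ℝ} {a b : ℝ} (hab : a < b) (hg : ContDiffOn ℝ 3 g (Icc a b))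
    (hpos : ∀ x ∈ Icc a b, ∃ D, 0 < D ∧ HasDerivWithinAt g D (Icc a b) x) (hgab : g a < g b) :
    IntervalDiffeo where
  toFun x := (Icc (0 : ℝ) 1).piecewise (fun x => (g (a + (b - a) * x) - g a) / (g b - g a)) id x
  contDiffOn := by
    have hm : MapsTo (fun x => a + (b - a) * x) (Icc (0 : ℝ) 1) (Icc a b) := fun x hx =>
      ⟨by nlinarith [hx.1], by nlinarith [hx.2]⟩
    have h1 : ContDiffOn ℝ 3 (fun x => (g (a + (b - a) * x) - g a) / (g b - g a))
        (Icc (0 : ℝ) 1) :=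
      ((hg.comp (by fun_prop) hm).sub contDiffOn_const).div_const _
    exact h1.congr fun x hx => piecewise_eq_of_mem _ _ _ hx
  map_zero := by
    rw [piecewise_eq_of_mem _ _ _ (by simp)]
    simp
  map_one := by
    rw [piecewise_eq_of_mem _ _ _ (by simp)]
    have : g b - g a ≠ 0 := (sub_pos.2 hgab).ne'
    simp [this]
  deriv_pos x hx := by
    have hm : MapsTo (fun x => a + (b - a) * x) (Icc (0 : ℝ) 1) (Icc a b) := fun x hx =>
      ⟨by nlinarith [hx.1], by nlinarith [hx.2]⟩
    obtain ⟨D, hD, hD'⟩ := hpos _ (hm hx)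
    have h1 : HasDerivWithinAt (fun x => a + (b - a) * x) (b - a) (Icc (0 : ℝ) 1) x := by
      simpa using (((hasDerivAt_id x).const_mul (b - a)).const_add a).hasDerivWithinAt
    have h2 := ((hD'.comp x h1 hm).sub_const (g a)).div_const (g b - g a)
    have h3 := h2.congr (f₁ := (Icc (0 : ℝ) 1).piecewise
      (fun x => (g (a + (b - a) * x) - g a) / (g b - g a)) id)
      (fun y hy => piecewise_eq_of_mem _ _ _ hy) (piecewise_eq_of_mem _ _ _ hx)
    rw [h3.derivWithin (uniqueDiffOn_Icc zero_lt_one x hx)]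
    exact div_pos (mul_pos hD (sub_pos.2 hab)) (sub_pos.2 hgab)
  eq_self x hx := piecewise_eq_of_notMem _ _ _ hx

lemma rescale_apply {g : ℝ → ℝ} {a b : ℝ} (hab : a < b) (hg : ContDiffOn ℝ 3 g (Icc a b))
    (hpos : ∀ x ∈ Icc a b, ∃ D, 0 < D ∧ HasDerivWithinAt g D (Icc a b) x) (hgab : g a < g b)
    {x : ℝ} (hx : x ∈ Icc (0 : ℝ) 1) :
    (rescale hab hg hpos hgab).toFun x = (g (a + (b - a) * x) - g a) / (g b - g a) := by
  simp only [rescale]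
  rw [piecewise_eq_of_mem _ _ _ hx]

end IntervalDiffeo

/-! ### Jets of the branches and of their compositions. -/

namespace GIET

variable {d : ℕ} {σ : Equiv.Perm (Fin d)}

/-- Affine coordinate on the `j`-th top interval. -/
def coord (T : GIET σ) (j : Fin d) (y : ℝ) : ℝ := (y - T.topCut j) / T.top j

/-- Logarithm of the slope of the affine map between the `j`-th top interval and its image. -/
def logSlope (T : GIET σ) (j : Fin d) : ℝ := Real.log (T.bot (σ j) / T.top j)

lemma coord_mem (T : GIET σ) {j : Fin d} {y : ℝ}
    (hy : y ∈ Icc (T.topCut j) (T.topCut (j + 1))) : T.coord j y ∈ Icc (0 : ℝ) 1 := by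
  have h := T.top_pos j
  rw [topCut_succ] at hy
  exact ⟨div_nonneg (by linarith [hy.1]) h.le, (div_le_one h).2 (by linarith [hy.2])⟩

lemma branch_logJet (T : GIET σ) (j : Fin d) :
    LogJet (T.branch j) (fun y => (T.φ j).logDer (T.coord j y) + T.logSlope j)
      (fun y => (T.φ j).nonlin (T.coord j y) / T.top j)
      (fun y => (T.φ j).schwarzian (T.coord j y) / T.top j ^ 2)
      (Icc (T.topCut j) (T.topCut (j + 1))) := by
  have ht := T.top_pos j
  have hb := T.bot_pos (σ j)
  have h1 := LogJet.affine (inv_pos.2 ht) (-(T.topCut j / T.top j))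
    (Icc (T.topCut j) (T.topCut (j + 1)))
  have he : ∀ y, (T.top j)⁻¹ * y + -(T.topCut j / T.top j) = T.coord j y := fun y => by
    rw [coord]; ring
  simp only [he] at h1
  have h2 := (T.φ j).logJet.comp h1 fun y hy => T.coord_mem hy
  have h3 := (LogJet.affine hb (T.botCut (σ j)) univ).comp h2 (mapsTo_univ _ _)
  have hl : T.logSlope j = Real.log (T.bot (σ j)) + Real.log (T.top j)⁻¹ := by
    rw [logSlope, Real.log_div hb.ne' ht.ne', Real.log_inv]; ring
  refine h3.congr (fun y _ => ?_) (fun y _ => ?_) (fun y _ => ?_) fun y _ => ?_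
  · rw [branch_apply, coord]; ring
  · rw [hl]; ring
  · rw [Real.exp_log (inv_pos.2 ht)]; ring
  · rw [Real.exp_log (inv_pos.2 ht)]; ring

lemma contDiffOn_branch (T : GIET σ) (j : Fin d) :
    ContDiffOn ℝ 3 (T.branch j) (Icc (T.topCut j) (T.topCut (j + 1))) := by
  have h1 : ContDiffOn ℝ 3 (fun y => T.botCut (σ j) + T.bot (σ j) * (T.φ j).toFun (T.coord j y))
      (Icc (T.topCut j) (T.topCut (j + 1))) := by
    refine contDiffOn_const.add (contDiffOn_const.mul ((T.φ j).contDiffOn.comp ?_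
      fun y hy => T.coord_mem hy))
    unfold coord
    fun_prop
  exact h1.congr fun y _ => by rw [branch_apply, coord]

/-- Logarithm of the derivative of `T.branch j`. -/
def branchLogDer (T : GIET σ) (j : Fin d) (y : ℝ) : ℝ :=
  (T.φ j).logDer (T.coord j y) + T.logSlope j

/-- Logarithm of the derivative of a composition of branches. -/
def wordLogDer (T : GIET σ) (w : ℕ → Fin d) (n : ℕ) (y : ℝ) : ℝ :=
  ∑ s ∈ Finset.range n, T.branchLogDer (w s) (T.word w s y)

/-- The non-linearity of a composition of branches. -/
def wordNonlin (T : GIET σ) (w : ℕ → Fin d) (n : ℕ) (y : ℝ) : ℝ :=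
  ∑ s ∈ Finset.range n, (T.φ (w s)).nonlin (T.coord (w s) (T.word w s y)) / T.top (w s) *
    Real.exp (T.wordLogDer w s y)

/-- The Schwarzian derivative of a composition of branches. -/
def wordSchwarzian (T : GIET σ) (w : ℕ → Fin d) (n : ℕ) (y : ℝ) : ℝ :=
  ∑ s ∈ Finset.range n, (T.φ (w s)).schwarzian (T.coord (w s) (T.word w s y)) / T.top (w s) ^ 2 *
    Real.exp (T.wordLogDer w s y) ^ 2

lemma word_logJet (T : GIET σ) (w : ℕ → Fin d) {n : ℕ} {s : Set ℝ}
    (h : ∀ m < n, ∀ y ∈ s, T.word w m y ∈ Icc (T.topCut (w m)) (T.topCut (w m + 1))) :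
    LogJet (T.word w n) (T.wordLogDer w n) (T.wordNonlin w n) (T.wordSchwarzian w n) s := by
  induction n with
  | zero =>
    refine (LogJet.affine one_pos 0 s).congr (fun y _ => ?_) (fun y _ => ?_) (fun y _ => ?_)
      fun y _ => ?_ <;> simp [wordLogDer, wordNonlin, wordSchwarzian]
  | succ n ih =>
    refine ((T.branch_logJet (w n)).comp (ih fun m hm => h m (by omega))
      (h n (Nat.lt_succ_self n))).congr (fun y _ => rfl) (fun y _ => ?_) (fun y _ => ?_)
      fun y _ => ?_
    · rw [wordLogDer, Finset.sum_range_succ, wordLogDer, branchLogDer]; ring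
    · rw [wordNonlin, Finset.sum_range_succ, wordNonlin]; ring
    · rw [wordSchwarzian, Finset.sum_range_succ, wordSchwarzian]; ring

lemma contDiffOn_word (T : GIET σ) (w : ℕ → Fin d) {n : ℕ} {s : Set ℝ}
    (h : ∀ m < n, ∀ y ∈ s, T.word w m y ∈ Icc (T.topCut (w m)) (T.topCut (w m + 1))) :
    ContDiffOn ℝ 3 (T.word w n) s := by
  induction n with
  | zero => exact contDiffOn_id
  | succ n ih =>
    exact (T.contDiffOn_branch (w n)).comp (ih fun m hm => h m (by omega))
      (h n (Nat.lt_succ_self n))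

end GIET

/-! ### Tilings by floors, and the exchange induced by a system of towers. -/

/-- Telescoping over a partition of `[a,b)` into intervals. -/
lemma sum_tiling {ι : Type*} [DecidableEq ι] (F : Finset ι) (l r : ι → ℝ) {b : ℝ} (h : ℝ → ℝ)
    (hlr : ∀ f ∈ F, l f < r f) (hr : ∀ f ∈ F, r f ≤ b)
    (hdisj : ∀ f ∈ F, ∀ g ∈ F, ∀ x, x ∈ Ico (l f) (r f) → x ∈ Ico (l g) (r g) → f = g) {a : ℝ}
    (hab : a ≤ b) (hl : ∀ f ∈ F, a ≤ l f)
    (hcov : ∀ x ∈ Ico a b, ∃ f ∈ F, x ∈ Ico (l f) (r f)) :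
    ∑ f ∈ F, (h (r f) - h (l f)) = h b - h a := by
  induction F using Finset.strongInduction generalizing a with
  | H F ih =>
    rcases hab.eq_or_lt with rfl | hlt
    · have : F = ∅ := by
        by_contra hne
        obtain ⟨f, hf⟩ := Finset.nonempty_iff_ne_empty.2 hne
        linarith [hlr f hf, hr f hf, hl f hf]
      simp [this]
    -- The tile containing `a` begins at `a`; without it the others tile what lies to its right.
    · obtain ⟨f, hf, hfa⟩ := hcov a ⟨le_rfl, hlt⟩
      have hfa' : l f = a := le_antisymm hfa.1 (hl f hf)
      have h1 := ih (F.erase f) (Finset.erase_ssubset hf)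
        (fun g hg => hlr g (Finset.mem_of_mem_erase hg))
        (fun g hg => hr g (Finset.mem_of_mem_erase hg))
        (fun g hg k hk => hdisj g (Finset.mem_of_mem_erase hg) k (Finset.mem_of_mem_erase hk))
        (a := r f) (hr f hf) (fun g hg => by
          by_contra! hlt
          have hg' := Finset.mem_of_mem_erase hg
          exact Finset.ne_of_mem_erase hg (hdisj g hg' f hf (l g) ⟨le_rfl, hlr g hg'⟩
            ⟨hfa'.le.trans (hl g hg'), hlt⟩))
        (fun x hx => by
          obtain ⟨g, hg, hxg⟩ := hcov x ⟨(hfa.2.trans_le hx.1).le, hx.2⟩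
          refine ⟨g, Finset.mem_erase.2 ⟨?_, hg⟩, hxg⟩
          rintro rfl
          exact absurd hx.1 (not_le.2 hxg.2))
      rw [← Finset.add_sum_erase _ _ hf, h1, hfa']
      ring

namespace GIET

variable {d : ℕ} {σ : Equiv.Perm (Fin d)} {T T' : GIET σ} {N : Fin d → ℕ} {w : Fin d → ℕ → Fin d}
  {κ : Fin d → Fin d} {τ : Fin d → ℕ} {p : ℕ → ℝ} {X : ℝ}

/-- `T'` is obtained from `T` by inducing on `[0,X)` along towers of heights `N` and
itineraries `w`, and rescaling. -/
structure IsInduced (T T' : GIET σ) (N : Fin d → ℕ) (w : Fin d → ℕ → Fin d) (X : ℝ) : Prop where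
  pos : 0 < X
  mem : ∀ i : Fin d, ∀ s < N i, ∀ y ∈ Icc (T'.topCut i) (T'.topCut (i + 1)),
    T.word (w i) s (X * y) ∈ Icc (T.topCut (w i s)) (T.topCut (w i s + 1))
  conj : ∀ i : Fin d, ∀ y ∈ Icc (T'.topCut i) (T'.topCut (i + 1)),
    T.word (w i) (N i) (X * y) = X * T'.branch i y
  tiling : ∀ (j : Fin d) (h : ℝ → ℝ), ∑ i, ∑ s ∈ (Finset.range (N i)).filter (fun s => w i s = j),
    (h (T.word (w i) s (X * T'.topCut (i + 1))) - h (T.word (w i) s (X * T'.topCut i))) =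
      h (T.topCut (j + 1)) - h (T.topCut j)

namespace Towers

lemma word_right_le (h : Towers T N w κ τ p) {i : Fin d} {s : ℕ} {c : ℝ}
    (hc : ∀ y ∈ Ico (p i) (p (i + 1)), T.word (w i) s y < c) :
    T.word (w i) s (p (i + 1)) ≤ c := by
  by_contra! hlt
  have h1 : (T.word (w i) s).symm c < p (i + 1) := by rwa [OrderIso.symm_apply_lt]
  have h2 := hc _ ⟨le_max_right ((T.word (w i) s).symm c) (p i), max_lt h1 (h.lt_succ i)⟩
  have h3 := (T.word (w i) s).monotone (le_max_left ((T.word (w i) s).symm c) (p i))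
  rw [OrderIso.apply_symm_apply] at h3
  linarith

lemma mem_Icc (h : Towers T N w κ τ p) {i : Fin d} {s : ℕ} (hs : s < N i) {y : ℝ}
    (hy : y ∈ Icc (p i) (p (i + 1))) :
    T.word (w i) s y ∈ Icc (T.topCut (w i s)) (T.topCut (w i s + 1)) :=
  ⟨(h.left_mem i s hs).1.trans ((T.word (w i) s).monotone hy.1),
    ((T.word (w i) s).monotone hy.2).trans (h.word_right_le fun z hz => (h.mem i z hz s hs).2)⟩

lemma mem_Ico_word {i : Fin d} {s : ℕ} {x : ℝ}
    (hx : x ∈ Ico (T.word (w i) s (p i)) (T.word (w i) s (p (i + 1)))) :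
    ∃ y ∈ Ico (p i) (p (i + 1)), T.word (w i) s y = x :=
  ⟨(T.word (w i) s).symm x, ⟨by rw [OrderIso.le_symm_apply]; exact hx.1,
    by rw [OrderIso.symm_apply_lt]; exact hx.2⟩, OrderIso.apply_symm_apply _ _⟩

lemma word_mem_Ico {i : Fin d} {s : ℕ} {y : ℝ} (hy : y ∈ Ico (p i) (p (i + 1))) :
    T.word (w i) s y ∈ Ico (T.word (w i) s (p i)) (T.word (w i) s (p (i + 1))) :=
  ⟨(T.word (w i) s).monotone hy.1, (T.word (w i) s).strictMono hy.2⟩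

lemma return_index_eq (h : Towers T N w κ τ p) {i j : Fin d} {x : ℝ}
    (hi : x ∈ Ico (T.word (w i) (N i) (p i)) (T.word (w i) (N i) (p (i + 1))))
    (hj : x ∈ Ico (T.word (w j) (N j) (p j)) (T.word (w j) (N j) (p (j + 1)))) : i = j := by
  have key : ∀ {i j : Fin d} {y z : ℝ}, y ∈ Ico (p i) (p (i + 1)) → z ∈ Ico (p j) (p (j + 1)) →
      N i ≤ N j → T.map^[N i] y = T.map^[N j] z → i = j := by
    intro i j y z hy hz hij he
    have h1 := T.iterate_cancel (h.mem_unit hy) (h.mem_unit hz) hij he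
    rcases hij.eq_or_lt with h2 | h2
    · rw [h2, Nat.sub_self, Function.iterate_zero_apply] at h1
      exact h.base_index_eq hy (h1 ▸ hz)
    · rw [h.iterate_eq hz (by omega)] at h1
      have := h.base_le' hz (s := N j - N i) (by have := h.N_pos i; omega) (by omega)
      rw [← h1] at this
      exact absurd (h.mem_base hy).2 (not_lt.2 this)
  obtain ⟨y, hy, hyx⟩ := mem_Ico_word hi
  obtain ⟨z, hz, hzx⟩ := mem_Ico_word hj
  rw [← h.iterate_eq hy le_rfl] at hyx
  rw [← h.iterate_eq hz le_rfl] at hzx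
  rcases le_total (N i) (N j) with h1 | h1
  · exact key hy hz h1 (hyx.trans hzx.symm)
  · exact (key hz hy h1 (hzx.trans hyx.symm)).symm

lemma return_nonneg (h : Towers T N w κ τ p) (i : Fin d) : 0 ≤ T.word (w i) (N i) (p i) := by
  rw [← h.iterate_eq (h.left_mem_base i) le_rfl]
  exact (T.iterate_mem (h.mem_unit (h.left_mem_base i)) _).1

variable (hd : 2 ≤ d) (hσ : numMarkedPoints σ = 1)

include hd hσ

lemma sum_floors (h : Towers T N w κ τ p) (j : Fin d) (f : ℝ → ℝ) :
    ∑ i : Fin d, ∑ s ∈ (Finset.range (N i)).filter (fun s => w i s = j),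
      (f (T.word (w i) s (p (i + 1))) - f (T.word (w i) s (p i))) =
        f (T.topCut (j + 1)) - f (T.topCut j) := by
  rw [← Finset.sum_sigma (Finset.univ : Finset (Fin d))
    (fun i => (Finset.range (N i)).filter (fun s => w i s = j))
    (fun x => f (T.word (w x.1) x.2 (p (x.1 + 1))) - f (T.word (w x.1) x.2 (p x.1)))]
  have hmem : ∀ x : Σ _ : Fin d, ℕ, x ∈ (Finset.univ : Finset (Fin d)).sigma
      (fun i => (Finset.range (N i)).filter (fun s => w i s = j)) ↔
        x.2 < N x.1 ∧ w x.1 x.2 = j := fun x => by simp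
  refine sum_tiling _ (fun x : Σ _ : Fin d, ℕ => T.word (w x.1) x.2 (p x.1))
    (fun x => T.word (w x.1) x.2 (p (x.1 + 1))) f
    (fun x _ => (T.word _ _).strictMono (h.lt_succ x.1)) (fun x hx => ?_)
    (fun x hx y hy z hz hz' => ?_) (T.topCut_mono (Nat.le_succ _)) (fun x hx => ?_)
    fun x hx => ?_
  · obtain ⟨h1, h2⟩ := (hmem x).1 hx
    have := (h.mem_Icc h1 (right_mem_Icc.2 (h.lt_succ x.1).le)).2
    rwa [h2] at this
  · obtain ⟨h1, -⟩ := (hmem x).1 hx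
    obtain ⟨h2, -⟩ := (hmem y).1 hy
    obtain ⟨a, ha, haz⟩ := mem_Ico_word hz
    obtain ⟨b, hb, hbz⟩ := mem_Ico_word hz'
    obtain ⟨h3, h4⟩ := h.floor_index_eq ha hb h1 h2 (haz.trans hbz.symm)
    obtain ⟨x1, x2⟩ := x
    obtain ⟨y1, y2⟩ := y
    simp only at h3 h4
    rw [h3, h4]
  · obtain ⟨h1, h2⟩ := (hmem x).1 hx
    have := (h.left_mem x.1 x.2 h1).1
    rwa [h2] at this
  · obtain ⟨i, y, hy, s, hs, rfl⟩ := h.mem_floors hd hσ (T.Ico_top_subset j hx)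
    exact ⟨⟨i, s⟩, (hmem _).2 ⟨hs, T.top_index_eq (h.mem i y hy s hs) hx⟩, word_mem_Ico hy⟩

/-- A generalised interval exchange conjugate to the return map of the towers. -/
theorem isInduced (h : Towers T N w κ τ p) (hcut : ∀ k ≤ d, p d * T'.topCut k = p k)
    (hconj : ∀ i : Fin d, ∀ y ∈ Icc (T'.topCut i) (T'.topCut (i + 1)),
      T.word (w i) (N i) (p d * y) = p d * T'.branch i y) : IsInduced T T' N w (p d) := by
  have hX : 0 < p d := by simpa [h.zero] using h.lt (show 0 < d by omega) le_rfl
  refine ⟨hX, fun i s hs y hy => h.mem_Icc hs ?_, hconj, fun j f => ?_⟩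
  · rw [← hcut i i.2.le, ← hcut (i + 1) i.2]
    exact ⟨mul_le_mul_of_nonneg_left hy.1 hX.le, mul_le_mul_of_nonneg_left hy.2 hX.le⟩
  · rw [← h.sum_floors hd hσ j f]
    refine Finset.sum_congr rfl fun i _ => ?_
    rw [hcut i i.2.le, hcut (i + 1) i.2]

omit hσ in
/-- The return map of the towers is a rescaled first return map. -/
theorem isRescaledFirstReturn (h : Towers T N w κ τ p)
    (hcut : ∀ k ≤ d, p d * T'.topCut k = p k)
    (hconj : ∀ i : Fin d, ∀ y ∈ Icc (T'.topCut i) (T'.topCut (i + 1)),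
      T.word (w i) (N i) (p d * y) = p d * T'.branch i y) : IsRescaledFirstReturn (p d) T T' := by
  have hX : 0 < p d := by simpa [h.zero] using h.lt (show 0 < d by omega) le_rfl
  refine ⟨hX, h.lt_one, fun y hy => ?_⟩
  obtain ⟨i, hi⟩ := T'.exists_mem_top hy
  have hyi : p d * y ∈ Ico (p i) (p (i + 1)) := by
    rw [← hcut i i.2.le, ← hcut (i + 1) i.2]
    exact ⟨mul_le_mul_of_nonneg_left hi.1 hX.le, mul_lt_mul_of_pos_left hi.2 hX⟩
  refine ⟨N i, h.isFirstReturnTime hyi, ?_⟩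
  rw [h.iterate_eq hyi le_rfl, hconj i y (Ico_subset_Icc_self hi), T'.map_eq_branch hi]

omit hd hσ in
lemma sum_returns_of (h : Towers T N w κ τ p) (F : Finset (Fin d)) {b : ℝ} (hb : 0 ≤ b)
    (hF : ∀ i ∈ F, T.word (w i) (N i) (p (i + 1)) ≤ b)
    (hcov : ∀ x ∈ Ico 0 b, ∃ i ∈ F,
      x ∈ Ico (T.word (w i) (N i) (p i)) (T.word (w i) (N i) (p (i + 1)))) :
    ∑ i ∈ F, (T.word (w i) (N i) (p (i + 1)) - T.word (w i) (N i) (p i)) = b := by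
  have := sum_tiling F (fun i => T.word (w i) (N i) (p i))
    (fun i => T.word (w i) (N i) (p (i + 1))) id
    (fun i _ => (T.word _ _).strictMono (h.lt_succ i)) hF
    (fun i _ j _ x hx hx' => h.return_index_eq hx hx') hb (fun i _ => h.return_nonneg i) hcov
  simpa using this

lemma exists_return_mem (h : Towers T N w κ τ p) {x : ℝ} (hx : x ∈ Ico 0 (p d)) :
    ∃ i, x ∈ Ico (T.word (w i) (N i) (p i)) (T.word (w i) (N i) (p (i + 1))) := by
  obtain ⟨i, y, hy, rfl⟩ := h.exists_return_eq hd hσ hx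
  exact ⟨i, word_mem_Ico hy⟩

lemma sum_returns (h : Towers T N w κ τ p) :
    ∑ i : Fin d, (T.word (w i) (N i) (p (i + 1)) - T.word (w i) (N i) (p i)) = p d :=
  h.sum_returns_of _ (h.nonneg le_rfl) (fun i _ => h.word_right_le (h.ret i)) fun x hx => by
    obtain ⟨i, hi⟩ := h.exists_return_mem hd hσ hx
    exact ⟨i, Finset.mem_univ _, hi⟩

/-- The images of the towers fill the base from the left in the order of `σ`, so the lengths of
those before the `k`-th add up to its left end. -/
lemma sum_returns_lt (h : Towers T N w κ τ p)
    (hord : ∀ i j, σ i < σ j → T.word (w i) (N i) (p i) < T.word (w j) (N j) (p j)) (k : Fin d) :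
    ∑ i with σ i < σ k, (T.word (w i) (N i) (p (i + 1)) - T.word (w i) (N i) (p i)) =
      T.word (w k) (N k) (p k) := by
  refine h.sum_returns_of _ (h.return_nonneg k) (fun i hi => ?_) fun x hx => ?_
  · have hi : σ i < σ k := by simpa using hi
    by_contra! hlt
    have := h.return_index_eq (x := T.word (w k) (N k) (p k)) ⟨(hord i k hi).le, hlt⟩
      (word_mem_Ico (h.left_mem_base k))
    subst this
    exact lt_irrefl _ hi
  · obtain ⟨i, hi⟩ := h.exists_return_mem hd hσ
      ⟨hx.1, hx.2.trans (h.ret k _ (h.left_mem_base k))⟩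
    refine ⟨i, by
      rw [Finset.mem_filter]
      refine ⟨Finset.mem_univ _, ?_⟩
      by_contra! hle
      rcases hle.eq_or_lt with he | hlt
      · have := σ.injective he
        subst this
        exact absurd hx.2 (not_lt.2 hi.1)
      · linarith [hord k i hlt, hi.1, hx.2], hi⟩

omit hd hσ in
lemma word_contDiffOn (h : Towers T N w κ τ p) (i : Fin d) :
    ContDiffOn ℝ 3 (T.word (w i) (N i)) (Icc (p i) (p (i + 1))) :=
  T.contDiffOn_word _ fun _ hm _ hy => h.mem_Icc hm hy

omit hd hσ in
lemma word_hasDeriv (h : Towers T N w κ τ p) (i : Fin d) : ∀ x ∈ Icc (p i) (p (i + 1)),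
    ∃ D, 0 < D ∧ HasDerivWithinAt (T.word (w i) (N i)) D (Icc (p i) (p (i + 1))) x := fun x hx =>
  ⟨_, Real.exp_pos _, (T.word_logJet (w i) (n := N i) fun _ hm _ hy => h.mem_Icc hm hy).d1 x hx⟩

/-- The rescaled return map of the towers. -/
theorem exists_giet (h : Towers T N w κ τ p)
    (hord : ∀ i j, σ i < σ j → T.word (w i) (N i) (p i) < T.word (w j) (N j) (p j)) :
    ∃ T' : GIET σ, (∀ k ≤ d, p d * T'.topCut k = p k) ∧
      ∀ i : Fin d, ∀ y ∈ Icc (T'.topCut i) (T'.topCut (i + 1)),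
        T.word (w i) (N i) (p d * y) = p d * T'.branch i y := by
  have hX : 0 < p d := by simpa [h.zero] using h.lt (show 0 < d by omega) le_rfl
  have hlt : ∀ i : Fin d, T.word (w i) (N i) (p i) < T.word (w i) (N i) (p (i + 1)) := fun i =>
    (T.word _ _).strictMono (h.lt_succ i)
  have htel : ∀ k ≤ d, p d * partialSum (fun i : Fin d => (p (i + 1) - p i) / p d) k = p k := by
    intro k
    induction k with
    | zero => intro _; simp [h.zero]
    | succ k ih =>
      intro hk
      rw [partialSum_succ (⟨k, hk⟩ : Fin d), mul_add, ih (by omega), mul_div_cancel₀ _ hX.ne']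
      simp
  let T' : GIET σ :=
    { top := fun i => (p (i + 1) - p i) / p d
      bot := fun l => (T.word (w (σ.symm l)) (N (σ.symm l)) (p (σ.symm l + 1)) -
        T.word (w (σ.symm l)) (N (σ.symm l)) (p (σ.symm l))) / p d
      φ := fun i => IntervalDiffeo.rescale (h.lt_succ i) (h.word_contDiffOn i) (h.word_hasDeriv i)
        (hlt i)
      top_pos := fun i => div_pos (sub_pos.2 (h.lt_succ i)) hX
      bot_pos := fun l => div_pos (sub_pos.2 (hlt _)) hX
      sum_top := by
        have := htel d le_rfl
        rw [partialSum_of_le le_rfl] at this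
        exact mul_left_cancel₀ hX.ne' (this.trans (mul_one _).symm)
      sum_bot := by
        rw [← Finset.sum_div, Equiv.sum_comp σ.symm (fun i => T.word (w i) (N i) (p (i + 1)) -
          T.word (w i) (N i) (p i)), h.sum_returns hd hσ, div_self hX.ne'] }
  have hcut : ∀ k ≤ d, p d * T'.topCut k = p k := htel
  have hbot : ∀ i, p d * T'.botCut (σ i) = T.word (w i) (N i) (p i) := fun i => by
    rw [← h.sum_returns_lt hd hσ hord i, botCut, partialSum, Finset.mul_sum]
    refine Finset.sum_equiv σ.symm (fun l => by
      simp only [Finset.mem_filter, Finset.mem_univ, true_and, Equiv.apply_symm_apply,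
        Fin.val_fin_lt]) fun l _ => ?_
    exact mul_div_cancel₀ _ hX.ne'
  refine ⟨T', hcut, fun i y hy => ?_⟩
  have hz := T'.coord_mem hy
  have hpos : 0 < p (i + 1) - p i := sub_pos.2 (h.lt_succ i)
  have h1 : p i + (p (i + 1) - p i) * T'.coord i y = p d * y := by
    have h2 := hcut i i.2.le
    have h3 : T'.coord i y = (p d * y - p i) / (p (i + 1) - p i) := by
      have : T'.coord i y = (y - T'.topCut i) / ((p (i + 1) - p i) / p d) := rfl
      rw [this, div_div_eq_mul_div, sub_mul, mul_comm, mul_comm (T'.topCut i), h2]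
    rw [h3, mul_div_cancel₀ _ hpos.ne']
    ring
  have h2 : (T'.φ i).toFun (T'.coord i y) = (T.word (w i) (N i) (p d * y) -
      T.word (w i) (N i) (p i)) / (T.word (w i) (N i) (p (i + 1)) - T.word (w i) (N i) (p i)) := by
    rw [← h1]
    exact IntervalDiffeo.rescale_apply (h.lt_succ i) (h.word_contDiffOn i) (h.word_hasDeriv i)
      (hlt i) hz
  have h3 : p d * T'.bot (σ i) = T.word (w i) (N i) (p (i + 1)) - T.word (w i) (N i) (p i) := by
    change p d * ((T.word (w (σ.symm (σ i))) (N (σ.symm (σ i))) (p (σ.symm (σ i) + 1)) -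
        T.word (w (σ.symm (σ i))) (N (σ.symm (σ i))) (p (σ.symm (σ i)))) / p d) = _
    rw [Equiv.symm_apply_apply, mul_div_cancel₀ _ hX.ne']
  rw [branch_apply, mul_add, hbot, ← mul_assoc, h3]
  change _ = _ + _ * (T'.φ i).toFun (T'.coord i y)
  rw [h2, mul_div_cancel₀ _ (sub_pos.2 (hlt i)).ne']
  ring

end Towers

/-- A self-similar standard interval exchange is induced by itself. -/
lemma IsRescaledFirstReturn.conj {x₀ : ℝ} (hself : IsRescaledFirstReturn x₀ T T)
    (h : Towers T N w κ τ (fun k => x₀ * T.topCut k)) (i : Fin d) {y : ℝ}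
    (hy : y ∈ Icc (T.topCut i) (T.topCut (i + 1))) :
    T.word (w i) (N i) (x₀ * y) = x₀ * T.branch i y := by
  have h0 := hself.1
  have hlt : T.topCut i < T.topCut (i + 1) := T.topCut_lt (Nat.lt_succ_self _) i.2
  have hbase : ∀ y ∈ Ico (T.topCut i) (T.topCut (i + 1)),
      T.word (w i) (N i) (x₀ * y) = x₀ * T.branch i y := by
    intro y hy
    have hy' : x₀ * y ∈ Ico (x₀ * T.topCut i) (x₀ * T.topCut (i + 1)) :=
      ⟨mul_le_mul_of_nonneg_left hy.1 h0.le, mul_lt_mul_of_pos_left hy.2 h0⟩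
    obtain ⟨n, hn, he⟩ := hself.2.2 y (T.Ico_top_subset i hy)
    have h1 := h.isFirstReturnTime (i := i) hy'
    simp only [topCut_last, mul_one] at h1
    rw [hn.unique h1, h.iterate_eq (i := i) hy' le_rfl, T.map_eq_branch hy] at he
    exact he
  have hc1 : Continuous fun y => T.word (w i) (N i) (x₀ * y) :=
    (T.word (w i) (N i)).continuous.comp (continuous_const.mul continuous_id)
  have hc2 : Continuous fun y => x₀ * T.branch i y :=
    continuous_const.mul (T.branch i).continuous
  -- The dynamics gives the identity on the half-open interval; continuity adds the right end.
  have : closure (Ico (T.topCut i) (T.topCut (i + 1))) ⊆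
      {y | T.word (w i) (N i) (x₀ * y) = x₀ * T.branch i y} :=
    closure_minimal hbase (isClosed_eq hc1 hc2)
  rw [closure_Ico hlt.ne] at this
  exact this hy

end GIET

/-! ### The renormalisation operator. -/

namespace GIET

variable {d : ℕ} {σ : Equiv.Perm (Fin d)} {T : GIET σ} {x₀ : ℝ}

/-- Renormalisation is defined on a neighbourhood of a self-similar interval exchange. -/
theorem exists_renormalisation (hd : 2 ≤ d) (hσ : numMarkedPoints σ = 1) (hT : T.IsStandard)
    (hc : T.NoConnection) (hself : IsRescaledFirstReturn x₀ T T) :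
    ∃ (N : Fin d → ℕ) (w : Fin d → ℕ → Fin d) (κ : Fin d → Fin d) (τ : Fin d → ℕ)
      (X : GIET σ → ℝ) (R : GIET σ → GIET σ), Towers T N w κ τ (fun k => x₀ * T.topCut k) ∧
      (∀ S, Tendsto X S.near (𝓝 (X S))) ∧ ∃ ε₀ > 0,
        (∀ ε > 0, ε ≤ ε₀ → IsRenormalisationOperator T x₀ {S | cDist 3 S T < ε} X R) ∧
        ∀ S, cDist 3 S T < ε₀ → IsInduced S (R S) N w (X S) := by
  classical
  obtain ⟨N, w, κ, τ, i₁, m₁, h, hm₀, hm₁, hX⟩ := exists_towers_frame hd hσ hT hc hself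
  have hXd : T.word (w i₁) m₁ ((fun k => x₀ * T.topCut k) i₁) =
      (fun k => x₀ * T.topCut k) d := by simpa using hX
  have hTX : T.baseLength w κ τ i₁ m₁ = x₀ := by
    rw [← basePoint_last, h.toTowerFrame.basePoint_eq hXd le_rfl]
    simp
  have hord : ∀ i j : Fin d, σ i < σ j → T.word (w i) (N i) ((fun k => x₀ * T.topCut k) i) <
      T.word (w j) (N j) ((fun k => x₀ * T.topCut k) j) := by
    intro i j hij
    simp only
    rw [hself.conj h i (left_mem_Icc.2 (T.topCut_mono (Nat.le_succ _))),
      hself.conj h j (left_mem_Icc.2 (T.topCut_mono (Nat.le_succ _))), branch_left, branch_left]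
    exact mul_lt_mul_of_pos_left (T.botCut_lt hij (σ i).2) hself.1
  obtain ⟨ε₀, hε₀, hball⟩ := eventually_near_iff.1
    ((h.eventually_towers hm₀ hm₁ hXd).and (h.eventually_order hXd hord))
  -- Prescribing the value at `T` avoids a uniqueness argument for the induced exchange; outside the
  -- ball any value will do.
  have hR : ∀ S : GIET σ, ∃ S' : GIET σ, (S = T → S' = T) ∧ (cDist 3 S T < ε₀ →
      IsInduced S S' N w (S.baseLength w κ τ i₁ m₁) ∧
      IsRescaledFirstReturn (S.baseLength w κ τ i₁ m₁) S S') := by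
    intro S
    by_cases hST : S = T
    · subst hST
      have hcut : ∀ k ≤ d, (fun k => x₀ * S.topCut k) d * S.topCut k =
        (fun k => x₀ * S.topCut k) k := fun k _ => by simp
      have hconj : ∀ i : Fin d, ∀ y ∈ Icc (S.topCut i) (S.topCut (i + 1)),
          S.word (w i) (N i) ((fun k => x₀ * S.topCut k) d * y) =
            (fun k => x₀ * S.topCut k) d * S.branch i y := fun i y hy => by
        simpa using hself.conj h i hy
      refine ⟨S, fun _ => rfl, fun _ => ?_⟩
      rw [hTX]
      have h1 := h.isInduced hd hσ hcut hconj
      simp only [topCut_last, mul_one] at h1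
      exact ⟨h1, hself⟩
    · by_cases hS : cDist 3 S T < ε₀
      · obtain ⟨h1, h2⟩ := hball S hS
        obtain ⟨S', h3, h4⟩ := h1.exists_giet hd hσ h2
        refine ⟨S', fun h => absurd h hST, fun _ => ?_⟩
        rw [← basePoint_last]
        exact ⟨h1.isInduced hd hσ h3 h4, h1.isRescaledFirstReturn hd h3 h4⟩
      · exact ⟨T, fun _ => rfl, fun h => absurd h hS⟩
  choose R hR1 hR2 using hR
  have hlim : ∀ S : GIET σ, Tendsto (fun S => S.baseLength w κ τ i₁ m₁) S.near
      (𝓝 (S.baseLength w κ τ i₁ m₁)) := fun S => S.tendsto_baseLength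
  refine ⟨N, w, κ, τ, fun S => S.baseLength w κ τ i₁ m₁, R, h, hlim, ε₀, hε₀, fun ε hε hεε => ?_,
    fun S hS => (hR2 S hS).1⟩
  refine ⟨⟨ε, hε, fun S hS => hS⟩, hTX, hR1 T rfl, fun S _ δ hδ => ?_,
    fun S hS => (hR2 S (lt_of_lt_of_le hS hεε)).2⟩
  obtain ⟨η, hη, h1⟩ := eventually_near_iff.1 (Metric.tendsto_nhds.1 (hlim S) δ hδ)
  exact ⟨η, hη, fun S' _ hS' => h1 S' hS'⟩

end GIET

/-! ### A positive row in a power of the intersection matrix. -/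

namespace GIET

variable {d : ℕ} {σ : Equiv.Perm (Fin d)} {T : GIET σ} {x₀ : ℝ}
  {N : Fin d → ℕ} {w : Fin d → ℕ → Fin d} {κ : Fin d → Fin d} {τ : Fin d → ℕ}

/-- The points of `[0,1)` lying in the top intervals with index in `Z`. -/
def topUnion (T : GIET σ) (Z : Set (Fin d)) : Set ℝ :=
  {x | ∃ j ∈ Z, x ∈ Ico (T.topCut j) (T.topCut (j + 1))}

/-- The entries of the intersection matrix count the visits of the itineraries. -/
lemma Towers.intersectionMatrix_apply (h : Towers T N w κ τ (fun k => x₀ * T.topCut k))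
    (h0 : 0 < x₀) (i j : Fin d) : T.intersectionMatrix x₀ i j =
      ((Finset.range (N i)).filter (fun s => w i s = j)).card := by
  have hl : x₀ * T.topCut i ∈ Ico (x₀ * T.topCut i) (x₀ * T.topCut (i + 1)) :=
    ⟨le_rfl, mul_lt_mul_of_pos_left (T.topCut_lt (Nat.lt_succ_self _) i.2) h0⟩
  have hN : T.returnTime x₀ i = N i := by
    have h1 := h.isFirstReturnTime (i := i) hl
    simp only [topCut_last, mul_one] at h1
    have : {n : ℕ | IsFirstReturnTime T.map (Ico 0 x₀) (x₀ * T.topLeft i) n} = {N i} := by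
      ext n
      rw [topLeft_eq]
      exact ⟨fun hn => hn.unique h1, fun hn => by rw [mem_singleton_iff.1 hn]; exact h1⟩
    rw [returnTime, this, csInf_singleton]
  have hbase : T.baseInterval x₀ i = Ico (x₀ * T.topCut i) (x₀ * T.topCut (i + 1)) := by
    rw [baseInterval, topLeft_eq, topCut_succ]
  rw [intersectionMatrix, Matrix.of_apply, ← Set.ncard_coe_finset]
  congr 1
  ext m
  simp only [mem_ofPred_eq, Finset.coe_filter, Finset.mem_range, hN, hbase, topInterval_eq]
  refine and_congr_right fun hm => ⟨?_, fun hj => ?_⟩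
  · rintro ⟨_, ⟨y, hy, rfl⟩, hj⟩
    rw [h.iterate_eq (i := i) hy hm.le] at hj
    exact T.top_index_eq (h.mem i y hy m hm) hj
  · refine ⟨_, ⟨_, hl, rfl⟩, ?_⟩
    rw [h.iterate_eq (i := i) hl hm.le, ← hj]
    exact h.mem i _ hl m hm

section Reach

variable (hself : IsRescaledFirstReturn x₀ T T)
  (h : Towers T N w κ τ (fun k => x₀ * T.topCut k)) {Z : Set (Fin d)}
  (hZ : ∀ j ∈ Z, ∀ s < N j, w j s ∈ Z)

include hself h

lemma Towers.iterate_return {j : Fin d} {y : ℝ} (hy : y ∈ Ico (T.topCut j) (T.topCut (j + 1))) :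
    T.map^[N j] (x₀ * y) = x₀ * T.map y := by
  have hy' : x₀ * y ∈ Ico (x₀ * T.topCut j) (x₀ * T.topCut (j + 1)) :=
    ⟨mul_le_mul_of_nonneg_left hy.1 hself.1.le, mul_lt_mul_of_pos_left hy.2 hself.1⟩
  rw [h.iterate_eq (i := j) hy' le_rfl, hself.conj h j (Ico_subset_Icc_self hy),
    T.map_eq_branch hy]

include hZ

/-- Orbit segments of renormalised points stay in an invariant union of intervals. -/
lemma Towers.orbit_segment (k : ℕ) {y : ℝ} (hy : y ∈ T.topUnion Z) :
    ∃ n, 0 < n ∧ T.map^[n] (x₀ ^ k * y) = x₀ ^ k * T.map y ∧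
      ∀ m < n, T.map^[m] (x₀ ^ k * y) ∈ T.topUnion Z := by
  induction k with
  | zero =>
    refine ⟨1, one_pos, by simp, fun m hm => ?_⟩
    obtain rfl : m = 0 := by omega
    simpa using hy
  | succ k ih =>
    obtain ⟨n, hn, he, hU⟩ := ih
    -- One step in the interval `j` at scale `x₀ ^ k` becomes, at scale `x₀ ^ (k + 1)`, a full
    -- passage through tower `j`, which visits only intervals of the itinerary `w j`.
    have key : ∀ r ≤ n, ∃ M, r ≤ M ∧
        T.map^[M] (x₀ ^ (k + 1) * y) = x₀ * T.map^[r] (x₀ ^ k * y) ∧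
        ∀ m < M, T.map^[m] (x₀ ^ (k + 1) * y) ∈ T.topUnion Z := by
      intro r
      induction r with
      | zero => exact fun _ => ⟨0, le_rfl, by simp [pow_succ']; ring, by simp⟩
      | succ r ihr =>
        intro hr
        obtain ⟨M, hM, hMe, hMU⟩ := ihr (by omega)
        obtain ⟨j, hj, hyj⟩ := hU r hr
        have hN := h.N_pos j
        refine ⟨N j + M, by omega, ?_, fun m hm => ?_⟩
        · rw [Function.iterate_add_apply, hMe, h.iterate_return hself hyj,
            Function.iterate_succ_apply']
        · rcases lt_or_ge m M with h1 | h1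
          · exact hMU m h1
          · obtain ⟨s, rfl⟩ := Nat.exists_eq_add_of_le' h1
            have hs : s < N j := by omega
            have hy' : x₀ * T.map^[r] (x₀ ^ k * y) ∈
                Ico (x₀ * T.topCut j) (x₀ * T.topCut (j + 1)) :=
              ⟨mul_le_mul_of_nonneg_left hyj.1 hself.1.le,
                mul_lt_mul_of_pos_left hyj.2 hself.1⟩
            rw [Function.iterate_add_apply, hMe, h.iterate_eq (i := j) hy' hs.le]
            exact ⟨_, hZ j hj s hs, h.mem j _ hy' s hs⟩
    obtain ⟨M, hM, hMe, hMU⟩ := key n le_rfl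
    refine ⟨M, by omega, ?_, hMU⟩
    rw [hMe, he]
    ring

variable (hd : 2 ≤ d) (hσ : numMarkedPoints σ = 1) (hT : T.IsStandard) (hc : T.NoConnection)
include hd hσ hT hc

/-- An invariant set of indices containing that of the last interval before `0` is full. -/
theorem Towers.invariant_eq_univ {i₀ : Fin d} (hi₀ : (σ i₀ : ℕ) = 0) (hi : i₀ ∈ Z) (j : Fin d) :
    j ∈ Z := by
  have h0 := hself.1
  have hx1 := hself.2.1
  have hpos : 0 < (i₀ : ℕ) := Nat.pos_of_ne_zero fun he => perm_first_ne hd hσ he hi₀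
  have hu : 0 < T.topCut i₀ := T.topCut_pos hpos (by omega)
  have hmap : T.map (T.topCut i₀) = 0 := by rw [map_topCut, hi₀, botCut_zero]
  have hmem : T.topCut i₀ ∈ T.topUnion Z := ⟨i₀, hi, T.topCut_mem_top i₀⟩
  have hmem_unit : ∀ k : ℕ, ∀ y ∈ Ico (0 : ℝ) 1, x₀ ^ k * y ∈ Ico (0 : ℝ) 1 := fun k y hy =>
    ⟨mul_nonneg (pow_nonneg h0.le k) hy.1,
      (mul_le_of_le_one_left hy.1 (pow_le_one₀ h0.le hx1.le)).trans_lt hy.2⟩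
  have hpow : ∀ {k l : ℕ} {a : ℝ}, 0 < a → x₀ ^ k * a = x₀ ^ l * a → k = l := by
    intro k l a ha he
    exact pow_right_injective₀ h0 hx1.ne (mul_right_cancel₀ ha.ne' he)
  -- The orbit of `x₀ ^ k` times the preimage of `0` arrives at `0` after `n k` steps inside the
  -- union. These times are distinct, hence unbounded, so the whole backward orbit of `0` stays in
  -- the union. Segments starting from `0` give the forward orbit in the same way.
  choose n hn hne hnU using fun k => h.orbit_segment hself hZ k hmem
  -- the index of `0` belongs to `Z`
  have hzero : (0 : ℝ) ∈ T.topUnion Z := by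
    have hlim : Tendsto (fun k => x₀ ^ k * T.topCut i₀) atTop (𝓝 0) := by
      simpa using (tendsto_pow_atTop_nhds_zero_of_lt_one h0.le hx1).mul_const (T.topCut i₀)
    have h1 : 0 < T.topCut 1 := T.topCut_pos one_pos (by omega)
    obtain ⟨k, hk⟩ := (hlim.eventually (gt_mem_nhds h1)).exists
    obtain ⟨j, hj, hy⟩ := hnU k 0 (hn k)
    have h2 : T.map^[0] (x₀ ^ k * T.topCut i₀) ∈
        Ico (T.topCut (⟨0, by omega⟩ : Fin d)) (T.topCut ((⟨0, by omega⟩ : Fin d) + 1)) := by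
      refine ⟨?_, by simpa using hk⟩
      simpa using (mul_pos (pow_pos h0 k) hu).le
    have h3 := T.top_index_eq hy h2
    subst h3
    exact ⟨_, hj, by simpa using T.topCut_mem_top (⟨0, by omega⟩ : Fin d)⟩
  -- backward orbit
  have hback : ∀ m, T.inv^[m] 0 ∈ T.topUnion Z := by
    intro m
    have hinj : Function.Injective n := by
      intro k l hkl
      have h1 := hne k
      rw [hkl, hmap, mul_zero] at h1
      have h2 := hne l
      rw [hmap, mul_zero] at h2
      exact hpow hu (T.iterate_injOn (n l) (hmem_unit k _ (T.topCut_mem i₀.2))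
        (hmem_unit l _ (T.topCut_mem i₀.2)) (h1.trans h2.symm))
    obtain ⟨k, hk⟩ := (hinj.nat_tendsto_atTop.eventually_gt_atTop m).exists
    rcases Nat.eq_zero_or_pos m with rfl | hm
    · exact hzero
    have h1 := hnU k (n k - m) (by omega)
    have h2 := iterate_iterate_cancel T.mapsTo_map (fun x hx => T.inv_map hx)
      (T.iterate_mem (hmem_unit k _ (T.topCut_mem i₀.2)) (n k - m)) m
    rw [← Function.iterate_add_apply T.map, show m + (n k - m) = n k by omega, hne k, hmap,
      mul_zero] at h2
    rwa [h2]
  -- forward orbit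
  have hfwd : ∀ m, T.map^[m] 0 ∈ T.topUnion Z := by
    intro m
    choose n hn hne hnU using fun k => h.orbit_segment hself hZ k hzero
    simp only [mul_zero] at hne hnU
    have hT0 : 0 < T.map 0 := (T.map_mem ⟨le_rfl, one_pos⟩).1.lt_of_ne
      (iterate_zero_ne_zero hd hσ hc one_pos).symm
    have hinj : Function.Injective n := by
      intro k l hkl
      have h1 := hne k
      rw [hkl, hne l] at h1
      exact (hpow hT0 h1).symm
    obtain ⟨k, hk⟩ := (hinj.nat_tendsto_atTop.eventually_gt_atTop m).exists
    exact hnU k m hk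
  rcases Nat.eq_zero_or_pos (j : ℕ) with hj | hj
  · obtain ⟨l, hl, hy⟩ := hzero
    have h2 := T.topCut_mem_top j
    rw [hj, topCut_zero] at h2
    have h3 := T.top_index_eq hy (i := l) (j := j) (by rw [hj, topCut_zero]; exact h2)
    rwa [← h3]
  · obtain ⟨m, hm⟩ := exists_orbit_zero_mem_Ico hd hσ hc hT (a := T.topCut j) ⟨j, hj, rfl⟩
      (T.topCut_lt (Nat.lt_succ_self j) j.2)
    have h1 : ∃ x ∈ T.topUnion Z, x ∈ Ico (T.topCut j) (T.topCut (j + 1)) := by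
      rcases hm with hm | hm
      · exact ⟨_, hfwd m, hm⟩
      · exact ⟨_, hback m, hm⟩
    obtain ⟨x, ⟨l, hl, hx⟩, hx'⟩ := h1
    rwa [← T.top_index_eq hx hx']

end Reach

/-- Some power of the intersection matrix has a positive row. -/
theorem exists_intersectionMatrix_row_pos (hd : 2 ≤ d) (hσ : numMarkedPoints σ = 1)
    (hT : T.IsStandard) (hc : T.NoConnection) (hself : IsRescaledFirstReturn x₀ T T)
    (h : Towers T N w κ τ (fun k => x₀ * T.topCut k)) :
    ∃ (i : Fin d) (k : ℕ), 0 < k ∧ ∀ j, 0 < (T.intersectionMatrix x₀ ^ k) i j := by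
  set A := T.intersectionMatrix x₀ with hA
  have hApos : ∀ i, ∀ s < N i, 0 < A i (w i s) := fun i s hs => by
    rw [hA, h.intersectionMatrix_apply hself.1, Finset.card_pos]
    exact ⟨s, by simp [hs]⟩
  have hmul : ∀ {B C : Matrix (Fin d) (Fin d) ℕ} {i j k : Fin d}, 0 < B i j → 0 < C j k →
      0 < (B * C) i k := fun {B C i j k} h1 h2 => by
    rw [Matrix.mul_apply]
    exact lt_of_lt_of_le (Nat.mul_pos h1 h2) (Finset.single_le_sum (f := fun j => B i j * C j k)
      (fun _ _ => Nat.zero_le _) (Finset.mem_univ j))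
  obtain ⟨i, hi, -, hmap⟩ := exists_map_eq_zero hd hσ T
  -- The left end of tower `i` returns to `0`, whose preimage is the left end of interval `i`; so
  -- the last floor lies in that interval. This diagonal entry keeps an entry of row `i` positive in
  -- all later powers, which allows a common exponent.
  have hii : 0 < A i i := by
    have hN := h.N_pos i
    have hs : N i - 1 < N i := by omega
    have h1 := h.left_mem i (N i - 1) hs
    have h2 := hself.conj h i (left_mem_Icc.2 (T.topCut_mono (Nat.le_succ i)))
    rw [branch_left, hi, botCut_zero, mul_zero, show N i = N i - 1 + 1 by omega, word_succ,
      ← T.map_eq_branch h1, ← hmap] at h2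
    have h3 := T.injOn_map (T.Ico_top_subset _ h1) (T.topCut_mem i.2) h2
    rw [h3] at h1
    have h4 := T.top_index_eq h1 (T.topCut_mem_top i)
    have h5 := hApos i _ hs
    rwa [h4] at h5
  have hreach : ∀ j, j ∈ {j | ∃ k, 0 < (A ^ k) i j} := fun j =>
    h.invariant_eq_univ hself (Z := {j | ∃ k, 0 < (A ^ k) i j})
      (fun j ⟨k, hk⟩ s hs => ⟨k + 1, by rw [pow_succ]; exact hmul hk (hApos j s hs)⟩)
      hd hσ hT hc hi ⟨0, by simp⟩ j
  choose k hk using hreach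
  have hup : ∀ j m, 0 < (A ^ (k j + m)) i j := fun j m => by
    induction m with
    | zero => exact hk j
    | succ m ih =>
      rw [← add_assoc, pow_succ']
      exact hmul hii ih
  refine ⟨i, Finset.univ.sup k + 1, Nat.succ_pos _, fun j => ?_⟩
  have h1 : k j ≤ Finset.univ.sup k := Finset.le_sup (Finset.mem_univ j)
  have h2 := hup j (Finset.univ.sup k + 1 - k j)
  rwa [show k j + (Finset.univ.sup k + 1 - k j) = Finset.univ.sup k + 1 by omega] at h2

end GIET

/-! ### Diffeomorphisms of the interval with small Schwarzian derivative. -/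

/-- Mean value inequality on an interval. -/
lemma abs_sub_le_of_hasDerivWithinAt {f f' : ℝ → ℝ} {a b C : ℝ}
    (hf : ∀ x ∈ Icc a b, HasDerivWithinAt f (f' x) (Icc a b) x) (hC : ∀ x ∈ Icc a b, |f' x| ≤ C)
    {x y : ℝ} (hx : x ∈ Icc a b) (hy : y ∈ Icc a b) : |f y - f x| ≤ C * |y - x| :=
  (convex_Icc a b).norm_image_sub_le_of_norm_hasDerivWithin_le hf hC hx hy

lemma abs_sub_le_of_hasDerivWithinAt_unit {f f' : ℝ → ℝ} {C : ℝ}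
    (hf : ∀ x ∈ Icc (0 : ℝ) 1, HasDerivWithinAt f (f' x) (Icc 0 1) x)
    (hC : ∀ x ∈ Icc (0 : ℝ) 1, |f' x| ≤ C)
    {x y : ℝ} (hx : x ∈ Icc (0 : ℝ) 1) (hy : y ∈ Icc (0 : ℝ) 1) : |f y - f x| ≤ C := by
  refine (abs_sub_le_of_hasDerivWithinAt hf hC hx hy).trans ?_
  have h1 : |y - x| ≤ 1 := abs_le.2 ⟨by linarith [hx.2, hy.1], by linarith [hx.1, hy.2]⟩
  exact mul_le_of_le_one_right ((abs_nonneg _).trans (hC x hx)) h1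

lemma exists_hasDerivWithinAt_eq_sub {f f' : ℝ → ℝ}
    (hf : ∀ x ∈ Icc (0 : ℝ) 1, HasDerivWithinAt f (f' x) (Icc 0 1) x) :
    ∃ c ∈ Icc (0 : ℝ) 1, f' c = f 1 - f 0 := by
  obtain ⟨c, hc, h⟩ := exists_hasDerivAt_eq_slope f f' one_pos
    (fun x hx => (hf x hx).continuousWithinAt)
    (fun x hx => (hf x (Ioo_subset_Icc_self hx)).hasDerivAt (Icc_mem_nhds hx.1 hx.2))
  exact ⟨c, Ioo_subset_Icc_self hc, by simpa using h⟩

lemma abs_exp_sub_one_le_two_mul {x : ℝ} (hx : |x| ≤ 1) : |Real.exp x - 1| ≤ 2 * |x| := by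
  have := Real.abs_exp_sub_one_sub_id_le hx
  have h2 : x ^ 2 ≤ |x| := by rw [← sq_abs]; nlinarith [abs_nonneg x]
  have h3 : |Real.exp x - 1| ≤ |Real.exp x - 1 - x| + |x| := by
    simpa using abs_add_le (Real.exp x - 1 - x) x
  linarith

/-- The difference with the affine interpolation is controlled by the second derivative. -/
lemma abs_sub_interpolation_le {g g1 g2 : ℝ → ℝ} {C : ℝ}
    (h1 : ∀ x ∈ Icc (0 : ℝ) 1, HasDerivWithinAt g (g1 x) (Icc 0 1) x)
    (h2 : ∀ x ∈ Icc (0 : ℝ) 1, HasDerivWithinAt g1 (g2 x) (Icc 0 1) x)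
    (hC : ∀ x ∈ Icc (0 : ℝ) 1, |g2 x| ≤ C) {x : ℝ} (hx : x ∈ Icc (0 : ℝ) 1) :
    |g x - (g 0 + (g 1 - g 0) * x)| ≤ C := by
  obtain ⟨c, hc, hce⟩ := exists_hasDerivWithinAt_eq_sub h1
  have h3 : ∀ y ∈ Icc (0 : ℝ) 1, HasDerivWithinAt (fun x => g x - (g 0 + (g 1 - g 0) * x))
      (g1 y - (g 1 - g 0)) (Icc 0 1) y := fun y hy => by
    have := ((hasDerivWithinAt_id y (Icc 0 1)).const_mul (g 1 - g 0)).const_add (g 0)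
    exact ((h1 y hy).sub this).congr_deriv (by simp)
  have h4 := abs_sub_le_of_hasDerivWithinAt_unit h3 (C := C) (fun y hy => by
    rw [← hce]
    exact abs_sub_le_of_hasDerivWithinAt_unit h2 hC hc hy) (left_mem_Icc.2 zero_le_one) hx
  simpa using h4

namespace IntervalDiffeo

/-- The projective diffeomorphism `b x / (a + (b - a) x)` of `[0,1]`. -/
def moebius (a b : ℝ) (ha : 0 < a) (hb : 0 < b) : IntervalDiffeo :=
  rescale (g := fun x => b * x / (a + (b - a) * x)) one_pos
    (by
      refine ContDiffOn.div (by fun_prop) (by fun_prop) fun x hx => ?_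
      have : 0 < a + (b - a) * x := by
        rcases hx.2.eq_or_lt with rfl | h
        · linarith
        · nlinarith [hx.1, mul_nonneg hb.le hx.1, mul_pos ha (sub_pos.2 h)]
      exact this.ne')
    (by
      intro x hx
      have h0 : 0 < a + (b - a) * x := by
        rcases hx.2.eq_or_lt with rfl | h
        · linarith
        · nlinarith [hx.1, mul_nonneg hb.le hx.1, mul_pos ha (sub_pos.2 h)]
      refine ⟨a * b / (a + (b - a) * x) ^ 2, by positivity, ?_⟩
      have h1 := ((hasDerivAt_id x).const_mul b).div
        (((hasDerivAt_id x).const_mul (b - a)).const_add a) h0.ne'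
      refine (h1.congr_deriv ?_).hasDerivWithinAt
      simp only [id]
      congr 1
      ring)
    (by simp [hb.ne'])

variable {a b : ℝ} (ha : 0 < a) (hb : 0 < b)

include ha hb in
lemma interp_pos {x : ℝ} (hx : x ∈ Icc (0 : ℝ) 1) : 0 < a + (b - a) * x := by
  rcases hx.2.eq_or_lt with rfl | h
  · linarith
  · nlinarith [hx.1, mul_nonneg hb.le hx.1, mul_pos ha (sub_pos.2 h)]

lemma moebius_apply {x : ℝ} (hx : x ∈ Icc (0 : ℝ) 1) :
    (moebius a b ha hb).toFun x = b * x / (a + (b - a) * x) := by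
  rw [moebius, rescale_apply _ _ _ _ hx]
  simp [hb.ne']

lemma moebius_hasDeriv {x : ℝ} (hx : x ∈ Icc (0 : ℝ) 1) :
    HasDerivWithinAt (moebius a b ha hb).toFun (a * b / (a + (b - a) * x) ^ 2) (Icc 0 1) x := by
  have h1 := ((hasDerivAt_id x).const_mul b).div
    (((hasDerivAt_id x).const_mul (b - a)).const_add a) (interp_pos ha hb hx).ne'
  refine ((h1.congr_deriv ?_).hasDerivWithinAt (s := Icc 0 1)).congr
    (fun y hy => moebius_apply ha hb hy) (moebius_apply ha hb hx)
  simp only [id]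
  congr 1
  ring

lemma isMoebius_moebius : (moebius a b ha hb).IsMoebius := by
  have hr : 0 < Real.sqrt (a * b) := Real.sqrt_pos.2 (mul_pos ha hb)
  have hr2 : Real.sqrt (a * b) * Real.sqrt (a * b) = a * b :=
    Real.mul_self_sqrt (mul_pos ha hb).le
  refine ⟨b / Real.sqrt (a * b), 0, (b - a) / Real.sqrt (a * b), a / Real.sqrt (a * b), ?_,
    fun x hx => ?_⟩
  · rw [zero_mul, sub_zero, div_mul_div_comm, hr2, mul_comm b a,
      div_self (mul_pos ha hb).ne']
  · have h := interp_pos ha hb hx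
    have he : (b - a) / Real.sqrt (a * b) * x + a / Real.sqrt (a * b) =
        (a + (b - a) * x) / Real.sqrt (a * b) := by ring
    rw [he]
    refine ⟨(div_pos h hr).ne', ?_⟩
    rw [moebius_apply ha hb hx, add_zero]
    field_simp

/-- `C¹` distance from bounds on the difference of the derivatives. -/
lemma cDist_one_le (f g : IntervalDiffeo) {f1 g1 : ℝ → ℝ} {C : ℝ}
    (hf : ∀ x ∈ Icc (0 : ℝ) 1, HasDerivWithinAt f.toFun (f1 x) (Icc 0 1) x)
    (hg : ∀ x ∈ Icc (0 : ℝ) 1, HasDerivWithinAt g.toFun (g1 x) (Icc 0 1) x)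
    (hC : ∀ x ∈ Icc (0 : ℝ) 1, |f1 x - g1 x| ≤ C) : f.cDist 1 g ≤ C := by
  have hd : ∀ x ∈ Icc (0 : ℝ) 1, HasDerivWithinAt (fun x => f.toFun x - g.toFun x)
      (f1 x - g1 x) (Icc 0 1) x := fun x hx => (hf x hx).sub (hg x hx)
  refine cDist_le fun i hi x hx => ?_
  interval_cases i
  · have := abs_sub_le_of_hasDerivWithinAt_unit hd hC (left_mem_Icc.2 zero_le_one) hx
    simpa [f.map_zero, g.map_zero] using this
  · rw [iteratedDerivWithin_one, iteratedDerivWithin_one,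
      (hf x hx).derivWithin (uniqueDiffOn_Icc one_pos x hx),
      (hg x hx).derivWithin (uniqueDiffOn_Icc one_pos x hx)]
    exact hC x hx

/-- A diffeomorphism with small Schwarzian derivative is close to a projective one. -/
theorem exists_moebius_near (f : IntervalDiffeo) {s : ℝ}
    (hψ : ∀ x ∈ Icc (0 : ℝ) 1, |f.logDer x| ≤ 1) (hs : ∀ x ∈ Icc (0 : ℝ) 1, |f.schwarzian x| ≤ s) :
    ∃ g : IntervalDiffeo, g.IsMoebius ∧ f.cDist 1 g ≤ 2000 * s := by
  have hJ := f.logJet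
  have hs0 : 0 ≤ s := (abs_nonneg _).trans (hs 0 (by simp))
  -- This is `(Df)^(-1/2)`, which satisfies `G'' = -(S/2) G`: a small Schwarzian derivative makes it
  -- almost affine, and it is exactly affine for projective maps.
  let G : ℝ → ℝ := fun x => Real.exp (-(f.logDer x) / 2)
  let G1 : ℝ → ℝ := fun x => -(f.nonlin x) / 2 * G x
  have hG1 : ∀ x ∈ Icc (0 : ℝ) 1, HasDerivWithinAt G (G1 x) (Icc 0 1) x := fun x hx =>
    (((hJ.d2 x hx).neg.div_const 2).exp).congr_deriv (mul_comm _ _)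
  have hG2 : ∀ x ∈ Icc (0 : ℝ) 1, HasDerivWithinAt G1 (-(f.schwarzian x) / 2 * G x)
      (Icc 0 1) x := fun x hx => by
    refine (((hJ.d3 x hx).neg.div_const 2).mul (hG1 x hx)).congr_deriv ?_
    simp only [G1, Pi.neg_apply]
    ring
  have hexp : Real.exp (1 / 2) ≤ 2 ∧ 1 / 2 ≤ Real.exp (-(1 / 2)) := by
    have h1 : Real.exp (1 / 2) ≤ 2 := by
      have h2 : Real.exp (1 / 2) * Real.exp (1 / 2) < 4 := by
        rw [← Real.exp_add]
        norm_num
        linarith [Real.exp_one_lt_d9]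
      nlinarith [Real.exp_pos (1 / 2)]
    refine ⟨h1, ?_⟩
    rw [Real.exp_neg]
    have := inv_anti₀ (Real.exp_pos _) h1
    linarith
  have hGb : ∀ x ∈ Icc (0 : ℝ) 1, 1 / 2 ≤ G x ∧ G x ≤ 2 := fun x hx => by
    have := abs_le.1 (hψ x hx)
    exact ⟨hexp.2.trans (Real.exp_le_exp.2 (by linarith)),
      (Real.exp_le_exp.2 (by linarith)).trans hexp.1⟩
  have h0 := hGb 0 (by simp)
  have h1 := hGb 1 (by simp)
  set a := G 0 with ha
  set b := G 1 with hb
  have hclose : ∀ x ∈ Icc (0 : ℝ) 1, |G x - (a + (b - a) * x)| ≤ s := fun x hx => by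
    refine abs_sub_interpolation_le hG1 hG2 (fun y hy => ?_) hx
    rw [abs_mul, abs_div, abs_neg, abs_two, abs_of_pos (Real.exp_pos _)]
    have := hs y hy
    nlinarith [(hGb y hy).2, (hGb y hy).1, abs_nonneg (f.schwarzian y)]
  have hL : ∀ x ∈ Icc (0 : ℝ) 1, 1 / 2 ≤ a + (b - a) * x ∧ a + (b - a) * x ≤ 2 := fun x hx =>
    ⟨by nlinarith [hx.1, hx.2], by nlinarith [hx.1, hx.2]⟩
  have hinv : ∀ x ∈ Icc (0 : ℝ) 1,
      |Real.exp (f.logDer x) - 1 / (a + (b - a) * x) ^ 2| ≤ 64 * s := fun x hx => by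
    have h2 := hGb x hx
    have h3 := hL x hx
    have h4 := hclose x hx
    have h5 : Real.exp (f.logDer x) = 1 / G x ^ 2 := by
      simp only [G]
      rw [← Real.exp_nat_mul, one_div, ← Real.exp_neg]
      congr 1
      push_cast
      ring
    set u := a + (b - a) * x
    have hG0 : 0 < G x := by linarith
    have hu0 : 0 < u := by linarith
    have h6 : 1 / G x ^ 2 - 1 / u ^ 2 = -(G x - u) * ((G x + u) * ((1 / G x) ^ 2 * (1 / u) ^ 2)) := by
      field_simp
      ring
    have h7 : 1 / G x ≤ 2 := by rw [div_le_iff₀ hG0]; linarith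
    have h8 : 1 / u ≤ 2 := by rw [div_le_iff₀ hu0]; linarith
    have h9 : (1 / G x) ^ 2 ≤ 2 ^ 2 := pow_le_pow_left₀ (by positivity) h7 2
    have h10 : (1 / u) ^ 2 ≤ 2 ^ 2 := pow_le_pow_left₀ (by positivity) h8 2
    have h11 : (G x + u) * ((1 / G x) ^ 2 * (1 / u) ^ 2) ≤ 4 * (2 ^ 2 * 2 ^ 2) := by
      gcongr
      linarith
    rw [h5, h6, abs_mul, abs_neg, abs_of_nonneg (a := (G x + u) * _) (by positivity)]
    calc |G x - u| * ((G x + u) * ((1 / G x) ^ 2 * (1 / u) ^ 2))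
        ≤ s * (4 * (2 ^ 2 * 2 ^ 2)) := mul_le_mul h4 h11 (by positivity) hs0
      _ = 64 * s := by ring
  have hapos : 0 < a := by linarith
  have hbpos : 0 < b := by linarith
  -- compare with `x / (a (a + (b - a) x))`
  have hQ : ∀ x ∈ Icc (0 : ℝ) 1, HasDerivWithinAt
      (fun x => f.toFun x - (moebius a b hapos hbpos).toFun x / (a * b))
      (Real.exp (f.logDer x) - 1 / (a + (b - a) * x) ^ 2) (Icc 0 1) x := fun x hx => by
    refine ((hJ.d1 x hx).sub ((moebius_hasDeriv hapos hbpos hx).div_const (a * b))).congr_deriv ?_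
    have := interp_pos hapos hbpos hx
    field_simp
  have h2 := abs_sub_le_of_hasDerivWithinAt_unit hQ hinv (left_mem_Icc.2 zero_le_one)
    (right_mem_Icc.2 zero_le_one)
  simp only [IntervalDiffeo.map_zero, IntervalDiffeo.map_one, zero_div, sub_zero] at h2
  -- The comparison map takes the value `1 / (a * b)` at `1`, while `f 1 = 1`; the constant is `64`
  -- times the bound `4` for `a * b`.
  have h3 : |a * b - 1| ≤ 256 * s := by
    have h4 : a * b - 1 = a * b * (1 - 1 / (a * b)) := by field_simp
    rw [h4, abs_mul, abs_of_pos (mul_pos hapos hbpos)]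
    have : a * b ≤ 2 * 2 := by gcongr <;> linarith
    nlinarith [abs_nonneg (1 - 1 / (a * b))]
  refine ⟨moebius a b hapos hbpos, isMoebius_moebius hapos hbpos,
    cDist_one_le f _ hJ.d1 (fun x hx => moebius_hasDeriv hapos hbpos hx) fun x hx => ?_⟩
  have h4 := hL x hx
  -- The two terms contribute `64` and `4 · 256`, well below `2000`.
  have h5 : Real.exp (f.logDer x) - a * b / (a + (b - a) * x) ^ 2 =
      (Real.exp (f.logDer x) - 1 / (a + (b - a) * x) ^ 2) -
        (a * b - 1) * (1 / (a + (b - a) * x)) ^ 2 := by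
    generalize a + (b - a) * x = u
    ring
  have h6 : (1 / (a + (b - a) * x)) ^ 2 ≤ 2 ^ 2 := by
    refine pow_le_pow_left₀ (by have := interp_pos hapos hbpos hx; positivity) ?_ 2
    rw [div_le_iff₀ (by linarith)]
    linarith
  rw [h5]
  refine (abs_sub _ _).trans ?_
  rw [abs_mul, abs_of_nonneg (a := (1 / (a + (b - a) * x)) ^ 2) (by positivity)]
  have h7 : |a * b - 1| * (1 / (a + (b - a) * x)) ^ 2 ≤ 256 * s * 2 ^ 2 :=
    mul_le_mul h3 h6 (by positivity) (by positivity)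
  linarith [hinv x hx]

/-- Total non-linearity of a diffeomorphism of `[0,1]`. -/
def totalNonlin (f : IntervalDiffeo) : ℝ := f.logDer 1 - f.logDer 0

/-- A diffeomorphism with small Schwarzian derivative has almost constant non-linearity. -/
theorem nonlin_bounds (f : IntervalDiffeo) {s ε : ℝ} (hε0 : 0 ≤ ε) (hε : ε ≤ 1)
    (hη : ∀ x ∈ Icc (0 : ℝ) 1, |f.nonlin x| ≤ ε) (hs : ∀ x ∈ Icc (0 : ℝ) 1, |f.schwarzian x| ≤ s) :
    (∀ x ∈ Icc (0 : ℝ) 1, |f.nonlin x - f.totalNonlin| ≤ 2 * s + ε * |f.totalNonlin|) ∧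
      ∀ x ∈ Icc (0 : ℝ) 1, |f.logDer x| ≤ 2 * (|f.totalNonlin| + s) := by
  have hJ := f.logJet
  have hs0 : 0 ≤ s := (abs_nonneg _).trans (hs 0 (by simp))
  have hcont : ContinuousOn (fun x => |f.nonlin x|) (Icc 0 1) :=
    ContinuousOn.abs fun x hx => (hJ.d3 x hx).continuousWithinAt
  obtain ⟨z, hz, hmax⟩ := isCompact_Icc.exists_isMaxOn ⟨0, by simp⟩ hcont
  set M := |f.nonlin z|
  have hM : ∀ x ∈ Icc (0 : ℝ) 1, |f.nonlin x| ≤ M := fun x hx => hmax hx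
  obtain ⟨c, hc, hce⟩ := exists_hasDerivWithinAt_eq_sub hJ.d2
  have hce : f.nonlin c = f.totalNonlin := hce
  -- The total non-linearity is a value of the non-linearity, whose derivative is `S + η²/2`. One
  -- factor of `η²` is bounded by `ε`, the other by the maximum `M`, which is then absorbed.
  have h1 : ∀ x ∈ Icc (0 : ℝ) 1, |f.nonlin x - f.totalNonlin| ≤ s + ε * M / 2 := fun x hx => by
    rw [← hce]
    refine abs_sub_le_of_hasDerivWithinAt_unit hJ.d3 (fun y hy => ?_) hc hx
    refine (abs_add_le _ _).trans (add_le_add (hs y hy) ?_)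
    rw [abs_div, abs_two, abs_pow, sq]
    have := mul_le_mul (hη y hy) (hM y hy) (abs_nonneg _) hε0
    linarith
  have hM0 : 0 ≤ M := abs_nonneg _
  have h2 : M ≤ 2 * (|f.totalNonlin| + s) := by
    have h3 := h1 z hz
    have h4 : M ≤ |f.nonlin z - f.totalNonlin| + |f.totalNonlin| := by
      simpa using abs_add_le (f.nonlin z - f.totalNonlin) f.totalNonlin
    nlinarith
  refine ⟨fun x hx => (h1 x hx).trans ?_, fun x hx => ?_⟩
  · nlinarith [mul_le_mul_of_nonneg_left h2 hε0]
  -- The mean of the derivative is `1`, so its logarithm vanishes somewhere.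
  · obtain ⟨c, hc, hce⟩ := exists_hasDerivWithinAt_eq_sub hJ.d1
    rw [f.map_one, f.map_zero, sub_zero, Real.exp_eq_one_iff] at hce
    have := abs_sub_le_of_hasDerivWithinAt_unit hJ.d2 hM hc hx
    rw [hce, sub_zero] at this
    linarith

/-- `C¹` distance to the identity. -/
lemma cDist_one_id_le (f g : IntervalDiffeo) (hg : ∀ x ∈ Icc (0 : ℝ) 1, g.toFun x = x) {M : ℝ}
    (hM : M ≤ 1) (hf : ∀ x ∈ Icc (0 : ℝ) 1, |f.logDer x| ≤ M) : f.cDist 1 g ≤ 2 * M := by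
  refine cDist_one_le f g f.logJet.d1 (g1 := fun _ => 1)
    (fun x hx => (hasDerivWithinAt_id x _).congr hg (hg x hx)) fun x hx => ?_
  exact (abs_exp_sub_one_le_two_mul ((hf x hx).trans hM)).trans (by linarith [hf x hx])

/-- The jet of a diffeomorphism which is `C³`-close to the identity. -/
lemma jet_bounds (f g : IntervalDiffeo) (hg : ∀ x ∈ Icc (0 : ℝ) 1, g.toFun x = x) {ε : ℝ}
    (hε : ε ≤ 1 / 4) (hf : f.cDist 3 g ≤ ε) {x : ℝ} (hx : x ∈ Icc (0 : ℝ) 1) :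
    |f.logDer x| ≤ 2 * ε ∧ |f.nonlin x| ≤ 2 * ε ∧ |f.schwarzian x| ≤ 4 * ε := by
  have hu := uniqueDiffOn_Icc (zero_lt_one' ℝ)
  have hg1 : ∀ x ∈ Icc (0 : ℝ) 1, g.der 1 x = 1 := fun x hx => by
    refine (hu x hx).eq_deriv _ (g.hasDerivWithinAt_der (k := 0) (by norm_num) hx) ?_
    rw [der_zero]
    exact (hasDerivWithinAt_id x _).congr hg (hg x hx)
  have hg2 : ∀ x ∈ Icc (0 : ℝ) 1, g.der 2 x = 0 := fun x hx =>
    (hu x hx).eq_deriv _ (g.hasDerivWithinAt_der (k := 1) (by norm_num) hx)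
      ((hasDerivWithinAt_const x _ (1 : ℝ)).congr hg1 (hg1 x hx))
  have hg3 : g.der 3 x = 0 :=
    (hu x hx).eq_deriv _ (g.hasDerivWithinAt_der (k := 2) (by norm_num) hx)
      ((hasDerivWithinAt_const x _ (0 : ℝ)).congr hg2 (hg2 x hx))
  have key : ∀ k ≤ 3, |f.der k x - g.der k x| ≤ ε := fun k hk =>
    (abs_sub_le_cDist f g (k := 3) le_rfl hk hx).trans hf
  have h1 := key 1 (by norm_num)
  have h2 := key 2 (by norm_num)
  have h3 := key 3 (by norm_num)
  rw [hg1 x hx] at h1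
  rw [hg2 x hx, sub_zero] at h2
  rw [hg3, sub_zero] at h3
  have hε0 : 0 ≤ ε := (abs_nonneg _).trans h1
  have h1' := abs_le.1 h1
  have hpos := f.der_one_pos hx
  have hinv : 1 / f.der 1 x ≤ 4 / 3 := by
    rw [div_le_iff₀ hpos]
    linarith
  have hη : |f.nonlin x| ≤ 4 / 3 * ε := by
    rw [nonlin, div_eq_mul_one_div, abs_mul, abs_of_pos (one_div_pos.2 hpos)]
    have := mul_le_mul h2 hinv (one_div_pos.2 hpos).le hε0
    linarith
  refine ⟨?_, hη.trans (by linarith), ?_⟩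
  · rw [logDer, abs_le]
    constructor
    · have h4 := Real.one_sub_inv_le_log_of_pos hpos
      have h5 : (f.der 1 x)⁻¹ ≤ 1 + 2 * ε := by
        rw [inv_eq_one_div, div_le_iff₀ hpos]
        nlinarith
      linarith
    · linarith [Real.log_le_sub_one_of_pos hpos]
  · have h4 : |f.der 3 x / f.der 1 x| ≤ 4 / 3 * ε := by
      rw [div_eq_mul_one_div, abs_mul, abs_of_pos (one_div_pos.2 hpos)]
      have := mul_le_mul h3 hinv (one_div_pos.2 hpos).le hε0
      linarith
    have h5 : |3 / 2 * (f.der 2 x / f.der 1 x) ^ 2| ≤ 3 / 2 * (4 / 3 * ε) ^ 2 := by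
      rw [abs_mul, abs_pow, abs_of_pos (by norm_num : (0 : ℝ) < 3 / 2)]
      exact mul_le_mul_of_nonneg_left (pow_le_pow_left₀ (abs_nonneg _) hη 2) (by norm_num)
    rw [schwarzian]
    refine (abs_sub _ _).trans ?_
    nlinarith

end IntervalDiffeo

/-! ### How inducing transforms Schwarzians, non-linearities, slopes and lengths. -/

namespace GIET

variable {d : ℕ} {σ : Equiv.Perm (Fin d)} {T T' : GIET σ} {N : Fin d → ℕ} {w : Fin d → ℕ → Fin d}
  {X : ℝ}

/-- Length of the `s`-th floor of the `i`-th tower. -/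
def floorLength (T T' : GIET σ) (w : Fin d → ℕ → Fin d) (X : ℝ) (i : Fin d) (s : ℕ) : ℝ :=
  T.word (w i) s (X * T'.topCut (i + 1)) - T.word (w i) s (X * T'.topCut i)

namespace IsInduced

lemma mem_of_mem (h : IsInduced T T' N w X) {i : Fin d} {s : ℕ} (hs : s < N i) {z : ℝ}
    (hz : z ∈ Icc (X * T'.topCut i) (X * T'.topCut (i + 1))) :
    T.word (w i) s z ∈ Icc (T.topCut (w i s)) (T.topCut (w i s + 1)) := by
  have h1 := h.mem i s hs (z / X) ⟨by rw [le_div_iff₀' h.pos]; exact hz.1,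
    by rw [div_le_iff₀' h.pos]; exact hz.2⟩
  rwa [mul_div_cancel₀ _ h.pos.ne'] at h1

lemma jet (h : IsInduced T T' N w X) {i : Fin d} {n : ℕ} (hn : n ≤ N i) :
    LogJet (T.word (w i) n) (T.wordLogDer (w i) n) (T.wordNonlin (w i) n)
      (T.wordSchwarzian (w i) n) (Icc (X * T'.topCut i) (X * T'.topCut (i + 1))) :=
  T.word_logJet (w i) fun _ hm _ hz => h.mem_of_mem (hm.trans_le hn) hz

lemma cut_lt (h : IsInduced T T' N w X) (i : Fin d) :
    X * T'.topCut i < X * T'.topCut (i + 1) :=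
  mul_lt_mul_of_pos_left (T'.topCut_lt (Nat.lt_succ_self _) i.2) h.pos

lemma point_mem (h : IsInduced T T' N w X) {i : Fin d} {z : ℝ} (hz : z ∈ Icc (0 : ℝ) 1) :
    X * T'.top i * z + X * T'.topCut i ∈ Icc (X * T'.topCut i) (X * T'.topCut (i + 1)) := by
  have h1 : 0 < X * T'.top i := mul_pos h.pos (T'.top_pos i)
  rw [topCut_succ]
  exact ⟨by nlinarith [hz.1], by nlinarith [hz.2]⟩

/-- The jet of the rescaled branches of the induced map. -/
lemma jet_eq (h : IsInduced T T' N w X) (i : Fin d) {z : ℝ} (hz : z ∈ Icc (0 : ℝ) 1) :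
    (T'.φ i).logDer z + T'.logSlope i =
        T.wordLogDer (w i) (N i) (X * T'.top i * z + X * T'.topCut i) ∧
      (T'.φ i).schwarzian z =
        T.wordSchwarzian (w i) (N i) (X * T'.top i * z + X * T'.topCut i) *
          (X * T'.top i) ^ 2 := by
  have ht := T'.top_pos i
  have hb := T'.bot_pos (σ i)
  have hXt : 0 < X * T'.top i := mul_pos h.pos ht
  have h1 := (h.jet (i := i) le_rfl).comp (LogJet.affine hXt (X * T'.topCut i) (Icc 0 1))
    fun z hz => h.point_mem hz
  have h2 := (LogJet.affine (mul_pos h.pos hb) (X * T'.botCut (σ i)) univ).comp (T'.φ i).logJet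
    (mapsTo_univ _ _)
  have he : ∀ z ∈ Icc (0 : ℝ) 1, X * T'.bot (σ i) * (T'.φ i).toFun z + X * T'.botCut (σ i) =
      T.word (w i) (N i) (X * T'.top i * z + X * T'.topCut i) := fun z hz => by
    have h3 := h.conj i (T'.top i * z + T'.topCut i) (by
      rw [topCut_succ]
      exact ⟨by nlinarith [hz.1], by nlinarith [hz.2]⟩)
    rw [branch_apply, add_sub_cancel_right, mul_div_cancel_left₀ _ ht.ne'] at h3
    rw [show X * T'.top i * z + X * T'.topCut i = X * (T'.top i * z + T'.topCut i) by ring, h3]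
    ring
  obtain ⟨e1, -, e3⟩ := LogJet.unique one_pos (h1.congr he (fun _ _ => rfl) (fun _ _ => rfl)
    fun _ _ => rfl) h2 hz
  simp only [Real.exp_log hXt, add_zero, zero_mul, zero_add] at e1 e3
  refine ⟨?_, e3.symm⟩
  rw [Real.log_mul h.pos.ne' ht.ne', Real.log_mul h.pos.ne' hb.ne'] at e1
  rw [logSlope, Real.log_div hb.ne' ht.ne']
  linarith

/-- Telescoping over the floors of all towers. -/
lemma sum_floors (h : IsInduced T T' N w X) (f : Fin d → ℝ → ℝ) :
    ∑ i : Fin d, ∑ s ∈ Finset.range (N i),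
      (f (w i s) (T.word (w i) s (X * T'.topCut (i + 1))) -
        f (w i s) (T.word (w i) s (X * T'.topCut i))) =
      ∑ j : Fin d, (f j (T.topCut (j + 1)) - f j (T.topCut j)) := by
  simp_rw [← h.tiling _ (f _)]
  rw [Finset.sum_comm]
  refine Finset.sum_congr rfl fun i _ => ?_
  rw [← Finset.sum_fiberwise (Finset.range (N i)) (w i)]
  refine Finset.sum_congr rfl fun j _ => Finset.sum_congr rfl fun s hs => ?_
  rw [(Finset.mem_filter.1 hs).2]

lemma sum_mul_floorLength (h : IsInduced T T' N w X) (c : Fin d → ℝ) :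
    ∑ i : Fin d, ∑ s ∈ Finset.range (N i), c (w i s) * floorLength T T' w X i s =
      ∑ j : Fin d, c j * T.top j := by
  have h1 := h.sum_floors fun j x => c j * x
  simp only [← mul_sub] at h1
  refine h1.trans (Finset.sum_congr rfl fun j _ => ?_)
  rw [topCut_succ, add_sub_cancel_left]

/-- Distortion bound. -/
lemma abs_wordLogDer_le (h : IsInduced T T' N w X) {δ : ℝ}
    (hφ : ∀ j, ∀ x ∈ Icc (0 : ℝ) 1, |(T.φ j).logDer x| ≤ δ) (hL : ∀ j, |T.logSlope j| ≤ δ)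
    {i : Fin d} {n : ℕ} (hn : n ≤ N i) {z : ℝ}
    (hz : z ∈ Icc (X * T'.topCut i) (X * T'.topCut (i + 1))) :
    |T.wordLogDer (w i) n z| ≤ 2 * δ * N i := by
  have hδ : 0 ≤ δ := (abs_nonneg _).trans (hL i)
  have h1 : ∀ s ∈ Finset.range n, |T.branchLogDer (w i s) (T.word (w i) s z)| ≤ 2 * δ := by
    intro s hs
    have h2 := T.coord_mem (h.mem_of_mem ((Finset.mem_range.1 hs).trans_le hn) hz)
    refine (abs_add_le _ _).trans ?_
    linarith [hφ (w i s) _ h2, hL (w i s)]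
  refine (Finset.abs_sum_le_sum_abs _ _).trans ((Finset.sum_le_sum h1).trans ?_)
  rw [Finset.sum_const, Finset.card_range, nsmul_eq_mul, mul_comm]
  exact mul_le_mul_of_nonneg_left (by exact_mod_cast hn) (by positivity)

lemma floorLength_bounds (h : IsInduced T T' N w X) {δ : ℝ}
    (hφ : ∀ j, ∀ x ∈ Icc (0 : ℝ) 1, |(T.φ j).logDer x| ≤ δ) (hL : ∀ j, |T.logSlope j| ≤ δ)
    {i : Fin d} {n : ℕ} (hn : n ≤ N i) :
    Real.exp (-(2 * δ * N i)) * (X * T'.top i) ≤ floorLength T T' w X i n ∧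
      floorLength T T' w X i n ≤ Real.exp (2 * δ * N i) * (X * T'.top i) := by
  have h1 := (h.jet hn).slope_bounds
    (fun z hz => (abs_le.1 (h.abs_wordLogDer_le hφ hL hn hz)).1)
    (fun z hz => (abs_le.1 (h.abs_wordLogDer_le hφ hL hn hz)).2)
    (left_mem_Icc.2 (h.cut_lt i).le) (right_mem_Icc.2 (h.cut_lt i).le) (h.cut_lt i).le
  rwa [show X * T'.topCut (i + 1) - X * T'.topCut i = X * T'.top i by
    rw [topCut_succ]; ring] at h1

/-- The weighted Schwarzian derivative is contracted by inducing. -/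
theorem schwarzian_contraction (h : IsInduced T T' N w X) {δ κ : ℝ} {q : Fin d → ℝ}
    (hφ : ∀ j, ∀ x ∈ Icc (0 : ℝ) 1, |(T.φ j).logDer x| ≤ δ) (hL : ∀ j, |T.logSlope j| ≤ δ)
    (hκ : ∀ i, 2 * δ * N i ≤ κ) (hq : ∀ j, ∀ x ∈ Icc (0 : ℝ) 1,
      |(T.φ j).schwarzian x| ≤ T.top j * q j) :
    ∃ q' : Fin d → ℝ, (∀ i, ∀ x ∈ Icc (0 : ℝ) 1, |(T'.φ i).schwarzian x| ≤ T'.top i * q' i) ∧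
      ∑ i, q' i ≤ X * Real.exp (3 * κ) * ∑ j, q j := by
  have hX := h.pos
  have hq0 : ∀ j, 0 ≤ q j := fun j =>
    nonneg_of_mul_nonneg_right ((abs_nonneg _).trans (hq j 0 (by simp))) (T.top_pos j)
  -- Dividing the Schwarzian by the length leaves one factor of floor length in each term; since
  -- floors tile, the sum over the towers recovers `∑ q j` and a factor `X` is gained. Distortion
  -- costs `exp κ` three times: twice for the squared derivative, once to replace `X * T'.top i` by
  -- the floor length.
  refine ⟨fun i => ∑ s ∈ Finset.range (N i),
    X * Real.exp κ ^ 2 * (q (w i s) / T.top (w i s) * (X * T'.top i)), fun i x hx => ?_, ?_⟩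
  · have ht := T'.top_pos i
    have hz := h.point_mem (i := i) hx
    set z := X * T'.top i * x + X * T'.topCut i
    rw [(h.jet_eq i hx).2, wordSchwarzian, Finset.sum_mul, Finset.mul_sum]
    refine (Finset.abs_sum_le_sum_abs _ _).trans (Finset.sum_le_sum fun s hs => ?_)
    have hs' := Finset.mem_range.1 hs
    have htw := T.top_pos (w i s)
    have h1 := hq (w i s) _ (T.coord_mem (h.mem_of_mem hs' hz))
    have h2 : Real.exp (T.wordLogDer (w i) s z) ^ 2 ≤ Real.exp κ ^ 2 :=
      pow_le_pow_left₀ (Real.exp_pos _).le (Real.exp_le_exp.2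
        ((le_abs_self _).trans ((h.abs_wordLogDer_le hφ hL hs'.le hz).trans (hκ i)))) 2
    rw [abs_mul, abs_mul, abs_div, abs_of_pos (pow_pos htw 2),
      abs_of_pos (pow_pos (Real.exp_pos _) 2), abs_of_pos (pow_pos (mul_pos hX ht) 2)]
    calc _ ≤ T.top (w i s) * q (w i s) / T.top (w i s) ^ 2 * Real.exp κ ^ 2 *
          (X * T'.top i) ^ 2 := by gcongr; exact div_nonneg (mul_nonneg htw.le (hq0 _)) (by positivity)
      _ = _ := by field_simp
  · have h1 : ∀ i, ∀ s ∈ Finset.range (N i),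
        X * Real.exp κ ^ 2 * (q (w i s) / T.top (w i s) * (X * T'.top i)) ≤
          X * Real.exp (3 * κ) * (q (w i s) / T.top (w i s) * floorLength T T' w X i s) := by
      intro i s hs
      have h2 := (h.floorLength_bounds hφ hL (Finset.mem_range.1 hs).le).1
      have h3 : X * T'.top i ≤ Real.exp κ * floorLength T T' w X i s := by
        have h4 : Real.exp (-κ) * (X * T'.top i) ≤ floorLength T T' w X i s :=
          (mul_le_mul_of_nonneg_right (Real.exp_le_exp.2 (by linarith [hκ i]))
            (mul_pos hX (T'.top_pos i)).le).trans h2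
        have h5 := mul_le_mul_of_nonneg_left h4 (Real.exp_pos κ).le
        rwa [← mul_assoc, ← Real.exp_add, add_neg_cancel, Real.exp_zero, one_mul] at h5
      have h4 : 0 ≤ q (w i s) / T.top (w i s) := div_nonneg (hq0 _) (T.top_pos _).le
      calc _ ≤ X * Real.exp κ ^ 2 * (q (w i s) / T.top (w i s) *
            (Real.exp κ * floorLength T T' w X i s)) := by gcongr
        _ = _ := by
          rw [show Real.exp (3 * κ) = Real.exp κ ^ 3 by
            rw [← Real.exp_nat_mul]; norm_num]
          ring
    refine (Finset.sum_le_sum fun i _ => Finset.sum_le_sum (h1 i)).trans (le_of_eq ?_)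
    simp only [← Finset.mul_sum]
    rw [h.sum_mul_floorLength fun j => q j / T.top j]
    congr 1
    exact Finset.sum_congr rfl fun j _ => div_mul_cancel₀ _ (T.top_pos j).ne'

/-- The logarithm of the derivative is additive along the word, and the slope constants cancel
between the two ends. -/
lemma totalNonlin_eq (h : IsInduced T T' N w X) (i : Fin d) :
    (T'.φ i).totalNonlin = ∑ s ∈ Finset.range (N i),
      (T.branchLogDer (w i s) (T.word (w i) s (X * T'.topCut (i + 1))) -
        T.branchLogDer (w i s) (T.word (w i) s (X * T'.topCut i))) := by
  have h0 := (h.jet_eq i (left_mem_Icc.2 zero_le_one)).1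
  have h1 := (h.jet_eq i (right_mem_Icc.2 zero_le_one)).1
  rw [mul_zero, zero_add] at h0
  rw [mul_one, show X * T'.top i + X * T'.topCut i = X * T'.topCut (i + 1) by
    rw [topCut_succ]; ring] at h1
  rw [Finset.sum_sub_distrib, ← wordLogDer, ← wordLogDer, ← h0, ← h1,
    IntervalDiffeo.totalNonlin]
  ring

/-- The total non-linearity is invariant. -/
theorem sum_totalNonlin (h : IsInduced T T' N w X) :
    ∑ i, (T'.φ i).totalNonlin = ∑ j, (T.φ j).totalNonlin := by
  simp_rw [h.totalNonlin_eq]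
  rw [h.sum_floors T.branchLogDer]
  refine Finset.sum_congr rfl fun j _ => ?_
  have ht := (T.top_pos j).ne'
  rw [branchLogDer, branchLogDer, coord, coord, topCut_succ, sub_self, add_sub_cancel_left,
    zero_div, div_self ht, IntervalDiffeo.totalNonlin]
  ring

/-- The non-linearities are transformed almost linearly. -/
theorem abs_totalNonlin_sub_le (h : IsInduced T T' N w X) {ε s₀ : ℝ} {B : Fin d → Fin d → ℝ}
    (hη : ∀ j, ∀ x ∈ Icc (0 : ℝ) 1, |(T.φ j).nonlin x - (T.φ j).totalNonlin| ≤
      2 * s₀ + ε * |(T.φ j).totalNonlin|)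
    (hB : ∀ i, ∀ s < N i, |floorLength T T' w X i s / T.top (w i s) - B i (w i s)| ≤ ε)
    (i : Fin d) :
    |(T'.φ i).totalNonlin - ∑ s ∈ Finset.range (N i), B i (w i s) * (T.φ (w i s)).totalNonlin| ≤
      N i * (2 * s₀ + 2 * ε * ∑ j, |(T.φ j).totalNonlin|) := by
  rw [h.totalNonlin_eq, ← Finset.sum_sub_distrib]
  refine (Finset.abs_sum_le_sum_abs _ _).trans ?_
  have key : ∀ s ∈ Finset.range (N i),
      |T.branchLogDer (w i s) (T.word (w i) s (X * T'.topCut (i + 1))) -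
        T.branchLogDer (w i s) (T.word (w i) s (X * T'.topCut i)) -
        B i (w i s) * (T.φ (w i s)).totalNonlin| ≤
      2 * s₀ + 2 * ε * ∑ j, |(T.φ j).totalNonlin| := by
    intro s hs
    have hs := Finset.mem_range.1 hs
    set j := w i s
    have ht := T.top_pos j
    have hx := T.coord_mem (h.mem_of_mem hs (left_mem_Icc.2 (h.cut_lt i).le))
    have hy := T.coord_mem (h.mem_of_mem hs (right_mem_Icc.2 (h.cut_lt i).le))
    set x := T.coord j (T.word (w i) s (X * T'.topCut i)) with hx'
    set y := T.coord j (T.word (w i) s (X * T'.topCut (i + 1))) with hy'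
    have hxy : y - x = floorLength T T' w X i s / T.top j := by
      rw [hx', hy', coord, coord, floorLength]
      ring
    have h1 : ∀ z ∈ Icc (0 : ℝ) 1, HasDerivWithinAt
        (fun z => (T.φ j).logDer z - (T.φ j).totalNonlin * z)
        ((T.φ j).nonlin z - (T.φ j).totalNonlin) (Icc 0 1) z := fun z hz =>
      (((T.φ j).logJet.d2 z hz).sub
        ((hasDerivWithinAt_id z (Icc 0 1)).const_mul _)).congr_deriv (by ring)
    have h2 := abs_sub_le_of_hasDerivWithinAt_unit h1 (hη j) hx hy
    have hn : |(T.φ j).totalNonlin| ≤ ∑ j, |(T.φ j).totalNonlin| :=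
      Finset.single_le_sum (f := fun j => |(T.φ j).totalNonlin|) (fun _ _ => abs_nonneg _)
        (Finset.mem_univ j)
    have hε : 0 ≤ ε := (abs_nonneg _).trans (hB i s hs)
    -- Two sources of error: the deviation of the logarithmic derivative from a linear function, and
    -- that of the relative floor length from `B`.
    have h3 : T.branchLogDer j (T.word (w i) s (X * T'.topCut (i + 1))) -
        T.branchLogDer j (T.word (w i) s (X * T'.topCut i)) - B i j * (T.φ j).totalNonlin =
        ((T.φ j).logDer y - (T.φ j).totalNonlin * y -
          ((T.φ j).logDer x - (T.φ j).totalNonlin * x)) +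
        (floorLength T T' w X i s / T.top j - B i j) * (T.φ j).totalNonlin := by
      rw [← hxy, branchLogDer, branchLogDer]
      ring
    rw [h3]
    refine (abs_add_le _ _).trans ?_
    rw [abs_mul]
    have h4 := mul_le_mul (hB i s hs) hn (abs_nonneg _) hε
    have h5 := mul_le_mul_of_nonneg_left hn hε
    linarith
  refine (Finset.sum_le_sum key).trans ?_
  rw [Finset.sum_const, Finset.card_range, nsmul_eq_mul]

/-- The logarithms of the slopes are transformed almost linearly. -/
theorem abs_logSlope_sub_le (h : IsInduced T T' N w X) {M : ℝ}
    (hφ : ∀ j, ∀ x ∈ Icc (0 : ℝ) 1, |(T.φ j).logDer x| ≤ M)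
    (hφ' : ∀ j, ∀ x ∈ Icc (0 : ℝ) 1, |(T'.φ j).logDer x| ≤ M) (i : Fin d) :
    |T'.logSlope i - ∑ s ∈ Finset.range (N i), T.logSlope (w i s)| ≤ (N i + 1) * M := by
  have h0 := (h.jet_eq i (left_mem_Icc.2 zero_le_one)).1
  rw [mul_zero, zero_add, wordLogDer] at h0
  simp only [branchLogDer, Finset.sum_add_distrib] at h0
  have h1 : |∑ s ∈ Finset.range (N i),
      (T.φ (w i s)).logDer (T.coord (w i s) (T.word (w i) s (X * T'.topCut i)))| ≤ N i * M := by
    refine (Finset.abs_sum_le_sum_abs _ _).trans ((Finset.sum_le_sum fun s hs => hφ (w i s) _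
      (T.coord_mem (h.mem_of_mem (Finset.mem_range.1 hs) (left_mem_Icc.2 (h.cut_lt i).le)))).trans ?_)
    rw [Finset.sum_const, Finset.card_range, nsmul_eq_mul]
  have h2 := hφ' i 0 (by simp)
  rw [abs_le] at *
  constructor <;> linarith

/-- The lengths are transformed almost linearly. -/
theorem abs_top_sub_le (h : IsInduced T T' N w X) (hX1 : X ≤ 1) {δ κ : ℝ} (hκ1 : κ ≤ 1)
    (hφ : ∀ j, ∀ x ∈ Icc (0 : ℝ) 1, |(T.φ j).logDer x| ≤ δ) (hL : ∀ j, |T.logSlope j| ≤ δ)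
    (hκ : ∀ i, 2 * δ * N i ≤ κ) (j : Fin d) :
    |T.top j - X * ∑ i, ((Finset.range (N i)).filter (fun s => w i s = j)).card * T'.top i| ≤
      2 * κ * ∑ i, (N i : ℝ) := by
  have h1 := h.tiling j id
  simp only [id, topCut_succ, add_sub_cancel_left] at h1
  have hδ : 0 ≤ δ := (abs_nonneg _).trans (hL j)
  have hκ0 : 0 ≤ κ := le_trans (by positivity) (hκ j)
  have h2 : X * ∑ i, (((Finset.range (N i)).filter (fun s => w i s = j)).card : ℝ) * T'.top i =
      ∑ i, ∑ s ∈ (Finset.range (N i)).filter (fun s => w i s = j), X * T'.top i := by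
    rw [Finset.mul_sum]
    refine Finset.sum_congr rfl fun i _ => ?_
    rw [Finset.sum_const, nsmul_eq_mul]
    ring
  rw [h2, ← h1, ← Finset.sum_sub_distrib, Finset.mul_sum]
  refine (Finset.abs_sum_le_sum_abs _ _).trans (Finset.sum_le_sum fun i _ => ?_)
  rw [← Finset.sum_sub_distrib]
  have key : ∀ s ∈ (Finset.range (N i)).filter (fun s => w i s = j),
      |T.word (w i) s (X * (T'.topCut i + T'.top i)) - T.word (w i) s (X * T'.topCut i) -
        X * T'.top i| ≤ 2 * κ := by
    intro s hs
    have hs := Finset.mem_range.1 (Finset.mem_filter.1 hs).1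
    have h3 := h.floorLength_bounds hφ hL hs.le
    rw [floorLength, topCut_succ] at h3
    have h4 : 0 < X * T'.top i := mul_pos h.pos (T'.top_pos i)
    have h5 : X * T'.top i ≤ 1 := by
      have h6 : T'.top i ≤ 1 := by
        rw [← T'.sum_top]
        exact Finset.single_le_sum (fun k _ => (T'.top_pos k).le) (Finset.mem_univ i)
      exact mul_le_one₀ hX1 (T'.top_pos i).le h6
    have hm0 : 0 ≤ 2 * δ * (N i : ℝ) := by positivity
    have hm1 : |2 * δ * (N i : ℝ)| ≤ 1 := by rw [abs_of_nonneg hm0]; exact (hκ i).trans hκ1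
    have h6 := abs_le.1 (abs_exp_sub_one_le_two_mul hm1)
    have h7 := abs_le.1 (abs_exp_sub_one_le_two_mul (x := -(2 * δ * N i)) (by rwa [abs_neg]))
    rw [abs_neg] at h7
    rw [abs_of_nonneg hm0] at h6 h7
    have h8 := hκ i
    rw [abs_le]
    constructor
    · nlinarith [h3.1]
    · nlinarith [h3.2]
  refine (Finset.abs_sum_le_sum_abs _ _).trans ((Finset.sum_le_sum key).trans ?_)
  rw [Finset.sum_const, nsmul_eq_mul, mul_comm]
  refine mul_le_mul_of_nonneg_left ?_ (by positivity)
  exact_mod_cast (Finset.card_filter_le _ _).trans (Finset.card_range _).le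

end IsInduced

end GIET

/-! ### The integral of the non-linearity. -/

namespace GIET

variable {d : ℕ} {σ : Equiv.Perm (Fin d)}

lemma hasDerivAt_map (T : GIET σ) {j : Fin d} {x : ℝ}
    (hx : x ∈ Ioo (T.topCut j) (T.topCut (j + 1))) :
    HasDerivAt T.map (Real.exp (T.branchLogDer j x)) x := by
  have h1 := ((T.branch_logJet j).d1 x (Ioo_subset_Icc_self hx)).hasDerivAt
    (Icc_mem_nhds hx.1 hx.2)
  refine h1.congr_of_eventuallyEq ?_
  filter_upwards [Ioo_mem_nhds hx.1 hx.2] with y hy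
  exact T.map_eq_branch (Ioo_subset_Ico_self hy)

lemma hasDerivAt_branchLogDer (T : GIET σ) {j : Fin d} {x : ℝ}
    (hx : x ∈ Ioo (T.topCut j) (T.topCut (j + 1))) :
    HasDerivAt (T.branchLogDer j) ((T.φ j).nonlin (T.coord j x) / T.top j) x :=
  ((T.branch_logJet j).d2 x (Ioo_subset_Icc_self hx)).hasDerivAt (Icc_mem_nhds hx.1 hx.2)

lemma nonlinearity_eq (T : GIET σ) {j : Fin d} {x : ℝ}
    (hx : x ∈ Ioo (T.topCut j) (T.topCut (j + 1))) :
    T.nonlinearity x = (T.φ j).nonlin (T.coord j x) / T.top j := by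
  rw [nonlinearity, ← (T.hasDerivAt_branchLogDer hx).deriv]
  refine Filter.EventuallyEq.deriv_eq ?_
  filter_upwards [Ioo_mem_nhds hx.1 hx.2] with y hy
  rw [(T.hasDerivAt_map hy).deriv, Real.log_exp]

/-- The integral of the non-linearity is the sum of the total non-linearities of the branches. -/
theorem totalNonlinearity_eq (T : GIET σ) :
    T.totalNonlinearity = ∑ j, (T.φ j).totalNonlin := by
  have hlt : ∀ j : Fin d, T.topCut j < T.topCut (j + 1) := fun j =>
    T.topCut_lt (Nat.lt_succ_self _) j.2
  have hint : ∀ j : Fin d,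
      IntervalIntegrable T.nonlinearity MeasureTheory.volume (T.topCut j) (T.topCut (j + 1)) := by
    intro j
    have h1 : ContinuousOn (fun x => (T.φ j).nonlin (T.coord j x) / T.top j)
        (uIcc (T.topCut j) (T.topCut (j + 1))) := by
      rw [uIcc_of_le (hlt j).le]
      exact fun x hx => ((T.branch_logJet j).d3 x hx).continuousWithinAt
    refine h1.intervalIntegrable.congr_uIoo fun x hx => ?_
    rw [uIoo_of_le (hlt j).le] at hx
    exact (T.nonlinearity_eq hx).symm
  have hval : ∀ j : Fin d, ∫ x in (T.topCut j)..(T.topCut (j + 1)), T.nonlinearity x =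
      (T.φ j).totalNonlin := by
    intro j
    rw [intervalIntegral.integral_eq_sub_of_hasDerivAt_of_le (hlt j).le
      (f := T.branchLogDer j) (fun x hx => ((T.branch_logJet j).d2 x hx).continuousWithinAt)
      (fun x hx => by rw [T.nonlinearity_eq hx]; exact T.hasDerivAt_branchLogDer hx) (hint j)]
    have ht := (T.top_pos j).ne'
    rw [branchLogDer, branchLogDer, coord, coord, topCut_succ, sub_self, add_sub_cancel_left,
      zero_div, div_self ht, IntervalDiffeo.totalNonlin]
    ring
  have h1 := intervalIntegral.sum_integral_adjacent_intervals (f := T.nonlinearity)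
    (μ := MeasureTheory.volume) (a := T.topCut) (n := d) fun k hk => hint ⟨k, hk⟩
  rw [topCut_zero, topCut_last] at h1
  rw [totalNonlinearity, ← h1, ← Fin.sum_univ_eq_sum_range
    (fun k => ∫ x in (T.topCut k)..(T.topCut (k + 1)), T.nonlinearity x) d]
  exact Finset.sum_congr rfl fun j _ => hval j

end GIET

/-! ### Perturbed scalar recursions, forwards and backwards. -/

/-- A forward perturbed contraction decays exponentially. -/
lemma exists_forward_bound {r θ ρ : ℝ} (hr : 0 ≤ r) (hrρ : r < ρ) (hθ : 0 ≤ θ) (hθρ : θ ≤ ρ)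
    {a : ℕ → ℝ} {C : ℝ} (hC : 0 ≤ C) (h : ∀ n, a (n + 1) ≤ r * a n + C * θ ^ n) :
    ∃ D, ∀ n, a n ≤ D * ρ ^ n := by
  have hpos : 0 < ρ - r := sub_pos.2 hrρ
  refine ⟨max (a 0) (C / (ρ - r)), fun n => ?_⟩
  set D := max (a 0) (C / (ρ - r))
  have hD : C ≤ D * (ρ - r) := (div_le_iff₀ hpos).1 (le_max_right _ _)
  induction n with
  | zero =>
    rw [pow_zero, mul_one]
    exact le_max_left _ _
  | succ n ih =>
    have h1 : θ ^ n ≤ ρ ^ n := pow_le_pow_left₀ hθ hθρ n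
    have h2 : 0 ≤ ρ ^ n := (pow_nonneg hθ n).trans h1
    calc a (n + 1) ≤ r * a n + C * θ ^ n := h n
      _ ≤ r * (D * ρ ^ n) + C * ρ ^ n := by gcongr
      _ ≤ r * (D * ρ ^ n) + D * (ρ - r) * ρ ^ n := by gcongr
      _ = D * ρ ^ (n + 1) := by ring

/-- A bounded backward perturbed contraction decays exponentially. -/
lemma backward_bound {r θ : ℝ} (hr : 0 ≤ r) (hr1 : r < 1) (hθ : 0 < θ) (hθ1 : θ ≤ 1)
    {Q : ℕ → ℝ → Prop} (hQ : ∀ n m m', m ≤ m' → Q n m → Q n m') {C M : ℝ} (hC : 0 ≤ C)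
    (hM : ∀ n, Q n M) (h : ∀ n m, Q (n + 1) m → Q n (r * m + C * θ ^ n)) (n : ℕ) :
    Q n ((C / (1 - r) + 1) * θ ^ n) := by
  have hpos : 0 < 1 - r := sub_pos.2 hr1
  have key : ∀ k n, Q n (r ^ k * M + C / (1 - r) * θ ^ n) := by
    intro k
    induction k with
    | zero =>
      intro n
      have : 0 ≤ C / (1 - r) * θ ^ n := by positivity
      exact hQ n M _ (by linarith) (hM n)
    | succ k ih =>
      intro n
      have h1 : θ ^ (n + 1) ≤ θ ^ n := pow_le_pow_of_le_one hθ.le hθ1 (Nat.le_succ n)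
      refine hQ n _ _ ?_ (h n _ (ih (n + 1)))
      calc r * (r ^ k * M + C / (1 - r) * θ ^ (n + 1)) + C * θ ^ n
          ≤ r * (r ^ k * M + C / (1 - r) * θ ^ n) + C * θ ^ n := by gcongr
        _ = r ^ (k + 1) * M + (r * (C / (1 - r)) + C) * θ ^ n := by ring
        _ = r ^ (k + 1) * M + C / (1 - r) * θ ^ n := by
          congr 2
          field_simp
          ring
  have hlim : Tendsto (fun k => r ^ k * M) atTop (𝓝 (0 * M)) :=
    (tendsto_pow_atTop_nhds_zero_of_lt_one hr hr1).mul_const M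
  rw [zero_mul] at hlim
  obtain ⟨k, hk⟩ := (hlim.eventually (gt_mem_nhds (pow_pos hθ n))).exists
  exact hQ n _ _ (by linarith) (key k n)

/-! ### Bounded perturbed orbits of a hyperbolic matrix. -/

section Hyperbolic

/-- Bounded perturbed orbits of multiplication by a number off the unit circle decay. -/
lemma exists_rate_scalar {V : Type*} [NormedAddCommGroup V] [NormedSpace ℂ V] {z : ℂ}
    (hz : ‖z‖ ≠ 1) {θ : ℝ} (hθ : 0 < θ) (hθ1 : θ < 1) :
    ∃ ρ, θ ≤ ρ ∧ ρ < 1 ∧ ∀ y e : ℕ → V, (∀ n, y (n + 1) = z • y n + e n) →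
      (∃ M, ∀ n, ‖y n‖ ≤ M) → (∃ C, ∀ n, ‖e n‖ ≤ C * θ ^ n) → ∃ D, ∀ n, ‖y n‖ ≤ D * ρ ^ n := by
  rcases lt_or_gt_of_ne hz with h | h
  · obtain ⟨ρ, h1, h2⟩ := exists_between (max_lt h hθ1)
    refine ⟨ρ, (le_max_right _ _).trans h1.le, h2, fun y e hy _ ⟨C, hC⟩ => ?_⟩
    have hC0 : 0 ≤ C := by simpa using (norm_nonneg _).trans (hC 0)
    refine exists_forward_bound (norm_nonneg z) ((le_max_left _ _).trans_lt h1) hθ.le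
      ((le_max_right _ _).trans h1.le) hC0 fun n => ?_
    rw [hy n]
    refine (norm_add_le _ _).trans ?_
    rw [norm_smul]
    linarith [hC n]
  · refine ⟨θ, le_rfl, hθ1, fun y e hy ⟨M, hM⟩ ⟨C, hC⟩ => ?_⟩
    have hz0 : 0 < ‖z‖ := one_pos.trans h
    have hC0 : 0 ≤ C := by simpa using (norm_nonneg _).trans (hC 0)
    -- For an expanding multiplier boundedness allows the recursion to be solved from the future.
    refine ⟨_, backward_bound (Q := fun n m => ‖y n‖ ≤ m) (r := ‖z‖⁻¹) (C := ‖z‖⁻¹ * C) (M := M)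
      (by positivity) (inv_lt_one_of_one_lt₀ h) hθ hθ1.le (fun n m m' h1 h2 => h2.trans h1)
      (by positivity) hM fun n m hm => ?_⟩
    have h1 : ‖z‖ * ‖y n‖ ≤ ‖y (n + 1)‖ + ‖e n‖ := by
      rw [← norm_smul, show z • y n = y (n + 1) - e n by rw [hy n]; abel]
      exact norm_sub_le _ _
    have h2 : ‖z‖⁻¹ * (‖z‖ * ‖y n‖) = ‖y n‖ := inv_mul_cancel_left₀ hz0.ne' _
    have h3 := mul_le_mul_of_nonneg_left (h1.trans (add_le_add hm (hC n))) (inv_pos.2 hz0).le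
    rw [h2] at h3
    linarith

/-- Bounded perturbed orbits decay if a polynomial without roots on the unit circle kills them. -/
lemma exists_rate_polynomial {V : Type*} [NormedAddCommGroup V] [NormedSpace ℂ V]
    [FiniteDimensional ℂ V] (f : Module.End ℂ V) (l : List ℂ) (hl : ∀ z ∈ l, ‖z‖ ≠ 1) {θ : ℝ}
    (hθ : 0 < θ) (hθ1 : θ < 1) :
    ∃ ρ, θ ≤ ρ ∧ ρ < 1 ∧ ∀ y e : ℕ → V, (∀ n, y (n + 1) = f (y n) + e n) →
      (∃ M, ∀ n, ‖y n‖ ≤ M) → (∃ C, ∀ n, ‖e n‖ ≤ C * θ ^ n) →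
      (∃ C, ∀ n, ‖Polynomial.aeval f (l.map fun z => Polynomial.X - Polynomial.C z).prod (y n)‖ ≤ C * θ ^ n) →
      ∃ D, ∀ n, ‖y n‖ ≤ D * ρ ^ n := by
  induction l generalizing θ with
  | nil => exact ⟨θ, le_rfl, hθ1, fun y e _ _ _ h => by simpa using h⟩
  | cons z l ih =>
    obtain ⟨ρ₁, h1, h2, h3⟩ := exists_rate_scalar (V := V) (hl z (by simp)) hθ hθ1
    obtain ⟨ρ, h4, h5, h6⟩ := ih (fun z hz => hl z (by simp [hz])) (hθ.trans_le h1) h2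
    refine ⟨ρ, h1.trans h4, h5, fun y e hy hM ⟨C₁, hC₁⟩ ⟨C₂, hC₂⟩ => ?_⟩
    set g := Polynomial.aeval f (l.map fun z => Polynomial.X - Polynomial.C z).prod with hg
    have hbound : ∃ K, 0 ≤ K ∧ ∀ v, ‖g v‖ ≤ K * ‖v‖ :=
      ⟨‖LinearMap.toContinuousLinearMap g‖, norm_nonneg _, fun v =>
        (LinearMap.toContinuousLinearMap g).le_opNorm v⟩
    obtain ⟨K, hK0, hK⟩ := hbound
    have hmono : ∀ {C : ℝ} {x : ℕ → V}, (∀ n, ‖x n‖ ≤ C * θ ^ n) → ∀ n, ‖x n‖ ≤ C * ρ₁ ^ n := by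
      intro C x hx n
      have : 0 ≤ C := by simpa using (norm_nonneg _).trans (hx 0)
      exact (hx n).trans (mul_le_mul_of_nonneg_left (pow_le_pow_left₀ hθ.le h1 n) this)
    refine h6 y e hy hM ⟨C₁, hmono hC₁⟩ ?_
    obtain ⟨M, hM⟩ := hM
    have hcomm : ∀ v, g (f v) = f (g v) := fun v => by
      have h7 : Commute g f := by
        have := (Commute.all ((l.map fun z => Polynomial.X - Polynomial.C z).prod)
        (Polynomial.X : Polynomial ℂ)).map (Polynomial.aeval f)
        rwa [Polynomial.aeval_X] at this
      exact LinearMap.congr_fun h7 v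
    have hcons : ∀ v, Polynomial.aeval f
        (((z :: l).map fun z => Polynomial.X - Polynomial.C z).prod) v = f (g v) - z • g v := by
      intro v
      rw [List.map_cons, List.prod_cons, map_mul, map_sub, Polynomial.aeval_X,
        Polynomial.aeval_C]
      rfl
    -- With `g` the product of the remaining factors, `g (y n)` obeys the scalar recursion of
    -- multiplier `z`; its error contains the full product applied to `y n`, small by hypothesis.
    -- Each root is peeled off at the price of a slower rate, without a Jordan form.
    refine h3 (fun n => g (y n)) (fun n => (f (g (y n)) - z • g (y n)) + g (e n)) (fun n => ?_)
      ⟨K * M, fun n => (hK _).trans (mul_le_mul_of_nonneg_left (hM n) hK0)⟩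
      ⟨C₂ + K * C₁, fun n => ?_⟩
    · rw [hy n, map_add, hcomm]
      abel
    · refine (norm_add_le _ _).trans ?_
      rw [← hcons]
      have := (hK (e n)).trans (mul_le_mul_of_nonneg_left (hC₁ n) hK0)
      linarith [hC₂ n]

/-- Bounded perturbed orbits of a hyperbolic matrix decay exponentially. -/
theorem IsHyperbolicMatrix.exists_rate {d : ℕ} {A : Matrix (Fin d) (Fin d) ℕ}
    (hA : IsHyperbolicMatrix A) {θ : ℝ} (hθ : 0 < θ) (hθ1 : θ < 1) :
    ∃ ρ, θ ≤ ρ ∧ ρ < 1 ∧ ∀ y : ℕ → Fin d → ℝ, (∃ M, ∀ n i, |y n i| ≤ M) →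
      (∃ C, ∀ n i, |y (n + 1) i - ∑ j, A i j * y n j| ≤ C * θ ^ n) →
      ∃ D, ∀ n i, |y n i| ≤ D * ρ ^ n := by
  set A' := A.map (Nat.cast : ℕ → ℂ) with hA'
  obtain ⟨l, hl⟩ : ∃ l : List ℂ, (l : Multiset ℂ) = A'.charpoly.roots := Quot.exists_rep _
  have hprod : (l.map fun z => Polynomial.X - Polynomial.C z).prod = A'.charpoly := by
    have h1 := (IsAlgClosed.splits A'.charpoly).eq_prod_roots_of_monic A'.charpoly_monic
    rw [← hl] at h1
    rw [h1]
    simp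
  have hroots : ∀ z ∈ l, ‖z‖ ≠ 1 := fun z hz => by
    refine hA z ?_
    have h1 : z ∈ A'.charpoly.roots := by rw [← hl]; exact hz
    exact Matrix.mem_spectrum_iff_isRoot_charpoly.2 (Polynomial.isRoot_of_mem_roots h1)
  obtain ⟨ρ, h1, h2, h3⟩ := exists_rate_polynomial (Matrix.toLin' A') l hroots hθ hθ1
  refine ⟨ρ, h1, h2, fun y ⟨M, hM⟩ ⟨C, hC⟩ => ?_⟩
  have hM0 : 0 ≤ max M 0 := le_max_right _ _
  have hC0 : 0 ≤ max C 0 := le_max_right _ _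
  obtain ⟨D, hD⟩ := h3 (fun n i => (y n i : ℂ))
    (fun n i => ((y (n + 1) i - ∑ j, A i j * y n j : ℝ) : ℂ)) (fun n => by
      ext i
      simp [Matrix.toLin'_apply, Matrix.mulVec, dotProduct, A'])
    ⟨max M 0, fun n => (pi_norm_le_iff_of_nonneg hM0).2 fun i => by
      rw [Complex.norm_real]
      exact (hM n i).trans (le_max_left _ _)⟩
    ⟨max C 0, fun n => (pi_norm_le_iff_of_nonneg (by positivity)).2 fun i => by
      rw [Complex.norm_real]
      exact (hC n i).trans (mul_le_mul_of_nonneg_right (le_max_left _ _) (by positivity))⟩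
    -- Cayley–Hamilton: the full product of the root factors annihilates the orbit.
    ⟨0, fun n => by
      rw [hprod, ← Matrix.charpoly_toLin', LinearMap.aeval_self_charpoly]
      simp⟩
  refine ⟨D, fun n i => ?_⟩
  have h4 := (norm_le_pi_norm (fun i => (y n i : ℂ)) i).trans (hD n)
  rwa [Complex.norm_real] at h4

end Hyperbolic

/-! ### Contraction by stochastic matrices, forwards and for the transpose. -/

section Stochastic

variable {d : ℕ} {B : Matrix (Fin d) (Fin d) ℝ}

lemma sum_mulVec_of_stochastic (h1 : ∀ j, ∑ i, B i j = 1) (u : Fin d → ℝ) :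
    ∑ i, (B.mulVec u) i = ∑ j, u j := by
  simp only [Matrix.mulVec, dotProduct]
  rw [Finset.sum_comm]
  exact Finset.sum_congr rfl fun j _ => by rw [← Finset.sum_mul, h1, one_mul]

lemma sum_abs_mulVec_le {a : ℝ} (h0 : ∀ i j, 0 ≤ B i j) (h1 : ∀ j, ∑ i, B i j = a)
    (u : Fin d → ℝ) : ∑ i, |(B.mulVec u) i| ≤ a * ∑ j, |u j| := by
  calc ∑ i, |(B.mulVec u) i| ≤ ∑ i, ∑ j, B i j * |u j| := Finset.sum_le_sum fun i _ =>
        (Finset.abs_sum_le_sum_abs (fun j => B i j * u j) Finset.univ).trans_eq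
          (Finset.sum_congr rfl fun j _ => by rw [abs_mul, abs_of_nonneg (h0 i j)])
    _ = ∑ j, (∑ i, B i j) * |u j| := by
        rw [Finset.sum_comm]
        exact Finset.sum_congr rfl fun j _ => by rw [Finset.sum_mul]
    _ = a * ∑ j, |u j| := by simp only [h1, Finset.mul_sum]

lemma stochastic_pow (h0 : ∀ i j, 0 ≤ B i j) (h1 : ∀ j, ∑ i, B i j = 1) (k : ℕ) :
    (∀ i j, 0 ≤ (B ^ k) i j) ∧ ∀ j, ∑ i, (B ^ k) i j = 1 := by
  induction k with
  | zero =>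
    refine ⟨fun i j => ?_, fun j => by simp [Matrix.one_apply]⟩
    rw [pow_zero, Matrix.one_apply]
    split_ifs <;> norm_num
  | succ k ih =>
    refine ⟨fun i j => ?_, fun j => ?_⟩
    · rw [pow_succ', Matrix.mul_apply]
      exact Finset.sum_nonneg fun l _ => mul_nonneg (h0 i l) (ih.1 l j)
    · simp only [pow_succ', Matrix.mul_apply]
      rw [Finset.sum_comm]
      simp only [← Finset.sum_mul, h1, one_mul, ih.2 j]

/-- A nonnegative stochastic matrix with a positive row contracts the vectors of zero sum. -/
lemma sum_abs_mulVec_le_of_row {α : ℝ} (h0 : ∀ i j, 0 ≤ B i j) (h1 : ∀ j, ∑ i, B i j = 1)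
    {i₀ : Fin d} (hα : ∀ j, α ≤ B i₀ j) {u : Fin d → ℝ} (hu : ∑ j, u j = 0) :
    ∑ i, |(B.mulVec u) i| ≤ (1 - α) * ∑ j, |u j| := by
  -- Subtracting `α` from the row `i₀` does not change the action on vectors of zero sum and lowers
  -- the column sums to `1 - α`.
  let B' : Matrix (Fin d) (Fin d) ℝ := Matrix.of fun i j => B i j - if i = i₀ then α else 0
  have h2 : B.mulVec u = B'.mulVec u := by
    ext i
    simp only [Matrix.mulVec, dotProduct, B', Matrix.of_apply, sub_mul, Finset.sum_sub_distrib,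
      ← Finset.mul_sum, hu, mul_zero, sub_zero]
  rw [h2]
  refine sum_abs_mulVec_le (fun i j => ?_) (fun j => ?_) u
  · simp only [B', Matrix.of_apply]
    split_ifs with h
    · rw [h]
      linarith [hα j]
    · simpa using h0 i j
  · simp [B', Finset.sum_sub_distrib, h1]

/-- An adapted norm for the action of a stochastic matrix on vectors of zero sum. -/
theorem exists_adapted_norm (h0 : ∀ i j, 0 ≤ B i j) (h1 : ∀ j, ∑ i, B i j = 1) {i₀ : Fin d}
    {k : ℕ} (hk : 0 < k) (hpos : ∀ j, 0 < (B ^ k) i₀ j) :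
    ∃ (P : (Fin d → ℝ) → ℝ) (r K : ℝ), 0 < r ∧ r < 1 ∧ 0 < K ∧
      (∀ u v, P (u + v) ≤ P u + P v) ∧ (∀ u, ∑ j, |u j| ≤ P u) ∧
      (∀ u, P u ≤ K * ∑ j, |u j|) ∧ ∀ u, ∑ j, u j = 0 → P (B.mulVec u) ≤ r * P u := by
  have : Nonempty (Fin d) := ⟨i₀⟩
  obtain ⟨j₀, hj₀⟩ := Finite.exists_min fun j => (B ^ k) i₀ j
  set α := (B ^ k) i₀ j₀
  -- Since `r ^ k` exceeds the contraction factor of `B ^ k`, the sum of the norms of `B ^ s u`, `s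
  -- < k`, weighted by `r ^ (-s)`, is contracted by `r` at every single step.
  obtain ⟨r, ⟨hr0, hr1⟩, hrα⟩ : ∃ r : ℝ, r ∈ Ioo (0 : ℝ) 1 ∧ 1 - α < r ^ k := by
    have h2 : Tendsto (fun r : ℝ => r ^ k) (𝓝[<] 1) (𝓝 1) := by
      have := (continuous_pow (M := ℝ) k).tendsto 1
      rw [one_pow] at this
      exact this.mono_left nhdsWithin_le_nhds
    have h3 : 1 - α < 1 := by linarith [hpos j₀]
    exact ((show ∀ᶠ r : ℝ in 𝓝[<] 1, r ∈ Ioo (0 : ℝ) 1 from Ioo_mem_nhdsLT one_pos).and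
      (h2.eventually (lt_mem_nhds h3))).exists
  have hrk : 0 < r ^ k := pow_pos hr0 k
  let ℓ : (Fin d → ℝ) → ℝ := fun u => ∑ j, |u j|
  have hℓ0 : ∀ u, 0 ≤ ℓ u := fun u => Finset.sum_nonneg fun _ _ => abs_nonneg _
  have hℓB : ∀ s u, ℓ ((B ^ s).mulVec u) ≤ ℓ u := fun s u => by
    simpa using sum_abs_mulVec_le (stochastic_pow h0 h1 s).1 (stochastic_pow h0 h1 s).2 u
  refine ⟨fun u => ∑ s ∈ Finset.range k, (r⁻¹) ^ s * ℓ ((B ^ s).mulVec u), r,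
    ∑ s ∈ Finset.range k, (r⁻¹) ^ s, hr0, hr1, ?_, fun u v => ?_, fun u => ?_, fun u => ?_,
    fun u hu => ?_⟩
  · exact Finset.sum_pos (fun s _ => by positivity) ⟨0, Finset.mem_range.2 hk⟩
  · rw [← Finset.sum_add_distrib]
    refine Finset.sum_le_sum fun s _ => ?_
    rw [← mul_add, Matrix.mulVec_add]
    refine mul_le_mul_of_nonneg_left ?_ (by positivity)
    simp only [ℓ]
    rw [← Finset.sum_add_distrib]
    exact Finset.sum_le_sum fun j _ => abs_add_le _ _
  · have := Finset.single_le_sum (f := fun s => (r⁻¹) ^ s * ℓ ((B ^ s).mulVec u))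
      (fun s _ => mul_nonneg (by positivity) (hℓ0 _)) (Finset.mem_range.2 hk)
    simpa [ℓ] using this
  · rw [Finset.sum_mul]
    exact Finset.sum_le_sum fun s _ => mul_le_mul_of_nonneg_left (hℓB s u) (by positivity)
  · have h2 : ∀ s ∈ Finset.range k, (r⁻¹) ^ s * ℓ ((B ^ s).mulVec (B.mulVec u)) =
        r * ((r⁻¹) ^ (s + 1) * ℓ ((B ^ (s + 1)).mulVec u)) := fun s _ => by
      rw [Matrix.mulVec_mulVec, ← pow_succ, pow_succ r⁻¹]
      field_simp
    simp only
    rw [Finset.sum_congr rfl h2, ← Finset.mul_sum]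
    refine mul_le_mul_of_nonneg_left ?_ hr0.le
    have h3 := Finset.sum_range_succ (fun s => (r⁻¹) ^ s * ℓ ((B ^ s).mulVec u)) k
    rw [Finset.sum_range_succ'] at h3
    have h4 : ℓ ((B ^ k).mulVec u) ≤ r ^ k * ℓ u :=
      (sum_abs_mulVec_le_of_row (stochastic_pow h0 h1 k).1 (stochastic_pow h0 h1 k).2 hj₀ hu).trans
        (mul_le_mul_of_nonneg_right hrα.le (hℓ0 u))
    have h5 : (r⁻¹) ^ k * ℓ ((B ^ k).mulVec u) ≤ ℓ u := by
      rw [inv_pow, inv_mul_le_iff₀ hrk]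
      exact h4
    simp only [pow_zero, Matrix.one_mulVec, one_mul] at h3
    linarith

/-- Perturbed orbits of zero sum of a stochastic matrix decay exponentially. -/
theorem exists_rate_of_stochastic (h0 : ∀ i j, 0 ≤ B i j) (h1 : ∀ j, ∑ i, B i j = 1) {i₀ : Fin d}
    {k : ℕ} (hk : 0 < k) (hpos : ∀ j, 0 < (B ^ k) i₀ j) :
    ∃ ε > 0, ∀ θ : ℝ, 0 < θ → θ < 1 → ∃ ρ, θ ≤ ρ ∧ ρ < 1 ∧ ∀ v : ℕ → Fin d → ℝ,
      (∀ n, ∑ j, v n j = 0) →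
      (∃ C, 0 ≤ C ∧ ∀ n i, |v (n + 1) i - B.mulVec (v n) i| ≤ ε * ∑ j, |v n j| + C * θ ^ n) →
      ∃ D, ∀ n, ∑ j, |v n j| ≤ D * ρ ^ n := by
  obtain ⟨P, r, K, hr0, hr1, hK, hadd, hlow, hup, hcon⟩ := exists_adapted_norm h0 h1 hk hpos
  have hd : 0 < (d : ℝ) := by exact_mod_cast i₀.pos
  -- Half of the gap `1 - r` is left to the proportional error; `d` passes from coordinates to the
  -- sum, and `K` to the adapted norm. The threshold does not depend on `θ`.
  refine ⟨(1 - r) / (2 * (K * d)), by have := sub_pos.2 hr1; positivity, fun θ hθ hθ1 => ?_⟩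
  set ε := (1 - r) / (2 * (K * d)) with hε
  have hεK : K * d * ε = (1 - r) / 2 := by rw [hε]; field_simp
  have hε0 : 0 ≤ ε := by have := sub_pos.2 hr1; positivity
  obtain ⟨ρ, hρ1, hρ2⟩ := exists_between (max_lt (show (1 + r) / 2 < 1 by linarith) hθ1)
  refine ⟨ρ, (le_max_right _ _).trans hρ1.le, hρ2, fun v hv ⟨C, hC0, hC⟩ => ?_⟩
  obtain ⟨D, hD⟩ := exists_forward_bound (r := (1 + r) / 2) (by linarith)
    ((le_max_left _ _).trans_lt hρ1) hθ.le ((le_max_right _ _).trans hρ1.le)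
    (a := fun n => P (v n)) (C := K * d * C) (by positivity) fun n => by
      have h2 : ∑ i, |(v (n + 1) - B.mulVec (v n)) i| ≤ d * (ε * P (v n) + C * θ ^ n) := by
        refine (Finset.sum_le_sum fun i _ => hC n i).trans ?_
        rw [Finset.sum_const, Finset.card_univ, Fintype.card_fin, nsmul_eq_mul]
        have := mul_le_mul_of_nonneg_left (hlow (v n)) hε0
        gcongr
      have h3 := hadd (B.mulVec (v n)) (v (n + 1) - B.mulVec (v n))
      rw [add_sub_cancel] at h3
      have h4 := (hup (v (n + 1) - B.mulVec (v n))).trans (mul_le_mul_of_nonneg_left h2 hK.le)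
      have h5 := hcon (v n) (hv n)
      have h6 : K * (d * (ε * P (v n) + C * θ ^ n)) =
        (1 - r) / 2 * P (v n) + K * d * C * θ ^ n := by rw [← hεK]; ring
      linarith
  exact ⟨D, fun n => (hlow _).trans (hD n)⟩

/-- Backward orbits of the transpose of a stochastic matrix become constant. -/
theorem exists_backward_of_stochastic (h0 : ∀ i j, 0 ≤ B i j) (h1 : ∀ j, ∑ i, B i j = 1)
    {i₀ : Fin d} {k : ℕ} (hk : 0 < k) (hpos : ∀ j, 0 < (B ^ k) i₀ j) :
    ∃ δ > 0, ∀ θ : ℝ, 0 < θ → θ < 1 → ∀ (z : ℕ → Fin d → ℝ) (c : ℕ → ℝ),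
      (∃ M, ∀ n i, |z n i| ≤ M) → (∀ n, 0 ≤ c n ∧ c n ≤ 1 + δ) →
      (∃ C, 0 ≤ C ∧ ∀ n j, |z n j - c n * ∑ i, B i j * z (n + 1) i| ≤ C * θ ^ n) →
      ∃ D, ∀ n a b, |z n a - z n b| ≤ D * θ ^ n := by
  obtain ⟨P, r, K, hr0, hr1, hK, -, hlow, hup, hcon⟩ := exists_adapted_norm h0 h1 hk hpos
  -- Chosen so that `r (1 + δ) = (1 + r) / 2 < 1`.
  have hδ : 0 < (1 - r) / (2 * r) := div_pos (sub_pos.2 hr1) (by positivity)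
  refine ⟨(1 - r) / (2 * r), hδ, fun θ hθ hθ1 z c ⟨M, hM⟩ hc ⟨C, hC0, hC⟩ => ?_⟩
  have hrδ : r * (1 + (1 - r) / (2 * r)) = (1 + r) / 2 := by field_simp; ring
  have hM0 : 0 ≤ M := (abs_nonneg _).trans (hM 0 i₀)
  have hP0 : ∀ u, 0 ≤ P u := fun u =>
    (Finset.sum_nonneg fun _ _ => abs_nonneg _).trans (hlow u)
  -- A dual norm: `z n` is measured as a functional on vectors of zero sum, which `B` contracts.
  -- Testing on a difference of two basis vectors bounds the oscillation.
  let Q : ℕ → ℝ → Prop := fun n m =>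
    0 ≤ m ∧ ∀ u : Fin d → ℝ, ∑ j, u j = 0 → |∑ j, u j * z n j| ≤ m * P u
  have hQ := backward_bound (Q := Q) (r := (1 + r) / 2) (θ := θ) (C := C) (M := M) (by linarith)
    (by linarith) hθ hθ1.le
    (fun n m m' hmm ⟨hm, h⟩ => ⟨hm.trans hmm, fun u hu =>
      (h u hu).trans (mul_le_mul_of_nonneg_right hmm (hP0 u))⟩) hC0
    (fun n => ⟨hM0, fun u _ => by
      refine (Finset.abs_sum_le_sum_abs _ _).trans ?_
      refine le_trans ?_ (mul_le_mul_of_nonneg_left (hlow u) hM0)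
      rw [Finset.mul_sum]
      refine Finset.sum_le_sum fun j _ => ?_
      rw [abs_mul, mul_comm]
      exact mul_le_mul_of_nonneg_right (hM n j) (abs_nonneg _)⟩)
    (fun n m ⟨hm, h⟩ => by
      have hθn : 0 ≤ C * θ ^ n := by positivity
      refine ⟨add_nonneg (mul_nonneg (by linarith) hm) hθn, fun u hu => ?_⟩
      have h2 : ∑ j, u j * z n j = c n * ∑ i, B.mulVec u i * z (n + 1) i +
          ∑ j, u j * (z n j - c n * ∑ i, B i j * z (n + 1) i) := by
        have h3 : ∑ i, B.mulVec u i * z (n + 1) i =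
            ∑ j, u j * ∑ i, B i j * z (n + 1) i := by
          simp only [Matrix.mulVec, dotProduct, Finset.sum_mul, Finset.mul_sum]
          rw [Finset.sum_comm]
          exact Finset.sum_congr rfl fun j _ => Finset.sum_congr rfl fun i _ => by ring
        rw [h3, Finset.mul_sum, ← Finset.sum_add_distrib]
        exact Finset.sum_congr rfl fun j _ => by ring
      have h4 := h (B.mulVec u) (by rw [sum_mulVec_of_stochastic h1, hu])
      have h5 : |∑ j, u j * (z n j - c n * ∑ i, B i j * z (n + 1) i)| ≤ C * θ ^ n * P u := by
        refine (Finset.abs_sum_le_sum_abs _ _).trans ?_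
        refine le_trans ?_ (mul_le_mul_of_nonneg_left (hlow u) hθn)
        rw [Finset.mul_sum]
        refine Finset.sum_le_sum fun j _ => ?_
        rw [abs_mul, mul_comm]
        exact mul_le_mul_of_nonneg_right (hC n j) (abs_nonneg _)
      have h6 : c n * |∑ i, B.mulVec u i * z (n + 1) i| ≤ (1 + r) / 2 * m * P u := by
        calc c n * |∑ i, B.mulVec u i * z (n + 1) i|
            ≤ (1 + (1 - r) / (2 * r)) * (m * (r * P u)) :=
              mul_le_mul (hc n).2 (h4.trans (mul_le_mul_of_nonneg_left (hcon u hu) hm))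
                (abs_nonneg _) (by linarith)
          _ = r * (1 + (1 - r) / (2 * r)) * m * P u := by ring
          _ = _ := by rw [hrδ]
      rw [h2]
      refine (abs_add_le _ _).trans ?_
      rw [abs_mul, abs_of_nonneg (hc n).1]
      linarith)
  refine ⟨(C / (1 - (1 + r) / 2) + 1) * (K * 2), fun n a b => ?_⟩
  obtain ⟨hm, h⟩ := hQ n
  let u : Fin d → ℝ := fun j => (if j = a then 1 else 0) - if j = b then 1 else 0
  have h2 := h u (by simp [u])
  have h3 : ∑ j, u j * z n j = z n a - z n b := by simp [u, sub_mul, Finset.sum_sub_distrib]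
  have h4 : ∑ j, |u j| ≤ 2 := by
    calc ∑ j, |u j| ≤ ∑ j, ((if j = a then 1 else 0) + if j = b then (1 : ℝ) else 0) :=
          Finset.sum_le_sum fun j _ => by
            simp only [u]
            split_ifs <;> norm_num
      _ = 2 := by rw [Finset.sum_add_distrib]; simp; norm_num
  rw [h3] at h2
  refine h2.trans ?_
  have h5 : P u ≤ K * 2 := (hup u).trans (mul_le_mul_of_nonneg_left h4 hK.le)
  calc _ ≤ (C / (1 - (1 + r) / 2) + 1) * θ ^ n * (K * 2) := mul_le_mul_of_nonneg_left h5 hm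
    _ = _ := by ring

end Stochastic

/-! ### The linear model at `T₀`, and uniform control near it. -/

namespace GIET

variable {d : ℕ} {σ : Equiv.Perm (Fin d)} {T : GIET σ} {N : Fin d → ℕ} {w : Fin d → ℕ → Fin d}
  {κ : Fin d → Fin d} {τ : Fin d → ℕ} {x₀ : ℝ}

lemma top_le_one (T : GIET σ) (i : Fin d) : T.top i ≤ 1 := by
  rw [← T.sum_top]
  exact Finset.single_le_sum (fun k _ => (T.top_pos k).le) (Finset.mem_univ i)

lemma sum_itinerary (N : Fin d → ℕ) (w : Fin d → ℕ → Fin d) (i : Fin d) (f : Fin d → ℝ) :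
    ∑ s ∈ Finset.range (N i), f (w i s) =
      ∑ j, ((Finset.range (N i)).filter (fun s => w i s = j)).card * f j := by
  rw [← Finset.sum_fiberwise (Finset.range (N i)) (w i)]
  refine Finset.sum_congr rfl fun j _ => ?_
  rw [Finset.sum_congr rfl fun s hs => by rw [(Finset.mem_filter.1 hs).2], Finset.sum_const,
    nsmul_eq_mul]

lemma IsStandard.logDer_eq_zero (hT : T.IsStandard) (j : Fin d) {x : ℝ}
    (hx : x ∈ Icc (0 : ℝ) 1) : (T.φ j).logDer x = 0 := by
  have h := ((T.φ j).jet_bounds (T.φ j) (hT.2 j) (ε := 0) (by norm_num)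
    (by rw [IntervalDiffeo.cDist_self]) hx).1
  simpa using h

lemma IsStandard.logSlope_eq_zero (hT : T.IsStandard) (j : Fin d) : T.logSlope j = 0 := by
  rw [logSlope, hT.1, div_self (T.top_pos j).ne', Real.log_one]

/-- The lengths of a self-similar standard interval exchange form an eigenvector. -/
lemma IsInduced.top_eq (hT : T.IsStandard) (hx₀ : x₀ ≤ 1) (h : IsInduced T T N w x₀) (j : Fin d) :
    T.top j =
      x₀ * ∑ i, ((Finset.range (N i)).filter (fun s => w i s = j)).card * T.top i := by
  have h1 := h.abs_top_sub_le hx₀ (δ := 0) (κ := 0) zero_le_one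
    (fun j x hx => by rw [hT.logDer_eq_zero j hx, abs_zero])
    (fun j => by rw [hT.logSlope_eq_zero j, abs_zero]) (fun i => by simp) j
  rw [mul_zero, zero_mul] at h1
  exact sub_eq_zero.1 (abs_nonpos_iff.1 h1)

/-- The action of renormalisation on the total non-linearities of the branches. -/
def nonlinMatrix (T : GIET σ) (x₀ : ℝ) : Matrix (Fin d) (Fin d) ℝ :=
  Matrix.of fun i j => x₀ * T.top i * T.intersectionMatrix x₀ i j / T.top j

lemma nonlinMatrix_nonneg (h0 : 0 < x₀) (i j : Fin d) : 0 ≤ T.nonlinMatrix x₀ i j :=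
  div_nonneg (mul_nonneg (mul_nonneg h0.le (T.top_pos i).le) (Nat.cast_nonneg _)) (T.top_pos j).le

/-- The matrix is `x₀` times the conjugate of the intersection matrix by the diagonal matrix of the
lengths, so positivity of entries passes to its powers. -/
lemma nonlinMatrix_pow (k : ℕ) (i j : Fin d) : (T.nonlinMatrix x₀ ^ k) i j =
    x₀ ^ k * T.top i * ((T.intersectionMatrix x₀ ^ k) i j : ℕ) / T.top j := by
  induction k generalizing i j with
  | zero =>
    have := (T.top_pos j).ne'
    rcases eq_or_ne i j with rfl | hij
    · simp [this]
    · simp [hij]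
  | succ k ih =>
    rw [pow_succ' (T.nonlinMatrix x₀), pow_succ' (T.intersectionMatrix x₀), pow_succ' x₀,
      Matrix.mul_apply, Matrix.mul_apply]
    push_cast
    rw [Finset.mul_sum, Finset.sum_div]
    refine Finset.sum_congr rfl fun l _ => ?_
    rw [ih, nonlinMatrix, Matrix.of_apply]
    have := (T.top_pos l).ne'
    field_simp

/-- The lengths form an eigenvector of the transposed intersection matrix, with eigenvalue `1 / x₀`.
-/
lemma sum_nonlinMatrix (hT : T.IsStandard) (hx₀ : x₀ ≤ 1) (h : IsInduced T T N w x₀)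
    (ht : Towers T N w κ τ (fun k => x₀ * T.topCut k)) (j : Fin d) :
    ∑ i, T.nonlinMatrix x₀ i j = 1 := by
  simp only [nonlinMatrix, Matrix.of_apply]
  rw [← Finset.sum_div, div_eq_one_iff_eq (T.top_pos j).ne']
  conv_rhs => rw [h.top_eq hT hx₀ j, Finset.mul_sum]
  refine Finset.sum_congr rfl fun i _ => ?_
  rw [ht.intersectionMatrix_apply h.pos]
  ring

/-- `S` and its renormalisation `S'` are `δ`-close to the standard interval exchange `T`. -/
structure IsControlled (T : GIET σ) (N : Fin d → ℕ) (w : Fin d → ℕ → Fin d) (x₀ δ : ℝ)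
    (S S' : GIET σ) (X : ℝ) : Prop where
  induced : IsInduced S S' N w X
  logDer : ∀ j, ∀ x ∈ Icc (0 : ℝ) 1, |(S.φ j).logDer x| ≤ δ
  nonlin : ∀ j, ∀ x ∈ Icc (0 : ℝ) 1, |(S.φ j).nonlin x| ≤ δ
  schwarzian : ∀ j, ∀ x ∈ Icc (0 : ℝ) 1, |(S.φ j).schwarzian x| ≤ δ
  logSlope : ∀ j, |S.logSlope j| ≤ δ
  base : |X - x₀| ≤ δ
  ratio : ∀ i, ∀ s < N i,
    |floorLength S S' w X i s / S.top (w i s) - x₀ * T.top i / T.top (w i s)| ≤ δ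

/-- Renormalisation is controlled on a small neighbourhood. -/
theorem exists_controlled (hT : T.IsStandard) {X : GIET σ → ℝ}
    (hX : Tendsto X T.near (𝓝 x₀)) {R : GIET σ → GIET σ} {ε₀ : ℝ} (hε₀ : 0 < ε₀)
    (hR : ∀ S, cDist 3 S T < ε₀ → IsInduced S (R S) N w (X S)) (h : IsInduced T T N w x₀)
    {δ : ℝ} (hδ : 0 < δ) :
    ∃ ε > 0, ε ≤ ε₀ ∧ ∀ S, cDist 3 S T < ε → cDist 3 (R S) T < ε →
      IsControlled T N w x₀ δ S (R S) (X S) := by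
  have e1 : ∀ᶠ S in T.near, ∀ j, |S.logSlope j| ≤ δ := by
    refine eventually_all.2 fun j => ?_
    have h1 : Tendsto (fun S : GIET σ => S.logSlope j) T.near (𝓝 (T.logSlope j)) :=
      ((T.tendsto_bot (σ j)).div (T.tendsto_top j) (T.top_pos j).ne').log
        (div_pos (T.bot_pos _) (T.top_pos j)).ne'
    rw [hT.logSlope_eq_zero] at h1
    filter_upwards [Metric.tendsto_nhds.1 h1 δ hδ] with S hS
    rw [Real.dist_eq, sub_zero] at hS
    exact hS.le
  have e2 : ∀ᶠ S in T.near, |X S - x₀| ≤ δ := by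
    filter_upwards [Metric.tendsto_nhds.1 hX δ hδ] with S hS
    exact hS.le
  -- Floor lengths involve both `S` and its renormalisation; requiring both to be close to `T`
  -- dispenses with the continuity of `R`.
  have e3 : ∀ᶠ p in T.near ×ˢ T.near, ∀ i, ∀ s ∈ Iio (N i),
      |floorLength p.1 p.2 w (X p.1) i s / p.1.top (w i s) -
        x₀ * T.top i / T.top (w i s)| ≤ δ := by
    refine eventually_all.2 fun i => (eventually_all_finite (finite_Iio _)).2 fun s hs => ?_
    have hcut : ∀ k, Tendsto (fun p : GIET σ × GIET σ => X p.1 * p.2.topCut k)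
        (T.near ×ˢ T.near) (𝓝 (x₀ * T.topCut k)) := fun k =>
      (hX.comp tendsto_fst).mul ((T.tendsto_topCut k).comp tendsto_snd)
    have hword : ∀ k, Tendsto (fun p : GIET σ × GIET σ => p.1.word (w i) s (X p.1 * p.2.topCut k))
        (T.near ×ˢ T.near) (𝓝 (T.word (w i) s (x₀ * T.topCut k))) := fun k =>
      tendsto_orderIso_apply (fun z => (T.tendsto_word (w i) s z).comp tendsto_fst) (hcut k)
    have h1 := ((hword (i + 1)).sub (hword i)).div ((T.tendsto_top (w i s)).comp tendsto_fst)
      (T.top_pos _).ne'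
    have h2 : T.word (w i) s (x₀ * T.topCut (i + 1)) - T.word (w i) s (x₀ * T.topCut i) =
        x₀ * T.top i := by
      have h3 := h.floorLength_bounds (δ := 0)
        (fun j x hx => by rw [hT.logDer_eq_zero j hx, abs_zero])
        (fun j => by rw [hT.logSlope_eq_zero j, abs_zero]) (le_of_lt (show s < N i from hs))
      simp only [mul_zero, zero_mul, neg_zero, Real.exp_zero, one_mul] at h3
      exact le_antisymm h3.2 h3.1
    rw [h2] at h1
    filter_upwards [Metric.tendsto_nhds.1 h1 δ hδ] with p hp
    exact hp.le
  obtain ⟨pa, hpa, pb, hpb, h3⟩ := eventually_prod_iff.1 e3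
  obtain ⟨ε₁, hε₁, h4⟩ := eventually_near_iff.1 ((e1.and e2).and (hpa.and hpb))
  -- The bounds `1 / 4` and `δ / 4` are the threshold and the constants of `jet_bounds`.
  refine ⟨min ε₀ (min ε₁ (min (1 / 4) (δ / 4))), by positivity, min_le_left _ _,
    fun S hS hS' => ?_⟩
  obtain ⟨h5, h6⟩ := lt_min_iff.1 hS
  obtain ⟨h7, h8⟩ := lt_min_iff.1 h6
  have h9 := ((lt_min_iff.1 hS').2)
  obtain ⟨⟨h10, h11⟩, h12, -⟩ := h4 S h7
  obtain ⟨-, -, h13⟩ := h4 (R S) (lt_min_iff.1 h9).1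
  have hjet : ∀ j, ∀ x ∈ Icc (0 : ℝ) 1, |(S.φ j).logDer x| ≤ 2 * (δ / 4) ∧
      |(S.φ j).nonlin x| ≤ 2 * (δ / 4) ∧ |(S.φ j).schwarzian x| ≤ 4 * (δ / 4) := by
    intro j x hx
    have h14 := (S.φ j).jet_bounds (T.φ j) (hT.2 j) (min_le_left _ _)
      ((cDist_φ_le 3 S T j).trans h8.le) hx
    have h15 := min_le_right (1 / 4 : ℝ) (δ / 4)
    exact ⟨h14.1.trans (by linarith), h14.2.1.trans (by linarith), h14.2.2.trans (by linarith)⟩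
  exact ⟨hR S h5, fun j x hx => (hjet j x hx).1.trans (by linarith),
    fun j x hx => (hjet j x hx).2.1.trans (by linarith),
    fun j x hx => (hjet j x hx).2.2.trans (by linarith), h10, h11,
    fun i s hs => h3 h12 h13 i s hs⟩

section Orbit

variable {δ θ : ℝ} {S : ℕ → GIET σ} {X : ℕ → ℝ}

/-- The Schwarzian derivatives decay exponentially under renormalisation. -/
theorem exists_schwarzian_bound (h : ∀ n, IsControlled T N w x₀ δ (S n) (S (n + 1)) (X n))
    (hθ : ∀ n, X n * Real.exp (3 * (2 * δ * ∑ i, (N i : ℝ))) ≤ θ) (hδ : 0 < δ) :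
    ∃ C, 0 ≤ C ∧ ∀ n j, ∀ x ∈ Icc (0 : ℝ) 1, |((S n).φ j).schwarzian x| ≤ C * θ ^ n := by
  have hθ0 : 0 ≤ θ := (mul_nonneg (h 0).induced.pos.le (Real.exp_pos _).le).trans (hθ 0)
  have hN : ∀ i, 2 * δ * N i ≤ 2 * δ * ∑ i, (N i : ℝ) := fun i =>
    mul_le_mul_of_nonneg_left (Finset.single_le_sum (f := fun i => (N i : ℝ))
      (fun _ _ => Nat.cast_nonneg _) (Finset.mem_univ i)) (by positivity)
  set C := ∑ j, δ / (S 0).top j with hC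
  have hC0 : 0 ≤ C := Finset.sum_nonneg fun j _ => (div_pos hδ ((S 0).top_pos j)).le
  have key : ∀ n, ∃ q : Fin d → ℝ, (∀ j, ∀ x ∈ Icc (0 : ℝ) 1,
      |((S n).φ j).schwarzian x| ≤ (S n).top j * q j) ∧ ∑ j, q j ≤ C * θ ^ n := by
    intro n
    induction n with
    | zero =>
      refine ⟨fun j => δ / (S 0).top j, fun j x hx => ?_, by simp [hC]⟩
      rw [mul_div_cancel₀ _ ((S 0).top_pos j).ne']
      exact (h 0).schwarzian j x hx
    | succ n ih =>
      obtain ⟨q, hq, hqs⟩ := ih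
      obtain ⟨q', hq', hqs'⟩ := (h n).induced.schwarzian_contraction (h n).logDer (h n).logSlope
        hN hq
      refine ⟨q', hq', hqs'.trans ?_⟩
      have hq0 : 0 ≤ ∑ j, q j := Finset.sum_nonneg fun j _ =>
        nonneg_of_mul_nonneg_right ((abs_nonneg _).trans (hq j 0 (by simp))) ((S n).top_pos j)
      calc _ ≤ θ * (C * θ ^ n) := mul_le_mul (hθ n) hqs hq0 hθ0
        _ = C * θ ^ (n + 1) := by ring
  refine ⟨C, hC0, fun n j x hx => ?_⟩
  obtain ⟨q, hq, hqs⟩ := key n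
  have hq0 : ∀ j, 0 ≤ q j := fun j =>
    nonneg_of_mul_nonneg_right ((abs_nonneg _).trans (hq j 0 (by simp))) ((S n).top_pos j)
  calc _ ≤ (S n).top j * q j := hq j x hx
    _ ≤ 1 * q j := mul_le_mul_of_nonneg_right ((S n).top_le_one j) (hq0 j)
    _ ≤ ∑ j, q j := by
      rw [one_mul]
      exact Finset.single_le_sum (fun j _ => hq0 j) (Finset.mem_univ j)
    _ ≤ _ := hqs

/-- The distance to the set of projective interval exchanges is controlled by the Schwarzian
derivatives. -/
theorem c1DistTo_moebius_le (S : GIET σ) {s : ℝ}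
    (hψ : ∀ j, ∀ x ∈ Icc (0 : ℝ) 1, |(S.φ j).logDer x| ≤ 1)
    (hs : ∀ j, ∀ x ∈ Icc (0 : ℝ) 1, |(S.φ j).schwarzian x| ≤ s) :
    S.c1DistTo {P : GIET σ | P.IsMoebius} ≤ d * (2000 * s) := by
  choose g hg hgs using fun j => (S.φ j).exists_moebius_near (hψ j) (hs j)
  -- Keeping the lengths, only the branches contribute to the distance.
  let P : GIET σ := { S with φ := g }
  have h1 : S.c1DistTo {P : GIET σ | P.IsMoebius} ≤ cDist 1 S P :=
    csInf_le ⟨0, by rintro _ ⟨Q, -, rfl⟩; exact cDist_nonneg 1 S Q⟩ ⟨P, hg, rfl⟩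
  refine h1.trans ?_
  have h2 : cDist 1 S P = ∑ j, (S.φ j).cDist 1 (g j) := by simp [cDist, P]
  rw [h2]
  refine (Finset.sum_le_sum fun j _ => hgs j).trans ?_
  rw [Finset.sum_const, Finset.card_univ, Fintype.card_fin, nsmul_eq_mul]

end Orbit

end GIET

/-! ### Exponential convergence to `T₀` for zero total non-linearity. -/

namespace GIET

variable {d : ℕ} {σ : Equiv.Perm (Fin d)} {T : GIET σ} {N : Fin d → ℕ} {w : Fin d → ℕ → Fin d}
  {κ : Fin d → Fin d} {τ : Fin d → ℕ} {x₀ : ℝ}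

lemma abs_bot_sub_le_of_logSlope (hT : T.IsStandard) (S : GIET σ) (i : Fin d)
    (hL : |S.logSlope i| ≤ 1) :
    |S.bot (σ i) - T.bot (σ i)| ≤ 2 * |S.logSlope i| + |S.top i - T.top i| := by
  have ht := S.top_pos i
  have h1 : S.bot (σ i) = S.top i * Real.exp (S.logSlope i) := by
    rw [logSlope, Real.exp_log (div_pos (S.bot_pos _) ht), mul_div_cancel₀ _ ht.ne']
  have h2 : S.bot (σ i) - T.bot (σ i) =
      S.top i * (Real.exp (S.logSlope i) - 1) + (S.top i - T.top i) := by
    rw [h1, hT.1]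
    ring
  rw [h2]
  refine (abs_add_le _ _).trans (add_le_add_left ?_ _)
  rw [abs_mul, abs_of_pos ht]
  calc S.top i * |Real.exp (S.logSlope i) - 1| ≤ 1 * (2 * |S.logSlope i|) :=
        mul_le_mul (S.top_le_one i) (abs_exp_sub_one_le_two_mul hL) (abs_nonneg _) zero_le_one
    _ = _ := one_mul _

/-- The average of the ratios, weighted by the lengths of `T`, is `1`; if they nearly agree, each is
close to `1`. -/
lemma abs_top_sub_le_of_ratio (S : GIET σ) {D : ℝ}
    (hD : ∀ a b, |S.top a / T.top a - S.top b / T.top b| ≤ D) (a : Fin d) :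
    |S.top a - T.top a| ≤ D := by
  have ht := T.top_pos a
  have hD0 : 0 ≤ D := (abs_nonneg _).trans (hD a a)
  have h1 : S.top a / T.top a - 1 =
      ∑ b, T.top b * (S.top a / T.top a - S.top b / T.top b) := by
    simp only [mul_sub, Finset.sum_sub_distrib, ← Finset.sum_mul, T.sum_top, one_mul]
    rw [Finset.sum_congr rfl fun b _ => mul_div_cancel₀ (S.top b) (T.top_pos b).ne', S.sum_top]
  have h2 : |S.top a / T.top a - 1| ≤ D := by
    rw [h1]
    refine (Finset.abs_sum_le_sum_abs _ _).trans ?_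
    calc _ ≤ ∑ b, T.top b * D := Finset.sum_le_sum fun b _ => by
          rw [abs_mul, abs_of_pos (T.top_pos b)]
          exact mul_le_mul_of_nonneg_left (hD a b) (T.top_pos b).le
      _ = D := by rw [← Finset.sum_mul, T.sum_top, one_mul]
  have h3 : S.top a - T.top a = T.top a * (S.top a / T.top a - 1) := by field_simp
  rw [h3, abs_mul, abs_of_pos ht]
  calc _ ≤ 1 * D := mul_le_mul (T.top_le_one a) h2 (abs_nonneg _) zero_le_one
    _ = D := one_mul D

variable {δ θ ρ : ℝ} {S : ℕ → GIET σ} {X : ℕ → ℝ}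

/-- The total non-linearities of the branches decay exponentially when their sum is zero. -/
lemma exists_totalNonlin_bound {εB : ℝ}
    (hrate : ∀ v : ℕ → Fin d → ℝ, (∀ n, ∑ j, v n j = 0) →
      (∃ C, 0 ≤ C ∧ ∀ n i, |v (n + 1) i - (T.nonlinMatrix x₀).mulVec (v n) i| ≤
        εB * ∑ j, |v n j| + C * θ ^ n) → ∃ D, ∀ n, ∑ j, |v n j| ≤ D * ρ ^ n)
    (ht : Towers T N w κ τ (fun k => x₀ * T.topCut k)) (hx₀ : 0 < x₀)
    (h : ∀ n, IsControlled T N w x₀ δ (S n) (S (n + 1)) (X n)) (hδ : 0 < δ) (hδ1 : δ ≤ 1)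
    (hδB : 2 * δ * ∑ i, (N i : ℝ) ≤ εB) (hθ : 0 < θ)
    (hs : ∃ C, 0 ≤ C ∧ ∀ n j, ∀ x ∈ Icc (0 : ℝ) 1, |((S n).φ j).schwarzian x| ≤ C * θ ^ n)
    (h0 : ∑ j, ((S 0).φ j).totalNonlin = 0) :
    ∃ D, ∀ n, ∑ j, |((S n).φ j).totalNonlin| ≤ D * ρ ^ n := by
  obtain ⟨C, hC0, hC⟩ := hs
  have hsum : ∀ n, ∑ j, ((S n).φ j).totalNonlin = 0 := by
    intro n
    induction n with
    | zero => exact h0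
    | succ n ih => rw [(h n).induced.sum_totalNonlin, ih]
  refine hrate (fun n j => ((S n).φ j).totalNonlin) hsum
    ⟨(∑ i, (N i : ℝ)) * (2 * C), by positivity, fun n i => ?_⟩
  have h1 := (h n).induced.abs_totalNonlin_sub_le (s₀ := C * θ ^ n) (ε := δ)
    (B := fun i j => x₀ * T.top i / T.top j)
    (fun j => (((S n).φ j).nonlin_bounds hδ.le hδ1 ((h n).nonlin j) (hC n j)).1) (h n).ratio i
  rw [sum_itinerary N w i fun j => x₀ * T.top i / T.top j * ((S n).φ j).totalNonlin] at h1
  have h2 : (T.nonlinMatrix x₀).mulVec (fun j => ((S n).φ j).totalNonlin) i =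
      ∑ j, ((Finset.range (N i)).filter (fun s => w i s = j)).card *
        (x₀ * T.top i / T.top j * ((S n).φ j).totalNonlin) := by
    simp only [Matrix.mulVec, dotProduct, nonlinMatrix, Matrix.of_apply]
    refine Finset.sum_congr rfl fun j _ => ?_
    rw [ht.intersectionMatrix_apply hx₀]
    ring
  rw [h2]
  refine h1.trans ?_
  have hNi : (N i : ℝ) ≤ ∑ i, (N i : ℝ) :=
    Finset.single_le_sum (f := fun i => (N i : ℝ)) (fun _ _ => Nat.cast_nonneg _)
      (Finset.mem_univ i)
  have hv : 0 ≤ ∑ j, |((S n).φ j).totalNonlin| := Finset.sum_nonneg fun _ _ => abs_nonneg _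
  calc (N i : ℝ) * (2 * (C * θ ^ n) + 2 * δ * ∑ j, |((S n).φ j).totalNonlin|)
      ≤ (∑ i, (N i : ℝ)) * (2 * (C * θ ^ n) + 2 * δ * ∑ j, |((S n).φ j).totalNonlin|) :=
        mul_le_mul_of_nonneg_right hNi (by positivity)
    _ = 2 * δ * (∑ i, (N i : ℝ)) * ∑ j, |((S n).φ j).totalNonlin| +
        (∑ i, (N i : ℝ)) * (2 * C) * θ ^ n := by ring
    _ ≤ _ := add_le_add_left (mul_le_mul_of_nonneg_right hδB hv) _

/-- The lengths converge exponentially when the branches become affine of slope one. -/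
lemma exists_top_bound {δB D₁ : ℝ}
    (hback : ∀ (z : ℕ → Fin d → ℝ) (c : ℕ → ℝ), (∃ M, ∀ n i, |z n i| ≤ M) →
      (∀ n, 0 ≤ c n ∧ c n ≤ 1 + δB) →
      (∃ C, 0 ≤ C ∧ ∀ n j, |z n j - c n * ∑ i, T.nonlinMatrix x₀ i j * z (n + 1) i| ≤ C * ρ ^ n) →
      ∃ D, ∀ n a b, |z n a - z n b| ≤ D * ρ ^ n)
    (ht : Towers T N w κ τ (fun k => x₀ * T.topCut k)) (hx₀ : 0 < x₀)
    (h : ∀ n, IsControlled T N w x₀ δ (S n) (S (n + 1)) (X n)) (hδ : 0 < δ)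
    (hδ1 : δ ≤ 1 - x₀) (hδB : δ ≤ δB * x₀) (hδN : 2 * δ * ∑ i, (N i : ℝ) ≤ 1) (hρ : 0 < ρ)
    (hD₁ : 0 ≤ D₁)
    (hφ : ∀ n j, ∀ x ∈ Icc (0 : ℝ) 1, |((S n).φ j).logDer x| ≤ D₁ * ρ ^ n)
    (hL : ∀ n j, |(S n).logSlope j| ≤ D₁ * ρ ^ n) :
    ∃ D, ∀ n j, |(S n).top j - T.top j| ≤ D * ρ ^ n := by
  set NN := ∑ i, (N i : ℝ) with hNN
  have hNN0 : 0 ≤ NN := Finset.sum_nonneg fun _ _ => Nat.cast_nonneg _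
  have hNi : ∀ i, (N i : ℝ) ≤ NN := fun i =>
    Finset.single_le_sum (f := fun i => (N i : ℝ)) (fun _ _ => Nat.cast_nonneg _)
      (Finset.mem_univ i)
  have hdec : ∀ n j, |(S n).top j -
      X n * ∑ i, ((Finset.range (N i)).filter (fun s => w i s = j)).card * (S (n + 1)).top i| ≤
        4 * D₁ * NN ^ 2 * ρ ^ n := by
    intro n j
    -- The minimum combines the uniform bound, which keeps the distortion below `1`, with the
    -- decaying one, which gives the rate.
    have h1 : min δ (D₁ * ρ ^ n) ≤ δ := min_le_left _ _
    have h2 : min δ (D₁ * ρ ^ n) ≤ D₁ * ρ ^ n := min_le_right _ _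
    have h0 : 0 ≤ min δ (D₁ * ρ ^ n) := le_min hδ.le (by positivity)
    have hX1 : X n ≤ 1 := by linarith [(abs_le.1 (h n).base).2]
    have h3 := (h n).induced.abs_top_sub_le hX1 (δ := min δ (D₁ * ρ ^ n))
      (κ := 2 * min δ (D₁ * ρ ^ n) * NN)
      (le_trans (mul_le_mul_of_nonneg_right (by linarith) hNN0) hδN)
      (fun j x hx => le_min ((h n).logDer j x hx) (hφ n j x hx))
      (fun j => le_min ((h n).logSlope j) (hL n j))
      (fun i => mul_le_mul_of_nonneg_left (hNi i) (by positivity)) j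
    refine h3.trans ?_
    calc 2 * (2 * min δ (D₁ * ρ ^ n) * NN) * NN = 4 * NN ^ 2 * min δ (D₁ * ρ ^ n) := by ring
      _ ≤ 4 * NN ^ 2 * (D₁ * ρ ^ n) := mul_le_mul_of_nonneg_left h2 (by positivity)
      _ = _ := by ring
  have hinv : ∀ j, 1 / T.top j ≤ ∑ j, 1 / T.top j := fun j =>
    Finset.single_le_sum (f := fun j => 1 / T.top j)
      (fun j _ => (one_div_pos.2 (T.top_pos j)).le) (Finset.mem_univ j)
  -- The recursion is written for the lengths relative to those of `T`; the factor `X n / x₀`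
  -- accounts for the variation of the base.
  obtain ⟨D, hD⟩ := hback (fun n j => (S n).top j / T.top j) (fun n => X n / x₀)
    ⟨∑ j, 1 / T.top j, fun n i => by
      rw [abs_of_pos (div_pos ((S n).top_pos i) (T.top_pos i))]
      exact (div_le_div_of_nonneg_right ((S n).top_le_one i) (T.top_pos i).le).trans (hinv i)⟩
    (fun n => ⟨div_nonneg (h n).induced.pos.le hx₀.le, by
      rw [div_le_iff₀ hx₀]
      linarith [(abs_le.1 (h n).base).2]⟩)
    ⟨(∑ j, 1 / T.top j) * (4 * D₁ * NN ^ 2), by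
      have : 0 ≤ ∑ j, 1 / T.top j :=
        Finset.sum_nonneg fun j _ => (one_div_pos.2 (T.top_pos j)).le
      positivity, fun n j => by
      have hj := T.top_pos j
      have h1 : (S n).top j / T.top j - X n / x₀ *
          ∑ i, T.nonlinMatrix x₀ i j * ((S (n + 1)).top i / T.top i) =
          1 / T.top j * ((S n).top j - X n * ∑ i,
            ((Finset.range (N i)).filter (fun s => w i s = j)).card * (S (n + 1)).top i) := by
        have h2 : ∑ i, T.nonlinMatrix x₀ i j * ((S (n + 1)).top i / T.top i) =
            x₀ / T.top j * ∑ i,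
              ((Finset.range (N i)).filter (fun s => w i s = j)).card * (S (n + 1)).top i := by
          rw [Finset.mul_sum]
          refine Finset.sum_congr rfl fun i _ => ?_
          have hi := (T.top_pos i).ne'
          rw [nonlinMatrix, Matrix.of_apply, ht.intersectionMatrix_apply hx₀]
          field_simp
        rw [h2]
        field_simp
      rw [h1, abs_mul, abs_of_pos (one_div_pos.2 hj), mul_assoc]
      exact mul_le_mul (hinv j) (hdec n j) (abs_nonneg _)
        ((one_div_pos.2 hj).le.trans (hinv j))⟩
  exact ⟨D, fun n j => abs_top_sub_le_of_ratio (T := T) (S n) (hD n) j⟩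

/-- Exponential convergence of the renormalisations when the total non-linearity vanishes. -/
theorem exists_convergence_rate (hT : T.IsStandard) (hx₀ : 0 < x₀) (hx₁ : x₀ < 1)
    (hind : IsInduced T T N w x₀) (ht : Towers T N w κ τ (fun k => x₀ * T.topCut k))
    {i₀ : Fin d} {k : ℕ} (hk : 0 < k) (hpos : ∀ j, 0 < (T.intersectionMatrix x₀ ^ k) i₀ j)
    (hyp : IsHyperbolicMatrix (T.intersectionMatrix x₀)) (hθ : 0 < θ) (hθ1 : θ < 1) :
    ∃ δ₁ > 0, ∃ ρ, 0 < ρ ∧ ρ < 1 ∧ ∀ δ > 0, δ ≤ δ₁ → ∀ (S : ℕ → GIET σ) (X : ℕ → ℝ),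
      (∀ n, IsControlled T N w x₀ δ (S n) (S (n + 1)) (X n)) →
      (∃ C, 0 ≤ C ∧ ∀ n j, ∀ x ∈ Icc (0 : ℝ) 1, |((S n).φ j).schwarzian x| ≤ C * θ ^ n) →
      ∑ j, ((S 0).φ j).totalNonlin = 0 → ∃ D, ∀ n, cDist 1 (S n) T ≤ D * ρ ^ n := by
  have hB0 := T.nonlinMatrix_nonneg hx₀
  have hB1 := sum_nonlinMatrix hT hx₁.le hind ht
  have hBpos : ∀ j, 0 < (T.nonlinMatrix x₀ ^ k) i₀ j := fun j => by
    rw [nonlinMatrix_pow]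
    have h1 := T.top_pos i₀
    have h2 := T.top_pos j
    have h3 : (0 : ℝ) < ((T.intersectionMatrix x₀ ^ k) i₀ j : ℕ) := by exact_mod_cast hpos j
    positivity
  obtain ⟨εB, hεB, hrate⟩ := exists_rate_of_stochastic hB0 hB1 hk hBpos
  obtain ⟨δB, hδB, hback⟩ := exists_backward_of_stochastic hB0 hB1 hk hBpos
  -- Rates only deteriorate: `θ` for the Schwarzians, `ρ₁` for the non-linearities, `ρ` for slopes
  -- and lengths. The thresholds `εB` and `δB` were fixed before any rate.
  obtain ⟨ρ₁, hθρ, hρ₁, hrate⟩ := hrate θ hθ hθ1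
  have hρ₁0 := hθ.trans_le hθρ
  obtain ⟨ρ, hρρ, hρ, hlog⟩ := hyp.exists_rate hρ₁0 hρ₁
  have hρ0 := hρ₁0.trans_le hρρ
  set NN := ∑ i, (N i : ℝ) with hNN
  have hNN0 : 0 ≤ NN := Finset.sum_nonneg fun _ _ => Nat.cast_nonneg _
  have hNi : ∀ i, (N i : ℝ) ≤ NN := fun i =>
    Finset.single_le_sum (f := fun i => (N i : ℝ)) (fun _ _ => Nat.cast_nonneg _)
      (Finset.mem_univ i)
  have hx₂ : 0 < 1 - x₀ := sub_pos.2 hx₁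
  -- The terms guarantee, in order, the hypothesis of `nonlin_bounds`, a proportional error below
  -- `εB`, `X n ≤ 1`, `X n / x₀ ≤ 1 + δB`, and distortion at most `1`. The `+ 1` makes the
  -- denominators visibly positive.
  refine ⟨min (min 1 (εB / (2 * (NN + 1)))) (min (min (1 - x₀) (δB * x₀)) (1 / (2 * (NN + 1)))),
    by positivity, ρ, hρ0, hρ, fun δ hδ hδ₁ S X h hs h0 => ?_⟩
  obtain ⟨h1, h2⟩ := le_min_iff.1 hδ₁
  obtain ⟨hδ1, h1⟩ := le_min_iff.1 h1
  obtain ⟨h2, h3⟩ := le_min_iff.1 h2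
  obtain ⟨hδx, hδb⟩ := le_min_iff.1 h2
  rw [le_div_iff₀ (by positivity)] at h1 h3
  have hδε : 2 * δ * NN ≤ εB := by nlinarith
  have hδN : 2 * δ * NN ≤ 1 := by nlinarith
  obtain ⟨D₁, hD₁⟩ := exists_totalNonlin_bound hrate ht hx₀ h hδ hδ1 hδε hθ hs h0
  obtain ⟨C, hC0, hC⟩ := hs
  have hD₁0 : 0 ≤ D₁ := by
    have := (Finset.sum_nonneg fun j _ => abs_nonneg _).trans (hD₁ 0)
    simpa using this
  have hpow : ∀ n, θ ^ n ≤ ρ₁ ^ n := fun n => pow_le_pow_left₀ hθ.le hθρ n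
  have hpow' : ∀ n, ρ₁ ^ n ≤ ρ ^ n := fun n => pow_le_pow_left₀ hρ₁0.le hρρ n
  set D₂ := 2 * (D₁ + C) with hD₂
  have hD₂0 : 0 ≤ D₂ := by positivity
  have hφ : ∀ n j, ∀ x ∈ Icc (0 : ℝ) 1, |((S n).φ j).logDer x| ≤ D₂ * ρ₁ ^ n := fun n j x hx => by
    have h4 := (((S n).φ j).nonlin_bounds hδ.le hδ1 ((h n).nonlin j) (hC n j)).2 x hx
    have h5 : |((S n).φ j).totalNonlin| ≤ D₁ * ρ₁ ^ n :=
      (Finset.single_le_sum (f := fun j => |((S n).φ j).totalNonlin|)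
        (fun _ _ => abs_nonneg _) (Finset.mem_univ j)).trans (hD₁ n)
    have h6 := mul_le_mul_of_nonneg_left (hpow n) hC0
    have h7 : D₂ * ρ₁ ^ n = 2 * (D₁ * ρ₁ ^ n + C * ρ₁ ^ n) := by rw [hD₂]; ring
    linarith
  -- Remaining in the neighbourhood bounds the slopes, which is what excludes the expanding
  -- directions.
  obtain ⟨D₃, hD₃⟩ := hlog (fun n j => (S n).logSlope j) ⟨δ, fun n j => (h n).logSlope j⟩
    ⟨(NN + 1) * D₂, fun n i => by
      have h4 := (h n).induced.abs_logSlope_sub_le (hφ n) (fun j x hx => (hφ (n + 1) j x hx).trans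
        (mul_le_mul_of_nonneg_left (pow_le_pow_of_le_one hρ₁0.le hρ₁.le (Nat.le_succ n)) hD₂0)) i
      rw [sum_itinerary N w i] at h4
      simp only [ht.intersectionMatrix_apply hx₀]
      have h5 : 0 ≤ D₂ * ρ₁ ^ n := by positivity
      have h6 := mul_le_mul_of_nonneg_right (hNi i) h5
      linarith⟩
  have hD₃0 : 0 ≤ D₃ := by simpa using (abs_nonneg _).trans (hD₃ 0 i₀)
  have hφ' : ∀ n j, ∀ x ∈ Icc (0 : ℝ) 1, |((S n).φ j).logDer x| ≤ (D₂ + D₃) * ρ ^ n :=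
    fun n j x hx => (hφ n j x hx).trans
      (mul_le_mul (by linarith) (hpow' n) (by positivity) (by positivity))
  have hL' : ∀ n j, |(S n).logSlope j| ≤ (D₂ + D₃) * ρ ^ n := fun n j => (hD₃ n j).trans
    (mul_le_mul_of_nonneg_right (by linarith) (by positivity))
  obtain ⟨D₄, hD₄⟩ := exists_top_bound (hback ρ hρ0 hρ) ht hx₀ h hδ hδx hδb hδN hρ0
    (by positivity) hφ' hL'
  refine ⟨d * D₄ + d * (2 * (D₂ + D₃) + D₄) + d * (2 * (D₂ + D₃)), fun n => ?_⟩
  have hcard : ∀ c : ℝ, ∑ _j : Fin d, c = d * c := fun c => by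
    rw [Finset.sum_const, Finset.card_univ, Fintype.card_fin, nsmul_eq_mul]
  have e1 : ∑ i, |(S n).top i - T.top i| ≤ d * (D₄ * ρ ^ n) := by
    rw [← hcard]
    exact Finset.sum_le_sum fun i _ => hD₄ n i
  have e2 : ∑ j, |(S n).bot j - T.bot j| ≤ d * (2 * ((D₂ + D₃) * ρ ^ n) + D₄ * ρ ^ n) := by
    rw [← Equiv.sum_comp σ, ← hcard]
    refine Finset.sum_le_sum fun i _ =>
      (abs_bot_sub_le_of_logSlope hT (S n) i (((h n).logSlope i).trans hδ1)).trans ?_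
    linarith [hL' n i, hD₄ n i]
  have e3 : ∑ i, ((S n).φ i).cDist 1 (T.φ i) ≤ d * (2 * ((D₂ + D₃) * ρ ^ n)) := by
    rw [← hcard]
    refine Finset.sum_le_sum fun i _ => ?_
    refine (((S n).φ i).cDist_one_id_le (T.φ i) (hT.2 i) (M := min δ ((D₂ + D₃) * ρ ^ n))
      ((min_le_left _ _).trans hδ1)
      fun x hx => le_min ((h n).logDer i x hx) (hφ' n i x hx)).trans ?_
    exact mul_le_mul_of_nonneg_left (min_le_right _ _) zero_le_two
  rw [cDist]
  calc _ ≤ d * (D₄ * ρ ^ n) + d * (2 * ((D₂ + D₃) * ρ ^ n) + D₄ * ρ ^ n) +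
        d * (2 * ((D₂ + D₃) * ρ ^ n)) := add_le_add (add_le_add e1 e2) e3
    _ = _ := by ring

end GIET

/-! ### Choice of the neighbourhood and conclusion. -/

theorem mainTheorem4 {g : ℕ} (hg : 2 ≤ g) (σ : Equiv.Perm (Fin (2 * g)))
    (hσ : numMarkedPoints σ = 1) (T₀ : GIET σ) (x₀ : ℝ)
    (hstd : T₀.IsStandard) (hconn : T₀.NoConnection)
    (hself : GIET.IsRescaledFirstReturn x₀ T₀ T₀)
    (hyp : IsHyperbolicMatrix (T₀.intersectionMatrix x₀)) :
    ∃ (W : Set (GIET σ)) (X : GIET σ → ℝ) (R : GIET σ → GIET σ),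
      GIET.IsRenormalisationOperator T₀ x₀ W X R ∧
      (∃ ρ₁ : ℝ, 0 < ρ₁ ∧ ρ₁ < 1 ∧ ∀ T ∈ GIET.preStable W R, ∃ C : ℝ, ∀ n : ℕ,
        GIET.c1DistTo (R^[n] T) {P : GIET σ | P.IsMoebius} ≤ C * ρ₁ ^ n) ∧
      (∃ ρ₂ : ℝ, 0 < ρ₂ ∧ ρ₂ < 1 ∧ ∀ T ∈ GIET.preStable W R, T.totalNonlinearity = 0 →
        ∃ D : ℝ, ∀ n : ℕ, GIET.cDist 1 (R^[n] T) T₀ ≤ D * ρ₂ ^ n) := by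
  have hd : 2 ≤ 2 * g := by omega
  have hx₀ := hself.1
  have hx₁ := hself.2.1
  obtain ⟨N, w, κ, τ, X, R, ht, hX, ε₀, hε₀, hren, hind⟩ :=
    GIET.exists_renormalisation hd hσ hstd hconn hself
  obtain ⟨-, hXT, hRT, -, -⟩ := hren ε₀ hε₀ le_rfl
  have hindT : GIET.IsInduced T₀ T₀ N w x₀ := by
    have := hind T₀ (by rwa [GIET.cDist_self])
    rwa [hXT, hRT] at this
  obtain ⟨i₀, k, hk, hpos⟩ := GIET.exists_intersectionMatrix_row_pos hd hσ hstd hconn hself ht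
  -- Any rate `θ` between `x₀` and `1` will do for the Schwarzians: the contraction factor,
  -- distortion included, tends to `x₀` as `δ` tends to `0`.
  obtain ⟨x₂, hx₂, hx₂'⟩ := exists_between hx₁
  obtain ⟨θ, hθ, hθ1⟩ := exists_between hx₂'
  have hθ0 : 0 < θ := (hx₀.trans hx₂).trans hθ
  obtain ⟨δ₁, hδ₁, ρ, hρ0, hρ1, hconv⟩ := GIET.exists_convergence_rate hstd hx₀ hx₁ hindT ht hk
    hpos hyp hθ0 hθ1
  have hlim : Tendsto (fun δ : ℝ => (x₀ + δ) * Real.exp (3 * (2 * δ * ∑ i, (N i : ℝ)))) (𝓝[>] 0)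
      (𝓝 x₀) := by
    have h1 : Continuous fun δ : ℝ => (x₀ + δ) * Real.exp (3 * (2 * δ * ∑ i, (N i : ℝ))) := by
      fun_prop
    have h2 := h1.tendsto 0
    simp only [add_zero, mul_zero, zero_mul, Real.exp_zero, mul_one] at h2
    exact h2.mono_left nhdsWithin_le_nhds
  obtain ⟨δ, hδθ, hδ0, hδ⟩ := ((hlim.eventually (gt_mem_nhds (hx₂.trans hθ))).and
    (Ioo_mem_nhdsGT (show 0 < min 1 δ₁ by positivity))).exists
  obtain ⟨hδ1, hδδ⟩ := lt_min_iff.1 hδ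
  obtain ⟨ε, hε, hεε, hctrl⟩ := GIET.exists_controlled hstd (hXT ▸ hX T₀) hε₀ hind hindT hδ0
  have hC : ∀ T ∈ GIET.preStable {S | GIET.cDist 3 S T₀ < ε} R, ∀ n,
      GIET.IsControlled T₀ N w x₀ δ (R^[n] T) (R^[n + 1] T) (X (R^[n] T)) := fun T hT n => by
    have h1 := hctrl (R^[n] T) (hT n)
    rw [← Function.iterate_succ_apply' R n T] at h1
    exact h1 (hT (n + 1))
  have hθn : ∀ T ∈ GIET.preStable {S | GIET.cDist 3 S T₀ < ε} R, ∀ n,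
      X (R^[n] T) * Real.exp (3 * (2 * δ * ∑ i, (N i : ℝ))) ≤ θ := fun T hT n =>
    (mul_le_mul_of_nonneg_right (by linarith [(abs_le.1 (hC T hT n).base).2])
      (Real.exp_pos _).le).trans hδθ.le
  refine ⟨{S | GIET.cDist 3 S T₀ < ε}, X, R, hren ε hε hεε, ⟨θ, hθ0, hθ1, fun T hT => ?_⟩,
    ⟨ρ, hρ0, hρ1, fun T hT hT0 => ?_⟩⟩
  · obtain ⟨C, -, hCb⟩ := GIET.exists_schwarzian_bound (hC T hT) (hθn T hT) hδ0
    refine ⟨(2 * g : ℕ) * (2000 * C), fun n => ?_⟩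
    refine (GIET.c1DistTo_moebius_le (R^[n] T)
      (fun j x hx => ((hC T hT n).logDer j x hx).trans hδ1.le) (hCb n)).trans (le_of_eq ?_)
    ring
  · rw [GIET.totalNonlinearity_eq] at hT0
    exact hconv δ hδ0 hδδ.le (fun n => R^[n] T) (fun n => X (R^[n] T)) (hC T hT)
      (GIET.exists_schwarzian_bound (hC T hT) (hθn T hT) hδ0) hT0

end
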